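/- **Conventions.** The Fourier transform is $\mathcal F[u](\xi)=(2\pi)^{-1/2}\int_{\mathbb R}e^{-ix\xi}u(x)\,dx$ on $\mathcal S(\mathbb R)$, extended to tempered distributions by $\langle\mathcal F[T],\varphi\rangle=\langle T,\mathcal F[\varphi]\rangle$. For $\operatorname{Re}a>-1$ and $l\in\mathbb N=\{0,1,2,\dots\}$, $x_\pm^a\ln^l|x|$ is the locally integrable function equal to $|x|^a\ln^l|x|$ for $\pm x>0$ and to $0$ otherwise. For $a\in\mathbb C\setminus\mathbb Z_{<0}$ one sets $$x_\pm^a=\frac{(\pm1)^k\,\partial_x^k x_\pm^{a+k}}{(a+1)\cdots(a+k)}\quad(\operatorname{Re}a+k>-1),\qquad x_\pm^a\ln^l|x|=\partial_a^l\,x_\pm^a ,$$ as tempered distributions. $(\xi\mp i0)^b\ln^m(\xi\mp i0)$ is the limit in $\mathcal S'(\mathbb R)$ as $\eta\to0^+$ of $(\xi\mp i\eta)^b\ln^m(\xi\mp i\eta)$ (principal branch). A cut-off function $\omega$ is a smooth compactly supported function, nonnegative, equal to $1$ near $0$. $g=O([\xi]^{-\infty})$ means that $g(\xi)=O(|\xi|^{-N})$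 as $|\xi|\to\infty$ for every $N$. In all formulas either all upper or all lower signs are taken. **Statement.** Let $a\in\mathbb C\setminus\mathbb Z_{<0}$ and $l\in\mathbb N$. 1. There is $k\in\mathbb N$ with $\operatorname{Re}a+k>-1$, and for every such $k$ $$\mathcal F[x_\pm^a\ln^l|x|](\xi)=(\pm i)^k\,\xi^k\,\partial_a^l\left(\frac{\mathcal F[x_\pm^{a+k}](\xi)}{(a+1)\cdots(a+k)}\right)$$ in $\mathcal S'(\mathbb R)$, where $\partial_a^l$ acts after pairing with a test function, the paired expression being analytic in $a$. In particular the right-hand side does not depend on $k$. 2. There are constants $c_0^+\neq0,c_1^+,\dots,c_l^+$ and $c_0^-,\dots,c_l^-$, depending only on $a$, $l$ and the sign, with $$c_j^-=e^{\mp(-a-1)\pi i}\sum_{i=0}^{j}\binom{l-i}{j-i}(\mp i\pi)^{j-i}\,c_i^+\qquad(0\le j\le l)$$ (where $i\pi$ in $(\mp i\pi)^{j-i}$ denotes $\sqrt{-1}\,\pi$), such that in $\mathcal S'(\mathbb R)$ $$\mathcal F[x_\pm^a\ln^l|x|](\xi)=\sum_{j=0}^l c_j^+\,(\xi\mp i0)^{-a-1}\ln^{l-j}(\xi\mp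 i0),$$ and such that $$\mathcal F[x_\pm^a\ln^l|x|](\xi)=\sum_{j=0}^l c_j^+\,\xi_+^{-a-1}\ln^{l-j}\xi+\sum_{j=0}^l c_j^-\,\xi_-^{-a-1}\ln^{l-j}|\xi|\qquad(\ast)$$ holds on $\mathbb R\setminus\{0\}$ (that is, tested on Schwartz functions whose support does not contain $0$) and, if $a\notin\{0,1,2,\dots\}$, also in $\mathcal S'(\mathbb R)$. In particular, for $l=0$ one has $c_0^-=e^{\pm(a+1)\pi i}c_0^+$. 3. For every cut-off function $\omega$, the restriction of $\mathcal F[(1-\omega)x_\pm^a\ln^l|x|]$ to $\mathbb R\setminus\{0\}$ is a smooth function, and it is $O([\xi]^{-\infty})$. 4. For every cut-off function $\omega$, $\mathcal F[\omega x_\pm^a\ln^l|x|]$ is a smooth function on $\mathbb R$, and with the constants of 2, as $|\xi|\to\infty$, $$\mathcal F[\omega x_\pm^a\ln^l|x|](\xi)=\sum_{j=0}^l c_j^+\,\xi_+^{-a-1}\ln^{l-j}\xi+\sum_{j=0}^l c_j^-\,\xi_-^{-a-1}\ln^{l-j}|\xi|+O([\xi]^{-\infty}).$$ -/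

import Mathlib

open scoped SchwartzMap ContDiff Topology FourierTransform
open MeasureTheory Filter

noncomputable section

namespace LogFourier

/-! ### The Fourier transform normalised by `(2π)^(-1/2)` and kernel `e^{-i x ξ}` -/

/-- `F u(ξ) = (2π)^{-1/2} ∫ e^{-i x ξ} u(x) dx` on Schwartz functions, obtained from Mathlib's
transform (kernel `e^{-2π i x ξ}`) by rescaling; see `fourierS_apply`. -/
def fourierS : 𝓢(ℝ, ℂ) →L[ℂ] 𝓢(ℝ, ℂ) :=
  (((Real.sqrt (2 * Real.pi))⁻¹ : ℝ) : ℂ) •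
    ((SchwartzMap.compCLMOfContinuousLinearEquiv ℂ
      (ContinuousLinearEquiv.unitsEquivAut ℝ
        (Units.mk0 ((2 * Real.pi)⁻¹ : ℝ) (by positivity)))) ∘L
      FourierTransform.fourierCLM ℂ 𝓢(ℝ, ℂ))

theorem fourierS_apply (u : 𝓢(ℝ, ℂ)) (ξ : ℝ) :
    fourierS u ξ = (((Real.sqrt (2 * Real.pi))⁻¹ : ℝ) : ℂ) *
      ∫ x : ℝ, Complex.exp (-(Complex.I * x * ξ)) * u x := by
  have h : fourierS u ξ = (((Real.sqrt (2 * Real.pi))⁻¹ : ℝ) : ℂ) *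
      (𝓕 (u : ℝ → ℂ)) (ξ * (2 * Real.pi)⁻¹) := by
    simp [fourierS, ← SchwartzMap.fourier_coe]
  rw [h, Real.fourier_eq']
  congr 1
  refine integral_congr_ae (Eventually.of_forall fun x => ?_)
  simp only [smul_eq_mul]
  congr 2
  have hpi : (Real.pi : ℂ) ≠ 0 := by exact_mod_cast Real.pi_ne_zero
  simp only [RCLike.inner_apply, conj_trivial]
  push_cast
  field_simp

/-- The Fourier transform of tempered distributions, `⟨F T, φ⟩ = ⟨T, F φ⟩`. -/
def fourierD : 𝓢'(ℝ, ℂ) →L[ℂ] 𝓢'(ℝ, ℂ) := PointwiseConvergenceCLM.precomp ℂ fourierS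

/-! ### Locally integrable functions as tempered distributions -/

/-- `f` is integrable against a negative power of `1 + |x|`, so that it defines a tempered
distribution. -/
def TemperedFun (f : ℝ → ℂ) : Prop :=
  ∃ N : ℕ, Integrable (fun x : ℝ => ((((1 + |x|) ^ N)⁻¹ : ℝ) : ℂ) * f x)

theorem TemperedFun.integrable_mul {f : ℝ → ℂ} {N : ℕ}
    (h : Integrable (fun x : ℝ => ((((1 + |x|) ^ N)⁻¹ : ℝ) : ℂ) * f x)) (φ : 𝓢(ℝ, ℂ)) :
    Integrable (fun x : ℝ => φ x * f x) ∧ ‖∫ x : ℝ, φ x * f x‖ ≤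
      (2 ^ N * ∫ x : ℝ, ‖((((1 + |x|) ^ N)⁻¹ : ℝ) : ℂ) * f x‖) *
        (Finset.Iic (N, 0)).sup (schwartzSeminormFamily ℂ ℝ ℂ) φ := by
  have key : ∀ x : ℝ, φ x * f x =
      ((((1 + |x|) ^ N : ℝ) : ℂ) * φ x) * (((((1 + |x|) ^ N)⁻¹ : ℝ) : ℂ) * f x) := by
    intro x
    have : (((1 + |x|) ^ N : ℝ) : ℂ) ≠ 0 := by
      have : (0 : ℝ) < (1 + |x|) ^ N := by positivity
      exact_mod_cast this.ne'
    push_cast at this ⊢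
    field_simp
  have bd : ∀ x : ℝ, ‖(((1 + |x|) ^ N : ℝ) : ℂ) * φ x‖ ≤
      2 ^ N * (Finset.Iic (N, 0)).sup (schwartzSeminormFamily ℂ ℝ ℂ) φ := by
    intro x
    have := SchwartzMap.one_add_le_sup_seminorm_apply (𝕜 := ℂ) (m := (N, 0)) (k := N) (n := 0)
      le_rfl le_rfl φ x
    rw [norm_mul, Complex.norm_real, Real.norm_of_nonneg (by positivity)]
    rw [norm_iteratedFDeriv_zero, Real.norm_eq_abs] at this
    exact this
  constructor
  · simp_rw [key]
    refine h.bdd_mul (c := 2 ^ N * (Finset.Iic (N, 0)).sup (schwartzSeminormFamily ℂ ℝ ℂ) φ)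
      ?_ (Eventually.of_forall bd)
    exact (Continuous.mul (by fun_prop) φ.continuous).aestronglyMeasurable
  · refine (norm_integral_le_integral_norm _).trans ?_
    have : ∀ x : ℝ, ‖φ x * f x‖ ≤
        (2 ^ N * (Finset.Iic (N, 0)).sup (schwartzSeminormFamily ℂ ℝ ℂ) φ) *
          ‖((((1 + |x|) ^ N)⁻¹ : ℝ) : ℂ) * f x‖ := by
      intro x
      rw [key, norm_mul]
      exact mul_le_mul_of_nonneg_right (bd x) (norm_nonneg _)
    refine (integral_mono_of_nonneg (Eventually.of_forall fun x => norm_nonneg _)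
      (h.norm.const_mul _) (Eventually.of_forall this)).trans (le_of_eq ?_)
    rw [integral_const_mul]
    ring

open Classical in
/-- The tempered distribution `φ ↦ ∫ φ f`. -/
def regularDist (f : ℝ → ℂ) : 𝓢'(ℝ, ℂ) :=
  if h : TemperedFun f then
    ContinuousLinearMap.toPointwiseConvergenceCLM _ _ _ _
      (SchwartzMap.mkCLMtoNormedSpace (σ := RingHom.id ℂ) (fun φ : 𝓢(ℝ, ℂ) => ∫ x : ℝ, φ x * f x)
        (fun φ ψ => by
          obtain ⟨N, hN⟩ := h
          simp only [add_apply, add_mul]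
          exact integral_add (TemperedFun.integrable_mul hN φ).1 (TemperedFun.integrable_mul hN ψ).1)
        (fun c φ => by
          simp only [smul_apply, smul_eq_mul, mul_assoc, RingHom.id_apply]
          exact integral_const_mul _ _)
        (by
          obtain ⟨N, hN⟩ := h
          exact ⟨Finset.Iic (N, 0), _, by positivity,
            fun φ => (TemperedFun.integrable_mul hN φ).2⟩))
  else 0

theorem regularDist_apply {f : ℝ → ℂ} (h : TemperedFun f) (φ : 𝓢(ℝ, ℂ)) :
    regularDist f φ = ∫ x : ℝ, φ x * f x := by
  rw [regularDist, dif_pos h]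
  rfl

/-! ### The distributions `x_±^a ln^l |x|` -/

/-- The function equal to `|x|^a ln^l |x|` on the half-line `σ x > 0` (`σ = 1`: positive,
`σ = -1`: negative) and to `0` elsewhere. -/
def powLogFun (σ : ℤˣ) (a : ℂ) (l : ℕ) (x : ℝ) : ℂ :=
  if 0 < ((σ : ℤ) : ℝ) * x then ((|x| : ℝ) : ℂ) ^ a * ((Real.log |x| : ℝ) : ℂ) ^ l else 0

theorem temperedFun_powLogFun (σ : ℤˣ) {a : ℂ} (ha : -1 < a.re) (l : ℕ) :
    TemperedFun (powLogFun σ a l) := by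
  have base : ∀ s : ℝ, -1 < s → ∀ N : ℕ, s + 2 ≤ N →
      Integrable (fun x : ℝ => ((1 + |x|) ^ N)⁻¹ * |x| ^ s) := by
    intro s hs N hN
    have hcont : Measurable (fun x : ℝ => ((1 + x) ^ N)⁻¹ * x ^ s) := by fun_prop
    have h1 : IntegrableOn (fun x : ℝ => ((1 + x) ^ N)⁻¹ * x ^ s) (Set.Ioi 0) := by
      rw [← Set.Ioc_union_Ioi_eq_Ioi zero_le_one]
      refine IntegrableOn.union ?_ ?_
      · have h0 : IntegrableOn (fun x : ℝ => x ^ s) (Set.Ioc 0 1) :=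
          (intervalIntegrable_iff_integrableOn_Ioc_of_le zero_le_one).1
            (intervalIntegral.intervalIntegrable_rpow' hs)
        refine Integrable.mono' h0 hcont.aestronglyMeasurable ?_
        filter_upwards [ae_restrict_mem measurableSet_Ioc] with x hx
        have hx0 : 0 < x := hx.1
        rw [Real.norm_of_nonneg (by positivity)]
        have : ((1 + x) ^ N)⁻¹ ≤ 1 := inv_le_one_of_one_le₀ (one_le_pow₀ (by linarith))
        exact mul_le_of_le_one_left (by positivity) this
      · have h0 : IntegrableOn (fun x : ℝ => x ^ (s - N)) (Set.Ioi 1) :=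
          integrableOn_Ioi_rpow_of_lt (by linarith) one_pos
        refine Integrable.mono' h0 hcont.aestronglyMeasurable ?_
        filter_upwards [ae_restrict_mem measurableSet_Ioi] with x hx
        have hx0 : 0 < x := lt_trans one_pos hx
        rw [Real.norm_of_nonneg (by positivity), Real.rpow_sub hx0, Real.rpow_natCast, div_eq_inv_mul]
        gcongr
        linarith
    have h2 : IntegrableOn (fun x : ℝ => ((1 + |x|) ^ N)⁻¹ * |x| ^ s) (Set.Ioi 0) :=
      h1.congr_fun (fun x hx => by simp only [abs_of_pos (Set.mem_Ioi.1 hx)]) measurableSet_Ioi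
    have h3 : IntegrableOn (fun x : ℝ => ((1 + |x|) ^ N)⁻¹ * |x| ^ s) (Set.Iic 0) := by
      have := h2
      rw [← neg_zero, ← integrableOn_Ici_iff_integrableOn_Ioi] at this
      have := this.comp_neg_Iic
      simpa using this
    rw [← integrableOn_univ, ← Set.Iic_union_Ioi (a := (0 : ℝ))]
    exact h3.union h2
  set r := a.re with hr
  obtain ⟨δ, hδ, hδl⟩ : ∃ δ : ℝ, 0 < δ ∧ δ * l < r + 1 := by
    refine ⟨(r + 1) / (l + 1), div_pos (by linarith) (by positivity), ?_⟩
    rw [div_mul_eq_mul_div, div_lt_iff₀ (by positivity)]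
    nlinarith
  have hlog : ∀ t : ℝ, 0 < t →
      |Real.log t| ^ l ≤ (2 / δ) ^ l * (t ^ (δ * l) + t ^ (-(δ * l))) := by
    intro t ht
    have e1 : |Real.log t| ≤ (2 / δ) * max (t ^ δ) (t ^ (-δ)) := by
      have p1 := Real.log_le_rpow_div ht.le hδ
      have p2 := Real.log_le_rpow_div (inv_pos.2 ht).le hδ
      rw [Real.log_inv, Real.inv_rpow ht.le, ← Real.rpow_neg ht.le] at p2
      have q1 : t ^ δ / δ ≤ (2 / δ) * max (t ^ δ) (t ^ (-δ)) := by
        rw [div_mul_eq_mul_div]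
        gcongr
        have := le_max_left (t ^ δ) (t ^ (-δ))
        have := Real.rpow_pos_of_pos ht δ
        linarith
      have q2 : t ^ (-δ) / δ ≤ (2 / δ) * max (t ^ δ) (t ^ (-δ)) := by
        rw [div_mul_eq_mul_div]
        gcongr
        have := le_max_right (t ^ δ) (t ^ (-δ))
        have := Real.rpow_pos_of_pos ht (-δ)
        linarith
      rw [abs_le]
      constructor <;> linarith
    calc |Real.log t| ^ l ≤ ((2 / δ) * max (t ^ δ) (t ^ (-δ))) ^ l :=
          pow_le_pow_left₀ (abs_nonneg _) e1 l
      _ = (2 / δ) ^ l * (max (t ^ δ) (t ^ (-δ))) ^ l := mul_pow _ _ _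
      _ ≤ _ := by
          gcongr
          rw [Real.rpow_mul ht.le, ← neg_mul, Real.rpow_mul ht.le, Real.rpow_natCast,
            Real.rpow_natCast]
          have := Real.rpow_pos_of_pos ht δ
          have := Real.rpow_pos_of_pos ht (-δ)
          rcases max_cases (t ^ δ) (t ^ (-δ)) with h | h <;> rw [h.1]
          · linarith [pow_pos ‹0 < t ^ (-δ)› l]
          · linarith [pow_pos ‹0 < t ^ δ› l]
  obtain ⟨N, hN⟩ := exists_nat_ge (r + δ * l + 2)
  have hδl0 : 0 ≤ δ * l := by positivity
  have b1 := base (r + δ * l) (by linarith) N hN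
  have b2 := base (r + -(δ * l)) (by linarith) N (by linarith)
  refine ⟨N, Integrable.mono' ((b1.add b2).const_mul ((2 / δ) ^ l)) ?_ ?_⟩
  · have : Measurable (powLogFun σ a l) := by
      unfold powLogFun
      refine Measurable.ite (measurableSet_lt (by fun_prop) (by fun_prop)) (by fun_prop) (by fun_prop)
    exact (Measurable.mul (by fun_prop) this).aestronglyMeasurable
  · refine Eventually.of_forall fun x => ?_
    simp only [Pi.add_apply]
    rw [norm_mul, Complex.norm_real, Real.norm_of_nonneg (by positivity), powLogFun]
    split_ifs with hx
    · have hx0 : 0 < |x| := abs_pos.2 (by rintro rfl; simp at hx)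
      rw [norm_mul, norm_pow, Complex.norm_real, Real.norm_eq_abs,
        Complex.norm_cpow_eq_rpow_re_of_pos hx0, ← hr]
      calc ((1 + |x|) ^ N)⁻¹ * (|x| ^ r * |(Real.log |x|)| ^ l)
          ≤ ((1 + |x|) ^ N)⁻¹ * (|x| ^ r *
              ((2 / δ) ^ l * (|x| ^ (δ * l) + |x| ^ (-(δ * l))))) := by
            gcongr
            exact hlog _ hx0
        _ = _ := by
            rw [Real.rpow_add hx0, Real.rpow_add hx0]
            ring
    · rw [norm_zero, mul_zero]
      positivity

/-- `x_±^a ln^l |x|` as a tempered distribution, for `a ∉ {-1, -2, …}`.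

Let `k` be the least natural number with `Re a + k > -1`. The value is
`∂_a^l ((± 1)^k ∂_x^k x_±^{a+k} / ((a + 1) ⋯ (a + k)))`, with the derivative in `a` written out by
the Leibniz rule; `x_±^{a+k} ln^m |x|` is a tempered function. For `Re a > -1` it is the function
itself (`powLogDist_of_re`). -/
def powLogDist (σ : ℤˣ) (a : ℂ) (l : ℕ) : 𝓢'(ℝ, ℂ) :=
  let k : ℕ := ⌊-a.re⌋₊
  ∑ m ∈ Finset.range (l + 1),
    ((l.choose m : ℂ) *
      iteratedDeriv (l - m) (fun z : ℂ => (∏ j ∈ Finset.range k, (z + j + 1))⁻¹) a *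
      ((σ : ℤ) : ℂ) ^ k) •
    (TemperedDistribution.derivCLM ℂ)^[k] (regularDist (powLogFun σ (a + k) m))

theorem powLogDist_exponent (a : ℂ) : -1 < (a + (⌊-a.re⌋₊ : ℂ)).re := by
  have := Nat.lt_floor_add_one (-a.re)
  simp only [Complex.add_re, Complex.natCast_re]
  linarith

theorem powLogDist_of_re (σ : ℤˣ) {a : ℂ} (ha : -1 < a.re) (l : ℕ) :
    powLogDist σ a l = regularDist (powLogFun σ a l) := by
  have hk : ⌊-a.re⌋₊ = 0 := Nat.floor_eq_zero.2 (by linarith)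
  simp only [powLogDist, hk]
  rw [Finset.sum_range_succ, Finset.sum_eq_zero]
  · simp
  · intro m hm
    have : l - m ≠ 0 := by have := Finset.mem_range.1 hm; omega
    simp only [Finset.range_zero, Finset.prod_empty, iteratedDeriv_const, this, if_false, mul_zero,
      zero_mul, inv_one]
    ext φ
    simp

/-! ### Boundary values, cut-off functions, rapid decrease -/

/-- `T` is the boundary value `f(ξ + i0)` (for `σ = 1`) or `f(ξ - i0)` (for `σ = -1`), i.e. the
limit of `f(ξ + σ i η)` as `η → 0+`, in the sense of tempered distributions. -/
def IsBoundaryValue (σ : ℤˣ) (f : ℂ → ℂ) (T : 𝓢'(ℝ, ℂ)) : Prop :=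
  ∀ φ : 𝓢(ℝ, ℂ),
    Tendsto (fun η : ℝ => ∫ ξ : ℝ, φ ξ * f (ξ + ((σ : ℤ) : ℂ) * η * Complex.I))
      (𝓝[>] 0) (𝓝 (T φ))

/-- A cut-off function around zero: smooth, compactly supported, nonnegative, equal to `1` near
zero. (No monotonicity is required.) -/
structure IsCutoff (w : ℝ → ℝ) : Prop where
  smooth : ContDiff ℝ ∞ w
  compact : HasCompactSupport w
  nonneg : ∀ x, 0 ≤ w x
  eq_one : ∀ᶠ x in 𝓝 0, w x = 1

/-- Multiplication of a tempered distribution by a real function, here `w` or `1 - w`. -/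
def mulDist (w : ℝ → ℝ) (T : 𝓢'(ℝ, ℂ)) : 𝓢'(ℝ, ℂ) :=
  TemperedDistribution.smulLeftCLM ℂ (fun x : ℝ => (w x : ℂ)) T

/-- `g = O([ξ]^{-∞})` as `|ξ| → ∞`. -/
def RapidlyDecreasing (g : ℝ → ℂ) : Prop :=
  ∀ N : ℕ, g =O[cocompact ℝ] fun ξ : ℝ => (|ξ| ^ N)⁻¹

/-- The function `∑_{j ≤ l} (c⁺_j ξ_+^b ln^{l-j} ξ + c⁻_j ξ_-^b ln^{l-j} |ξ|)` on `ξ ≠ 0`. -/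
def logPolyFun (b : ℂ) (l : ℕ) (cp cm : ℕ → ℂ) (ξ : ℝ) : ℂ :=
  ∑ j ∈ Finset.range (l + 1),
    (cp j * powLogFun 1 b (l - j) ξ + cm j * powLogFun (-1) b (l - j) ξ)

end LogFourier
end

open scoped SchwartzMap ContDiff Topology FourierTransform
open MeasureTheory Filter

noncomputable section

namespace LogFourier

/-! For Re a > -1, the pairing of x_±^a ln^l|x| with ψ is the Mellin transform of t ↦ ψ(±t) at a +
1, weighted by ln^l t. Differentiating a Mellin transform in its variable inserts ln t, so
logarithms are derivatives in the exponent; for the other admissible a the regularised pairing is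
still analytic in a (`powLogDist_eq_iteratedDeriv`). Identities are therefore proved for l = 0 and
differentiated in a, or proved for Re a > -1 and carried to the left by the recursion ∂ x_±^{a+1}
ln^l|x| = ±((a+1) x_±^a ln^l|x| + l x_±^a ln^{l-1}|x|).

Damping by e^{-ηt} turns the Fourier integral into a Laplace integral at s = ±i(ξ ∓ iη). By the
Gamma integral it equals C(a) (ξ ∓ iη)^{-a-1}, where C(a) = (2π)^{-1/2} Γ(a+1) e^{∓iπ(a+1)/2}.
Taking l derivatives in a gives the symbol with c_j^+ = (-1)^{l-j} binom(l,j) C^{(j)}(a), and η → 0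
gives the boundary value (`isBoundaryValue_holSymbol`). For ξ < 0 the logarithm tends to ln|ξ| ∓ iπ;
expanding its powers produces the c_j^-. Away from the origin the limit passes under the integral.
On the whole line this works directly for l = 0 and -1 < Re a < 0; the identity theorem on ℂ ∖ ℤ and
differentiation in a give the rest (`fourier_powLogDist_eq_sum`).

For a cut-off ω, the distribution ω x_±^a ln^l|x| is built from compactly supported integrable
functions by finitely many derivatives, so its transform is a smooth function h. Each derivative of
(1 - ω) x_±^a ln^l|x| lowers the exponent, up to a Schwartz function, so ξ^N times its transform is
bounded for all large N. Off zero that transform is P - h, with P the claimed expansion, and its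
rapid decrease settles both cut-off statements (`exists_cutoff_expansion`). -/

/-! ### Mellin transforms with logarithms -/

/-- A function on the half-line to which all Mellin transforms of positive real part apply:
continuous, bounded near zero and rapidly decreasing at infinity. -/
structure MellinRegular (f : ℝ → ℂ) : Prop where
  cont : ContinuousOn f (Set.Ioi 0)
  top : ∀ N : ℕ, f =O[atTop] fun x : ℝ => x ^ (-(N : ℝ))
  bot : f =O[𝓝[>] 0] fun _ : ℝ => (1 : ℝ)

/-- A logarithm costs less than any positive power of t. Rapid decrease at infinity survives, and
boundedness at zero weakens only to O(t^{-ε}) for every ε > 0, so Mellin integrals with any power of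
the logarithm still converge for Re s > 0. -/
theorem MellinRegular.log_pow {f : ℝ → ℂ} (hf : MellinRegular f) (l : ℕ) :
    ContinuousOn (fun t : ℝ => ((Real.log t : ℝ) : ℂ) ^ l * f t) (Set.Ioi 0) ∧
    (∀ N : ℕ, (fun t : ℝ => ((Real.log t : ℝ) : ℂ) ^ l * f t) =O[atTop]
      fun x : ℝ => x ^ (-(N : ℝ))) ∧
    (∀ ε : ℝ, 0 < ε → (fun t : ℝ => ((Real.log t : ℝ) : ℂ) ^ l * f t) =O[𝓝[>] 0]
      fun x : ℝ => x ^ (-ε)) := by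
  induction l with
  | zero =>
    refine ⟨by simpa using hf.cont, fun N => by simpa using hf.top N, fun ε hε => ?_⟩
    have h1 : (fun _ : ℝ => (1 : ℝ)) =O[𝓝[>] 0] fun x : ℝ => x ^ (-ε) := by
      refine Asymptotics.IsBigO.of_bound 1 ?_
      filter_upwards [Ioo_mem_nhdsGT (zero_lt_one (α := ℝ))] with x hx
      rw [norm_one, one_mul, Real.norm_of_nonneg (Real.rpow_nonneg hx.1.le _)]
      exact Real.one_le_rpow_of_pos_of_le_one_of_nonpos hx.1 hx.2.le (by linarith)
    simpa using hf.bot.trans h1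
  | succ l ih =>
    have e : (fun t : ℝ => ((Real.log t : ℝ) : ℂ) ^ (l + 1) * f t) =
        fun t : ℝ => Real.log t • (((Real.log t : ℝ) : ℂ) ^ l * f t) := by
      funext t
      rw [Complex.real_smul]
      ring
    rw [e]
    refine ⟨?_, fun N => ?_, fun ε hε => ?_⟩
    · refine ContinuousOn.smul (Real.continuousOn_log.mono fun x hx => ?_) ih.1
      exact (Set.mem_Ioi.1 hx).ne'
    · exact isBigO_rpow_top_log_smul (a := ((N + 1 : ℕ) : ℝ)) (b := (N : ℝ))
        (by push_cast; linarith) (ih.2.1 (N + 1))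
    · exact isBigO_rpow_zero_log_smul (a := ε / 2) (b := ε) (by linarith) (ih.2.2 (ε / 2) (by linarith))

/-- `∫_0^∞ t^(s-1) log^l t f(t) dt`. -/
def mellinLog (f : ℝ → ℂ) (l : ℕ) (s : ℂ) : ℂ :=
  mellin (fun t : ℝ => ((Real.log t : ℝ) : ℂ) ^ l * f t) s

theorem MellinRegular.convergent {f : ℝ → ℂ} (hf : MellinRegular f) (l : ℕ) {s : ℂ}
    (hs : 0 < s.re) :
    MellinConvergent (fun t : ℝ => ((Real.log t : ℝ) : ℂ) ^ l * f t) s := by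
  obtain ⟨h1, h2, h3⟩ := hf.log_pow l
  obtain ⟨N, hN⟩ := exists_nat_gt s.re
  exact mellinConvergent_of_isBigO_rpow (h1.locallyIntegrableOn measurableSet_Ioi) (h2 N) hN
    (h3 (s.re / 2) (by linarith)) (by linarith)

/-- The derivative of t^{s-1} in s brings down ln t. This is what identifies powers of the logarithm
with derivatives in the exponent. -/
theorem MellinRegular.hasDerivAt {f : ℝ → ℂ} (hf : MellinRegular f) (l : ℕ) {s : ℂ}
    (hs : 0 < s.re) : HasDerivAt (mellinLog f l) (mellinLog f (l + 1) s) s := by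
  obtain ⟨h1, h2, h3⟩ := hf.log_pow l
  obtain ⟨N, hN⟩ := exists_nat_gt s.re
  have := (mellin_hasDerivAt_of_isBigO_rpow (h1.locallyIntegrableOn measurableSet_Ioi) (h2 N) hN
    (h3 (s.re / 2) (by linarith)) (by linarith)).2
  refine HasDerivAt.congr_deriv this ?_
  unfold mellinLog
  congr 1
  funext t
  rw [Complex.real_smul]
  ring

theorem isOpen_re_gt (r : ℝ) : IsOpen {z : ℂ | r < z.re} :=
  isOpen_lt continuous_const Complex.continuous_re

theorem MellinRegular.analyticAt {f : ℝ → ℂ} (hf : MellinRegular f) (l : ℕ) {s : ℂ}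
    (hs : 0 < s.re) : AnalyticAt ℂ (mellinLog f l) s :=
  DifferentiableOn.analyticAt (s := {z : ℂ | 0 < z.re})
    (fun _ hz => (hf.hasDerivAt l hz).differentiableAt.differentiableWithinAt)
    ((isOpen_re_gt 0).mem_nhds hs)

theorem MellinRegular.iteratedDeriv_eq {f : ℝ → ℂ} (hf : MellinRegular f) (l : ℕ) {s : ℂ}
    (hs : 0 < s.re) : iteratedDeriv l (mellinLog f 0) s = mellinLog f l s := by
  induction l generalizing s with
  | zero => simp
  | succ l ih =>
    rw [iteratedDeriv_succ, ← (hf.hasDerivAt l hs).deriv]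
    refine Filter.EventuallyEq.deriv_eq ?_
    filter_upwards [(isOpen_re_gt 0).mem_nhds hs] with z hz
    exact ih hz

/-! ### The Gamma integral on the right half-plane -/

theorem mellinRegular_exp {r : ℂ} (hr : 0 < r.re) :
    MellinRegular fun t : ℝ => Complex.exp (-(r * t)) where
  cont := by fun_prop
  top N := by
    have h := (isLittleO_exp_neg_mul_rpow_atTop hr (-(N : ℝ))).isBigO
    refine Asymptotics.IsBigO.trans (Asymptotics.IsBigO.of_norm_eventuallyLE ?_) h
    refine Eventually.of_forall fun t => ?_
    simp [Complex.norm_exp]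
  bot := by
    refine Asymptotics.IsBigO.of_bound 1 ?_
    filter_upwards [self_mem_nhdsWithin] with x hx
    have : 0 < r.re * x := mul_pos hr hx
    simp only [Complex.norm_exp, Complex.neg_re, Complex.mul_re, Complex.ofReal_re,
      Complex.ofReal_im, mul_zero, sub_zero, norm_one, mul_one]
    exact Real.exp_le_one_iff.2 (by linarith)

theorem hasDerivAt_mellin_exp {a : ℂ} (ha : 0 < a.re) {r : ℂ} (hr : 0 < r.re) :
    DifferentiableAt ℂ (fun r : ℂ => mellin (fun t : ℝ => Complex.exp (-(r * t))) a) r := by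
  have hr2 : 0 < (r.re / 2 : ℂ).re := by
    simp only [Complex.div_ofNat_re, Complex.ofReal_re]; linarith
  have hconv : ∀ b : ℂ, 0 < b.re → ∀ q : ℂ, 0 < q.re →
      IntegrableOn (fun t : ℝ => (t : ℂ) ^ (b - 1) * Complex.exp (-(q * t))) (Set.Ioi 0) := by
    intro b hb q hq
    have := (mellinRegular_exp hq).convergent 0 hb
    simpa [MellinConvergent] using this
  have key := hasDerivAt_integral_of_dominated_loc_of_deriv_le
    (μ := volume.restrict (Set.Ioi (0 : ℝ))) (𝕜 := ℂ)
    (F := fun (q : ℂ) (t : ℝ) => (t : ℂ) ^ (a - 1) * Complex.exp (-(q * t)))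
    (F' := fun (q : ℂ) (t : ℝ) => (t : ℂ) ^ (a - 1) * (Complex.exp (-(q * t)) * (-t)))
    -- On Re q > Re r / 2 the exponential is dominated by e^{-(Re r / 2) t}; the factor t from the
    -- derivative is absorbed by raising a to a + 1 in the bound.
    (x₀ := r) (s := {q : ℂ | r.re / 2 < q.re})
    (bound := fun t : ℝ => ‖(t : ℂ) ^ (a + 1 - 1) * Complex.exp (-((r.re / 2 : ℂ) * t))‖)
    ((isOpen_re_gt _).mem_nhds (show r.re / 2 < r.re by linarith)) ?_ (hconv a ha r hr) ?_ ?_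
    (hconv (a + 1) (by simp only [Complex.add_re, Complex.one_re]; linarith) _ hr2).norm ?_
  · have h2 := key.2.differentiableAt
    simpa [mellin] using h2
  · filter_upwards [(isOpen_re_gt 0).mem_nhds hr] with q hq
    exact (hconv a ha q hq).aestronglyMeasurable
  · refine Measurable.aestronglyMeasurable ?_
    fun_prop
  · filter_upwards [ae_restrict_mem measurableSet_Ioi] with t ht q hq
    have ht0 : (0 : ℝ) < t := ht
    rw [norm_mul, norm_mul, norm_mul, Complex.norm_cpow_eq_rpow_re_of_pos ht0,
      Complex.norm_cpow_eq_rpow_re_of_pos ht0, Complex.norm_exp, Complex.norm_exp, norm_neg,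
      Complex.norm_real, Real.norm_of_nonneg ht0.le]
    have e : t ^ (a + 1 - 1).re = t ^ (a - 1).re * t := by
      rw [← Real.rpow_add_one ht0.ne']
      congr 1
      simp
    rw [e, mul_assoc, mul_comm t]
    refine mul_le_mul_of_nonneg_left (mul_le_mul_of_nonneg_right (Real.exp_le_exp.2 ?_) ht0.le)
      (Real.rpow_nonneg ht0.le _)
    have hq' : r.re / 2 < q.re := hq
    simp only [Complex.neg_re, Complex.mul_re, Complex.ofReal_re, Complex.ofReal_im, mul_zero,
      sub_zero, Complex.div_ofNat_re]
    nlinarith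
  · refine Eventually.of_forall fun t q _ => ?_
    refine HasDerivAt.const_mul _ (HasDerivAt.cexp ?_)
    exact ((hasDerivAt_id q).mul_const (t : ℂ)).neg.congr_deriv (by simp)

/-- The Gamma integral with a complex rate. -/
theorem mellin_exp_neg_mul {a : ℂ} (ha : 0 < a.re) {r : ℂ} (hr : 0 < r.re) :
    mellin (fun t : ℝ => Complex.exp (-(r * t))) a = Complex.Gamma a * r ^ (-a) := by
  -- Both sides are analytic in r on the right half-plane, and they agree at the real points 1 +
  -- 1/(n+1), which accumulate at 1.
  have hU : IsPreconnected {q : ℂ | 0 < q.re} :=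
    (convex_halfSpace_re_gt 0).isPreconnected
  have hopen := isOpen_re_gt 0
  have h1 : AnalyticOnNhd ℂ (fun r : ℂ => mellin (fun t : ℝ => Complex.exp (-(r * t))) a)
      {q : ℂ | 0 < q.re} :=
    DifferentiableOn.analyticOnNhd
      (fun q hq => (hasDerivAt_mellin_exp ha hq).differentiableWithinAt) hopen
  have h2 : AnalyticOnNhd ℂ (fun r : ℂ => Complex.Gamma a * r ^ (-a)) {q : ℂ | 0 < q.re} := by
    intro q hq
    exact analyticAt_const.mul (analyticAt_id.cpow analyticAt_const (Or.inl hq))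
  refine h1.eqOn_of_preconnected_of_frequently_eq h2 hU (z₀ := 1) (by simp) ?_ hr
  have ht : Tendsto (fun n : ℕ => (((1 + 1 / ((n : ℝ) + 1) : ℝ)) : ℂ)) atTop (𝓝[≠] 1) := by
    refine tendsto_nhdsWithin_iff.2 ⟨?_, Eventually.of_forall fun n => ?_⟩
    · have := (tendsto_one_div_add_atTop_nhds_zero_nat (𝕜 := ℝ)).const_add 1
      rw [add_zero] at this
      exact (Complex.continuous_ofReal.tendsto _).comp this
    · have : (0 : ℝ) < 1 / ((n : ℝ) + 1) := by positivity
      simp only [Set.mem_compl_iff, Set.mem_singleton_iff]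
      intro h
      have h' : (1 + 1 / ((n : ℝ) + 1) : ℝ) = 1 := by exact_mod_cast h
      linarith
  refine ht.frequently (Eventually.of_forall fun n => ?_).frequently
  have hp : (0 : ℝ) < 1 + 1 / ((n : ℝ) + 1) := by positivity
  have := Complex.integral_cpow_mul_exp_neg_mul_Ioi ha hp
  simp only [mellin, smul_eq_mul]
  rw [this, one_div, Complex.inv_cpow, Complex.cpow_neg, mul_comm]
  rw [Complex.arg_ofReal_of_nonneg hp.le]
  exact Real.pi_pos.ne

/-! ### Pairing of `x_±^a ln^l |x|` with test functions -/

theorem integral_comp_sign (σ : ℤˣ) (g : ℝ → ℂ) :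
    ∫ x : ℝ, g (((σ : ℤ) : ℝ) * x) = ∫ x : ℝ, g x := by
  rcases Int.units_eq_one_or σ with rfl | rfl
  · simp
  · simpa using integral_neg_eq_self g volume

theorem sign_mul_self (σ : ℤˣ) : ((σ : ℤ) : ℝ) * ((σ : ℤ) : ℝ) = 1 := by
  rcases Int.units_eq_one_or σ with rfl | rfl <;> simp

theorem sign_mul_self' (σ : ℤˣ) : ((σ : ℤ) : ℂ) * ((σ : ℤ) : ℂ) = 1 := by
  rcases Int.units_eq_one_or σ with rfl | rfl <;> simp

theorem abs_sign (σ : ℤˣ) : |((σ : ℤ) : ℝ)| = 1 := by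
  rcases Int.units_eq_one_or σ with rfl | rfl <;> simp

theorem ofReal_sign (σ : ℤˣ) : ((((σ : ℤ) : ℝ)) : ℂ) = ((σ : ℤ) : ℂ) := by
  push_cast
  rfl

theorem powLogFun_sign_mul (σ : ℤˣ) (a : ℂ) (l : ℕ) (x : ℝ) :
    powLogFun σ a l (((σ : ℤ) : ℝ) * x) =
      (Set.Ioi (0 : ℝ)).indicator
        (fun t : ℝ => (t : ℂ) ^ a * ((Real.log t : ℝ) : ℂ) ^ l) x := by
  rw [powLogFun, ← mul_assoc, sign_mul_self, one_mul, abs_mul, abs_sign, one_mul, Set.indicator]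
  by_cases hx : 0 < x
  · simp [hx, abs_of_pos hx]
  · simp [hx]

/-- The substitution x = σt reduces both half-lines to (0, ∞). The argument is a + 1 because the
Mellin kernel is t^{s-1}. -/
theorem integral_mul_powLogFun (σ : ℤˣ) (a : ℂ) (l : ℕ) (ψ : ℝ → ℂ) :
    ∫ x : ℝ, ψ x * powLogFun σ a l x =
      mellinLog (fun t : ℝ => ψ (((σ : ℤ) : ℝ) * t)) l (a + 1) := by
  rw [← integral_comp_sign σ, mellinLog, mellin, ← integral_indicator measurableSet_Ioi]
  refine integral_congr_ae (Eventually.of_forall fun x => ?_)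
  simp only [powLogFun_sign_mul, Set.indicator]
  split_ifs
  · simp only [add_sub_cancel_right, smul_eq_mul]
    ring
  · simp

theorem mellinRegular_schwartz (σ : ℤˣ) (ψ : 𝓢(ℝ, ℂ)) :
    MellinRegular fun t : ℝ => ψ (((σ : ℤ) : ℝ) * t) where
  cont := by
    have := ψ.continuous
    exact (this.comp (by fun_prop)).continuousOn
  top N := by
    have h := ψ.isBigO_cocompact_rpow (-(N : ℝ))
    have ht : Tendsto (fun t : ℝ => ((σ : ℤ) : ℝ) * t) atTop (cocompact ℝ) := by
      rw [cocompact_eq_atBot_atTop]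
      rcases Int.units_eq_one_or σ with rfl | rfl
      · exact (tendsto_id.mono_right le_sup_right).congr fun t => by simp
      · exact (tendsto_neg_atTop_atBot.mono_right le_sup_left).congr fun t => by simp
    refine (h.comp_tendsto ht).congr' EventuallyEq.rfl ?_
    filter_upwards [eventually_ge_atTop 0] with t h0
    simp [abs_of_nonneg h0, abs_sign]
  bot := by
    have h : Continuous fun t : ℝ => ψ (((σ : ℤ) : ℝ) * t) := ψ.continuous.comp (by fun_prop)
    exact ((h.tendsto 0).isBigO_one ℝ).mono nhdsWithin_le_nhds

theorem regularDist_powLogFun (σ : ℤˣ) {a : ℂ} (ha : -1 < a.re) (l : ℕ) (ψ : 𝓢(ℝ, ℂ)) :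
    regularDist (powLogFun σ a l) ψ =
      mellinLog (fun t : ℝ => ψ (((σ : ℤ) : ℝ) * t)) l (a + 1) := by
  rw [regularDist_apply (temperedFun_powLogFun σ ha l), integral_mul_powLogFun]

theorem derivCLM_iterate_apply (T : 𝓢'(ℝ, ℂ)) (k : ℕ) (ψ : 𝓢(ℝ, ℂ)) :
    (TemperedDistribution.derivCLM ℂ)^[k] T ψ =
      (-1) ^ k * T ((SchwartzMap.derivCLM ℂ ℂ)^[k] ψ) := by
  induction k generalizing ψ with
  | zero => simp
  | succ k ih =>
    rw [Function.iterate_succ_apply', TemperedDistribution.derivCLM_apply_apply, ih,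
      Function.iterate_succ_apply]
    rw [iterate_map_neg, map_neg]
    ring

/-- Integration by parts of t^a ψ(σt): the boundary term at zero vanishes because Re a > 0, the one
at infinity by rapid decrease, and the chain rule supplies σ. -/
theorem mellin_deriv_schwartz (σ : ℤˣ) {a : ℂ} (ha : 0 < a.re) (ψ : 𝓢(ℝ, ℂ)) :
    mellinLog (fun t : ℝ => SchwartzMap.derivCLM ℂ ℂ ψ (((σ : ℤ) : ℝ) * t)) 0 (a + 1) =
      -(((σ : ℤ) : ℂ) * a * mellinLog (fun t : ℝ => ψ (((σ : ℤ) : ℝ) * t)) 0 a) := by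
  have ha1 : 0 < (a + 1).re := by simp only [Complex.add_re, Complex.one_re]; linarith
  have c1 := (mellinRegular_schwartz σ (SchwartzMap.derivCLM ℂ ℂ ψ)).convergent 0 ha1
  have c2 := (mellinRegular_schwartz σ ψ).convergent 0 ha
  simp only [mellinLog, mellin, MellinConvergent, pow_zero, one_mul, add_sub_cancel_right,
    smul_eq_mul] at c1 c2 ⊢
  have d1 : ∀ t : ℝ, HasDerivAt (fun t : ℝ => ψ (((σ : ℤ) : ℝ) * t))
      (((σ : ℤ) : ℂ) * SchwartzMap.derivCLM ℂ ℂ ψ (((σ : ℤ) : ℝ) * t)) t := by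
    intro t
    have h := (ψ.hasDerivAt (((σ : ℤ) : ℝ) * t)).scomp t
      ((hasDerivAt_id t).const_mul ((σ : ℤ) : ℝ))
    refine h.congr_deriv ?_
    rw [SchwartzMap.derivCLM_apply, Complex.real_smul, mul_one, ofReal_sign]
  have key := integral_Ioi_of_hasDerivAt_of_tendsto (a := (0 : ℝ)) (m := (0 : ℂ))
    (f := fun t : ℝ => (t : ℂ) ^ a * ψ (((σ : ℤ) : ℝ) * t))
    (f' := fun t : ℝ => a * ((t : ℂ) ^ (a - 1) * ψ (((σ : ℤ) : ℝ) * t)) +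
      ((σ : ℤ) : ℂ) * ((t : ℂ) ^ a * SchwartzMap.derivCLM ℂ ℂ ψ (((σ : ℤ) : ℝ) * t)))
    ?_ ?_ ((c2.const_mul a).add (c1.const_mul _)) ?_
  · rw [integral_add (c2.const_mul a) (c1.const_mul _), integral_const_mul,
      integral_const_mul] at key
    have hz : ((0 : ℝ) : ℂ) ^ a = 0 := by
      rw [Complex.ofReal_zero, Complex.zero_cpow]
      rintro rfl
      simp at ha
    rw [hz, zero_mul, sub_zero] at key
    linear_combination ((σ : ℤ) : ℂ) * key -
      (∫ (t : ℝ) in Set.Ioi 0,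
        (t : ℂ) ^ a * SchwartzMap.derivCLM ℂ ℂ ψ (((σ : ℤ) : ℝ) * t)) * sign_mul_self' σ
  · refine Continuous.continuousWithinAt ?_
    exact (Complex.continuous_ofReal_cpow_const ha).mul (ψ.continuous.comp (by fun_prop))
  · intro t ht
    have ht0 : (0 : ℝ) < t := ht
    have ha0 : a ≠ 0 := by
      rintro rfl
      simp at ha
    have h1 : HasDerivAt (fun t : ℝ => (t : ℂ) ^ a) (a * (t : ℂ) ^ (a - 1)) t :=
      hasDerivAt_ofReal_cpow_const ht0.ne' ha0
    exact (h1.mul (d1 t)).congr_deriv (by ring)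
  · obtain ⟨N, hN⟩ := exists_nat_gt a.re
    have h2 : Tendsto (fun t : ℝ => t ^ (-((N : ℝ) - a.re))) atTop (𝓝 0) :=
      tendsto_rpow_neg_atTop (by linarith)
    have h1 := (mellinRegular_schwartz σ ψ).top N
    refine Asymptotics.IsBigO.trans_tendsto (g'' := fun t : ℝ => t ^ (-((N : ℝ) - a.re))) ?_ h2
    have h3 : (fun t : ℝ => (t : ℂ) ^ a) =O[atTop] fun t : ℝ => t ^ a.re := by
      refine Asymptotics.IsBigO.of_bound 1 ?_
      filter_upwards [eventually_gt_atTop 0] with t ht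
      rw [Complex.norm_cpow_eq_rpow_re_of_pos ht, Real.norm_of_nonneg (Real.rpow_nonneg ht.le _),
        one_mul]
    refine (h3.mul h1).congr' EventuallyEq.rfl ?_
    filter_upwards [eventually_gt_atTop 0] with t ht
    rw [← Real.rpow_add ht]
    congr 1
    ring

theorem deriv_regularDist_powLogFun (σ : ℤˣ) {a : ℂ} (ha : 0 < a.re) :
    TemperedDistribution.derivCLM ℂ (regularDist (powLogFun σ a 0)) =
      (((σ : ℤ) : ℂ) * a) • regularDist (powLogFun σ (a - 1) 0) := by
  ext ψ
  have h1 : -1 < a.re := by linarith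
  have h2 : -1 < (a - 1).re := by simp only [Complex.sub_re, Complex.one_re]; linarith
  rw [TemperedDistribution.derivCLM_apply_apply, map_neg, regularDist_powLogFun σ h1,
    mellin_deriv_schwartz σ ha, neg_neg]
  change _ = (((σ : ℤ) : ℂ) * a) * regularDist (powLogFun σ (a - 1) 0) ψ
  rw [regularDist_powLogFun σ h2, sub_add_cancel]

/-- `1 / ((z + 1) ⋯ (z + k))`. -/
def invPoch (k : ℕ) (z : ℂ) : ℂ := (∏ j ∈ Finset.range k, (z + j + 1))⁻¹

theorem analyticAt_invPoch (k : ℕ) {a : ℂ} (ha : ∀ n : ℕ, a ≠ -((n : ℂ) + 1)) :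
    AnalyticAt ℂ (invPoch k) a := by
  unfold invPoch
  refine AnalyticAt.inv ?_ ?_
  · exact Finset.analyticAt_fun_prod _ fun j _ => by fun_prop
  · refine Finset.prod_ne_zero_iff.2 fun j _ h => ha j ?_
    linear_combination h

/-- The definition uses the least admissible k, which jumps with z. Independence of k allows one k
to serve a whole neighbourhood, as analyticity in z requires. Raising k by one adds a derivative of
x_±^{z+k+1}, whose factor ±(z+k+1) cancels the new factor of the denominator. -/
theorem powLogDist_zero_eq (σ : ℤˣ) {z : ℂ} {k : ℕ} (hk : -1 < z.re + k) :
    powLogDist σ z 0 = (invPoch k z * ((σ : ℤ) : ℂ) ^ k) •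
      (TemperedDistribution.derivCLM ℂ)^[k] (regularDist (powLogFun σ (z + k) 0)) := by
  have hle : ⌊-z.re⌋₊ ≤ k := by
    have : -z.re < (k : ℝ) + 1 := by linarith
    by_cases h0 : 0 ≤ -z.re
    · exact Nat.lt_succ_iff.1 ((Nat.floor_lt h0).2 (by push_cast; exact this))
    · rw [Nat.floor_of_nonpos (by linarith)]; exact Nat.zero_le _
  obtain ⟨d, rfl⟩ := Nat.exists_eq_add_of_le hle
  clear hk hle
  induction d with
  | zero => simp [powLogDist, invPoch]
  | succ d ih =>
    rw [ih]
    set k := ⌊-z.re⌋₊ + d with hk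
    have e1 : ⌊-z.re⌋₊ + (d + 1) = k + 1 := by omega
    rw [e1, Function.iterate_succ_apply]
    have hre : 0 < (z + ((k + 1 : ℕ) : ℂ)).re := by
      have := powLogDist_exponent z
      simp only [Complex.add_re, Complex.natCast_re] at this ⊢
      rw [hk]
      push_cast
      have : (0 : ℝ) ≤ d := Nat.cast_nonneg d
      linarith
    rw [deriv_regularDist_powLogFun σ hre]
    have e2 : z + ((k + 1 : ℕ) : ℂ) - 1 = z + k := by push_cast; ring
    rw [e2]
    have e4 : ∀ (c : ℂ) (T : 𝓢'(ℝ, ℂ)), (TemperedDistribution.derivCLM ℂ)^[k] (c • T) =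
        c • (TemperedDistribution.derivCLM ℂ)^[k] T := fun c T =>
      (Function.Commute.iterate_left (g := fun T : 𝓢'(ℝ, ℂ) => c • T)
        (fun T => map_smul (TemperedDistribution.derivCLM ℂ) c T) k) T
    rw [e4, smul_smul]
    congr 1
    have hne : z + k + 1 ≠ 0 := by
      intro h
      have e3 : z + ((k + 1 : ℕ) : ℂ) = 0 := by push_cast; linear_combination h
      rw [e3] at hre
      simp at hre
    simp only [invPoch, Finset.prod_range_succ, mul_inv]
    push_cast
    rw [pow_succ, show z + ((k : ℂ) + 1) = z + k + 1 by ring]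
    linear_combination (-(∏ j ∈ Finset.range k, (z + j + 1))⁻¹ * ((σ : ℤ) : ℂ) ^ k) *
      (sign_mul_self' σ + (((σ : ℤ) : ℂ) * ((σ : ℤ) : ℂ)) * (inv_mul_cancel₀ hne))

theorem powLogDist_zero_apply (σ : ℤˣ) {z : ℂ} {k : ℕ} (hk : -1 < z.re + k) (φ : 𝓢(ℝ, ℂ)) :
    powLogDist σ z 0 φ = invPoch k z * ((-((σ : ℤ) : ℂ)) ^ k *
      mellinLog (fun t : ℝ => (SchwartzMap.derivCLM ℂ ℂ)^[k] φ (((σ : ℤ) : ℝ) * t)) 0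
        (z + k + 1)) := by
  rw [powLogDist_zero_eq σ hk]
  change (invPoch k z * ((σ : ℤ) : ℂ) ^ k) * ((TemperedDistribution.derivCLM ℂ)^[k]
    (regularDist (powLogFun σ (z + k) 0)) φ) = _
  rw [derivCLM_iterate_apply, regularDist_powLogFun σ (by simpa using hk), neg_pow]
  ring

theorem eventually_re (a : ℂ) {k : ℕ} (hk : -1 < a.re + k) : ∀ᶠ z : ℂ in 𝓝 a, -1 < z.re + (k : ℝ) := by
  filter_upwards [(isOpen_re_gt (-1 - (k : ℝ))).mem_nhds (show -1 - (k : ℝ) < a.re by linarith)] with z hz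
  have : -1 - (k : ℝ) < z.re := hz
  linarith

theorem exists_nat_re (a : ℂ) : ∃ k : ℕ, -1 < a.re + k := by
  obtain ⟨k, hk⟩ := exists_nat_gt (-1 - a.re)
  exact ⟨k, by linarith⟩

theorem analyticAt_mellinLog_shift {f : ℝ → ℂ} (hf : MellinRegular f) (l : ℕ) {a : ℂ} {k : ℕ}
    (hk : -1 < a.re + k) : AnalyticAt ℂ (fun z : ℂ => mellinLog f l (z + k + 1)) a := by
  have h : 0 < (a + k + 1).re := by
    simp only [Complex.add_re, Complex.natCast_re, Complex.one_re]; linarith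
  exact AnalyticAt.fun_comp (hf.analyticAt l h) (by fun_prop)

theorem analyticAt_powLogDist (σ : ℤˣ) {a : ℂ} (ha : ∀ n : ℕ, a ≠ -((n : ℂ) + 1)) (φ : 𝓢(ℝ, ℂ)) :
    AnalyticAt ℂ (fun z : ℂ => powLogDist σ z 0 φ) a := by
  obtain ⟨k, hk⟩ := exists_nat_re a
  have h := (analyticAt_invPoch k ha).mul ((analyticAt_const (v := (-((σ : ℤ) : ℂ)) ^ k)).mul
    (analyticAt_mellinLog_shift
      (mellinRegular_schwartz σ ((SchwartzMap.derivCLM ℂ ℂ)^[k] φ)) 0 hk))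
  refine h.congr ?_
  filter_upwards [eventually_re a hk] with z hz
  exact (powLogDist_zero_apply σ hz φ).symm

theorem sum_dist_apply (s : Finset ℕ) (T : ℕ → 𝓢'(ℝ, ℂ)) (φ : 𝓢(ℝ, ℂ)) :
    (∑ m ∈ s, T m) φ = ∑ m ∈ s, T m φ :=
  map_sum (PointwiseConvergenceCLM.evalCLM (RingHom.id ℂ) ℂ φ) T s

/-- The definition is the Leibniz expansion of this derivative, with k frozen at its value for a.
Freezing it is legitimate because the same k remains admissible for z near a. -/
theorem powLogDist_eq_iteratedDeriv (σ : ℤˣ) {a : ℂ} (ha : ∀ n : ℕ, a ≠ -((n : ℂ) + 1)) (l : ℕ)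
    (φ : 𝓢(ℝ, ℂ)) :
    powLogDist σ a l φ = iteratedDeriv l (fun z : ℂ => powLogDist σ z 0 φ) a := by
  set k := ⌊-a.re⌋₊ with hk'
  have hk : -1 < a.re + k := by simpa using powLogDist_exponent a
  set f : ℝ → ℂ := fun t : ℝ => (SchwartzMap.derivCLM ℂ ℂ)^[k] φ (((σ : ℤ) : ℝ) * t) with hf
  have hfr : MellinRegular f := mellinRegular_schwartz σ _
  have e1 : (fun z : ℂ => powLogDist σ z 0 φ) =ᶠ[𝓝 a] fun z : ℂ =>
      mellinLog f 0 (z + (k + 1)) * ((-((σ : ℤ) : ℂ)) ^ k * invPoch k z) := by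
    filter_upwards [eventually_re a hk] with z hz
    rw [powLogDist_zero_apply σ hz, ← add_assoc]
    ring
  have an1 : AnalyticAt ℂ (fun z : ℂ => mellinLog f 0 (z + (k + 1))) a := by
    simpa only [← add_assoc] using analyticAt_mellinLog_shift hfr 0 hk
  have an2 := analyticAt_invPoch k ha
  have hpos : 0 < (a + (k + 1)).re := by
    simp only [Complex.add_re, Complex.natCast_re, Complex.one_re]; linarith
  rw [e1.iteratedDeriv_eq, iteratedDeriv_fun_mul an1.contDiffAt
    (analyticAt_const.fun_mul an2).contDiffAt]
  simp only [powLogDist, ← hk']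
  change (∑ m ∈ Finset.range (l + 1), _ : 𝓢'(ℝ, ℂ)) φ = _
  rw [sum_dist_apply]
  refine Finset.sum_congr rfl fun m _ => ?_
  rw [iteratedDeriv_comp_add_const, iteratedDeriv_const_mul_field]
  dsimp only
  rw [hfr.iteratedDeriv_eq m hpos]
  change (_ * _ * _) * ((TemperedDistribution.derivCLM ℂ)^[k]
    (regularDist (powLogFun σ (a + k) m)) φ) = _
  rw [derivCLM_iterate_apply, regularDist_powLogFun σ (by simpa using hk), neg_pow, ← hf,
    add_assoc]
  change _ * iteratedDeriv (l - m) (invPoch k) a * _ * _ = _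
  ring

/-! ### The recursion in the exponent -/

/-- Only two Leibniz terms survive for a linear factor. At l = 0 the truncated index l - 1 is
harmless, since its term carries the factor l. -/
theorem iteratedDeriv_linear_mul {f : ℂ → ℂ} {a : ℂ} (hf : AnalyticAt ℂ f a) (c : ℂ) (l : ℕ) :
    iteratedDeriv l (fun z : ℂ => f z * (z + c)) a =
      (a + c) * iteratedDeriv l f a + l * iteratedDeriv (l - 1) f a := by
  have h : ∀ i : ℕ, iteratedDeriv i (fun z : ℂ => z + c) a =
      if i = 0 then a + c else if i = 1 then 1 else 0 := by
    intro i
    rw [iteratedDeriv_comp_add_const i (fun z : ℂ => z)]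
    simp [iteratedDeriv_fun_id]
  rw [iteratedDeriv_fun_mul hf.contDiffAt (by fun_prop)]
  rcases l with - | l
  · simp [mul_comm]
  · rw [Finset.sum_range_succ, Finset.sum_range_succ, Finset.sum_eq_zero]
    · simp only [h]
      simp
      ring
    · intro i hi
      have hi' := Finset.mem_range.1 hi
      rw [h, if_neg (by omega), if_neg (by omega), mul_zero]

/-- With k for the exponent z + 1 and k + 1 for z, both sides contain the same Mellin transform at z
+ k + 2 of the (k+1)-st derivative of φ; only the prefactors have to be compared. -/
theorem powLogDist_zero_deriv (σ : ℤˣ) {z : ℂ} (hz : z + 1 ≠ 0) (φ : 𝓢(ℝ, ℂ)) :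
    powLogDist σ (z + 1) 0 (SchwartzMap.derivCLM ℂ ℂ φ) =
      -(((σ : ℤ) : ℂ) * (powLogDist σ z 0 φ * (z + 1))) := by
  obtain ⟨k, hk⟩ := exists_nat_re z
  rw [powLogDist_zero_apply (k := k) σ (by simp only [Complex.add_re, Complex.one_re]; linarith),
    powLogDist_zero_apply (k := k + 1) σ (by push_cast; linarith), Function.iterate_succ_apply,
    show z + 1 + (k : ℂ) + 1 = z + ((k + 1 : ℕ) : ℂ) + 1 by push_cast; ring]
  have e : invPoch k (z + 1) = invPoch (k + 1) z * (z + 1) := by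
    unfold invPoch
    rw [Finset.prod_range_succ', mul_inv, mul_assoc]
    simp only [Nat.cast_zero, add_zero]
    rw [inv_mul_cancel₀ hz, mul_one]
    congr 1
    refine Finset.prod_congr rfl fun j _ => ?_
    push_cast
    ring
  rw [e, pow_succ]
  linear_combination (-invPoch (k + 1) z * (z + 1) * (-((σ : ℤ) : ℂ)) ^ k *
    mellinLog (fun t : ℝ => (SchwartzMap.derivCLM ℂ ℂ)^[k] (SchwartzMap.derivCLM ℂ ℂ φ)
      (((σ : ℤ) : ℝ) * t)) 0 (z + ((k + 1 : ℕ) : ℂ) + 1)) * sign_mul_self' σ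

theorem add_one_ne_neg {a : ℂ} (ha : ∀ n : ℕ, a ≠ -((n : ℂ) + 1)) (n : ℕ) :
    a + 1 ≠ -((n : ℂ) + 1) := by
  intro h
  refine ha (n + 1) ?_
  push_cast
  linear_combination h

theorem add_one_ne_zero_of {a : ℂ} (ha : ∀ n : ℕ, a ≠ -((n : ℂ) + 1)) : a + 1 ≠ 0 := by
  intro h
  refine ha 0 ?_
  push_cast
  linear_combination h

/-- The case l = 0 is differentiated l times in the exponent; the factor z + 1 is responsible for
the term with l - 1. -/
theorem powLogDist_deriv (σ : ℤˣ) {a : ℂ} (ha : ∀ n : ℕ, a ≠ -((n : ℂ) + 1)) (l : ℕ)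
    (φ : 𝓢(ℝ, ℂ)) :
    powLogDist σ (a + 1) l (SchwartzMap.derivCLM ℂ ℂ φ) =
      -(((σ : ℤ) : ℂ) * ((a + 1) * powLogDist σ a l φ + l * powLogDist σ a (l - 1) φ)) := by
  rw [powLogDist_eq_iteratedDeriv σ (add_one_ne_neg ha), powLogDist_eq_iteratedDeriv σ ha,
    powLogDist_eq_iteratedDeriv σ ha, ← iteratedDeriv_linear_mul (analyticAt_powLogDist σ ha φ) 1 l]
  have e : (fun z : ℂ => powLogDist σ (z + 1) 0 (SchwartzMap.derivCLM ℂ ℂ φ)) =ᶠ[𝓝 a]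
      fun z : ℂ => -(((σ : ℤ) : ℂ) * (powLogDist σ z 0 φ * (z + 1))) := by
    have : ∀ᶠ z : ℂ in 𝓝 a, z + 1 ≠ 0 :=
      (by fun_prop : ContinuousAt (fun z : ℂ => z + 1) a).eventually_ne (add_one_ne_zero_of ha)
    filter_upwards [this] with z hz
    exact powLogDist_zero_deriv σ hz φ
  have h1 := e.iteratedDeriv_eq l
  rw [iteratedDeriv_comp_add_const l
    (fun z : ℂ => powLogDist σ z 0 (SchwartzMap.derivCLM ℂ ℂ φ))] at h1
  dsimp only at h1
  rw [h1, iteratedDeriv_fun_neg, iteratedDeriv_const_mul_field]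

/-- Induction along the recursion `∂ x_±^{a+1} ln^l = ±((a+1) x_±^a ln^l + l x_±^a ln^{l-1})`. -/
theorem exponent_induction {P : ℂ → ℕ → Prop} (h0 : ∀ a l, -1 < a.re → P a l)
    (h1 : ∀ a l, (∀ n : ℕ, a ≠ -((n : ℂ) + 1)) → P (a + 1) l → (l ≠ 0 → P a (l - 1)) → P a l)
    {a : ℂ} (ha : ∀ n : ℕ, a ≠ -((n : ℂ) + 1)) (l : ℕ) : P a l := by
  obtain ⟨k, hk⟩ := exists_nat_re a
  -- The outer induction counts the unit steps needed to reach Re a > -1; the inner one on l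
  -- supplies the case l - 1 at the same exponent.
  induction k generalizing a l with
  | zero => exact h0 a l (by simpa using hk)
  | succ k ih =>
    have h2 : ∀ m, P (a + 1) m := fun m => ih (add_one_ne_neg ha) m (by
      push_cast at hk
      simp only [Complex.add_re, Complex.one_re]
      linarith)
    induction l with
    | zero => exact h1 a 0 ha (h2 0) (by simp)
    | succ l ihl => exact h1 a (l + 1) ha (h2 _) fun _ => ihl

/-! ### The Fourier transform of a derivative -/

/-- Multiplication of a Schwartz function by the coordinate. -/
def mulX : 𝓢(ℝ, ℂ) →L[ℂ] 𝓢(ℝ, ℂ) := SchwartzMap.smulLeftCLM ℂ (fun ξ : ℝ => (ξ : ℂ))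

theorem hasTemperateGrowth_pow (k : ℕ) : (fun ξ : ℝ => (ξ : ℂ) ^ k).HasTemperateGrowth :=
  Function.Complex.hasTemperateGrowth_ofReal.pow k

theorem mulX_apply (φ : 𝓢(ℝ, ℂ)) (x : ℝ) : mulX φ x = x * φ x := by
  rw [mulX, SchwartzMap.smulLeftCLM_apply_apply Function.Complex.hasTemperateGrowth_ofReal, smul_eq_mul]

theorem mulPow_apply (k : ℕ) (φ : 𝓢(ℝ, ℂ)) (x : ℝ) :
    SchwartzMap.smulLeftCLM ℂ (fun ξ : ℝ => (ξ : ℂ) ^ k) φ x = (x : ℂ) ^ k * φ x := by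
  rw [SchwartzMap.smulLeftCLM_apply_apply (hasTemperateGrowth_pow k), smul_eq_mul]

theorem mulX_iterate_apply (k : ℕ) (φ : 𝓢(ℝ, ℂ)) (x : ℝ) : mulX^[k] φ x = (x : ℂ) ^ k * φ x := by
  induction k generalizing φ with
  | zero => simp
  | succ k ih => rw [Function.iterate_succ_apply, ih, mulX_apply, pow_succ, mul_assoc]

theorem mulX_iterate (k : ℕ) (φ : 𝓢(ℝ, ℂ)) :
    mulX^[k] φ = SchwartzMap.smulLeftCLM ℂ (fun ξ : ℝ => (ξ : ℂ) ^ k) φ := by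
  ext x
  rw [mulX_iterate_apply, mulPow_apply]

theorem fourierS_eq (φ : 𝓢(ℝ, ℂ)) (ξ : ℝ) :
    fourierS φ ξ = (((Real.sqrt (2 * Real.pi))⁻¹ : ℝ) : ℂ) *
      (𝓕 (φ : ℝ → ℂ)) (ξ * (2 * Real.pi)⁻¹) := by
  simp [fourierS, ← SchwartzMap.fourier_coe]

theorem deriv_fourierS (φ : 𝓢(ℝ, ℂ)) :
    SchwartzMap.derivCLM ℂ ℂ (fourierS φ) = -(Complex.I • fourierS (mulX φ)) := by
  ext ξ
  have hi : Integrable (fun x : ℝ => x • φ x) := by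
    refine (mulX φ).integrable.congr (Eventually.of_forall fun x => ?_)
    simp only [mulX_apply, Complex.real_smul]
  have h1 := Real.hasDerivAt_fourier φ.integrable hi (ξ * (2 * Real.pi)⁻¹)
  have h2 := (h1.scomp ξ ((hasDerivAt_id ξ).mul_const ((2 * Real.pi)⁻¹))).const_mul
    (((Real.sqrt (2 * Real.pi))⁻¹ : ℝ) : ℂ)
  have h3 : (fun ξ : ℝ => fourierS φ ξ) = fun ξ : ℝ => (((Real.sqrt (2 * Real.pi))⁻¹ : ℝ) : ℂ) *
      (𝓕 (φ : ℝ → ℂ)) (ξ * (2 * Real.pi)⁻¹) := funext (fourierS_eq φ)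
  have h4 : (fun x : ℝ => (-2 * Real.pi * Complex.I * x) • φ x) =
      (-2 * Real.pi * Complex.I : ℂ) • (mulX φ : ℝ → ℂ) := by
    funext x
    simp [mulX_apply, mul_assoc]
  have h5 : 𝓕 ((-2 * Real.pi * Complex.I : ℂ) • (mulX φ : ℝ → ℂ)) (ξ * (2 * Real.pi)⁻¹) =
      (-2 * Real.pi * Complex.I : ℂ) * 𝓕 (mulX φ : ℝ → ℂ) (ξ * (2 * Real.pi)⁻¹) := by
    rw [Real.fourier_eq, Real.fourier_eq]
    simp only [Pi.smul_apply, smul_eq_mul]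
    rw [← integral_const_mul]
    refine integral_congr_ae (Eventually.of_forall fun x => ?_)
    simp only [Circle.smul_def, smul_eq_mul]
    ring
  rw [SchwartzMap.derivCLM_apply]
  change deriv (fun ξ : ℝ => fourierS φ ξ) ξ = -(Complex.I * fourierS (mulX φ) ξ)
  rw [h3]
  refine h2.deriv.trans ?_
  rw [h4, h5, fourierS_eq, Complex.real_smul]
  have hpi : (Real.pi : ℂ) ≠ 0 := by exact_mod_cast Real.pi_ne_zero
  push_cast
  field_simp

theorem deriv_fourierS_iterate (k : ℕ) (φ : 𝓢(ℝ, ℂ)) :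
    (SchwartzMap.derivCLM ℂ ℂ)^[k] (fourierS φ) = (-Complex.I) ^ k • fourierS (mulX^[k] φ) := by
  induction k with
  | zero => simp
  | succ k ih =>
    rw [Function.iterate_succ_apply', ih, map_smul, deriv_fourierS, Function.iterate_succ_apply',
      pow_succ, ← smul_smul, neg_smul]

/-- The formula for the Fourier transform in terms of `x_±^{a+k}`. -/
theorem fourier_powLogDist (σ : ℤˣ) {a : ℂ} (ha : ∀ n : ℕ, a ≠ -((n : ℂ) + 1)) (l k : ℕ)
    (hk : -1 < a.re + k) (φ : 𝓢(ℝ, ℂ)) :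
    AnalyticAt ℂ (fun z : ℂ => (∏ j ∈ Finset.range k, (z + j + 1))⁻¹ *
      fourierD (powLogDist σ (z + k) 0)
        (SchwartzMap.smulLeftCLM ℂ (fun ξ : ℝ => (ξ : ℂ) ^ k) φ)) a ∧
    fourierD (powLogDist σ a l) φ = (((σ : ℤ) : ℂ) * Complex.I) ^ k *
      iteratedDeriv l (fun z : ℂ => (∏ j ∈ Finset.range k, (z + j + 1))⁻¹ *
        fourierD (powLogDist σ (z + k) 0)
          (SchwartzMap.smulLeftCLM ℂ (fun ξ : ℝ => (ξ : ℂ) ^ k) φ)) a := by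
  have hak : ∀ n : ℕ, a + k ≠ -((n : ℂ) + 1) := by
    intro n h
    have := congrArg Complex.re h
    simp only [Complex.add_re, Complex.natCast_re, Complex.neg_re, Complex.one_re] at this
    have : (0 : ℝ) ≤ n := Nat.cast_nonneg n
    linarith
  rw [← mulX_iterate]
  constructor
  · have h1 := analyticAt_powLogDist σ hak (fourierS (mulX^[k] φ))
    have h2 : AnalyticAt ℂ (fun z : ℂ => z + (k : ℂ)) a := by fun_prop
    have h3 := AnalyticAt.fun_comp (g := fun z : ℂ => powLogDist σ z 0 (fourierS (mulX^[k] φ)))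
      (f := fun z : ℂ => z + (k : ℂ)) h1 h2
    exact (analyticAt_invPoch k ha).fun_mul h3
  · change powLogDist σ a l (fourierS φ) = _
    rw [powLogDist_eq_iteratedDeriv σ ha, ← iteratedDeriv_const_mul_field]
    -- It remains to compare the case l = 0 for exponents near a. Moving k derivatives to the test
    -- function gives (-1)^k, and moving them through the Fourier transform gives (-i)^k and the
    -- factor ξ^k; the two signs combine to i^k.
    refine Filter.EventuallyEq.iteratedDeriv_eq l ?_
    filter_upwards [eventually_re a hk] with z hz
    change _ = _ * (invPoch k z * powLogDist σ (z + k) 0 (fourierS (mulX^[k] φ)))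
    have hz' : -1 < (z + k : ℂ).re := by simpa using hz
    rw [powLogDist_zero_eq σ hz, powLogDist_of_re σ hz' 0]
    change invPoch k z * ((σ : ℤ) : ℂ) ^ k * ((TemperedDistribution.derivCLM ℂ)^[k]
      (regularDist (powLogFun σ (z + k) 0)) (fourierS φ)) = _
    rw [derivCLM_iterate_apply, deriv_fourierS_iterate, map_smul, smul_eq_mul, mul_pow]
    have : (-1 : ℂ) ^ k * (-Complex.I) ^ k = Complex.I ^ k := by rw [← mul_pow]; simp
    linear_combination (invPoch k z * ((σ : ℤ) : ℂ) ^ k *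
      regularDist (powLogFun σ (z + k) 0) (fourierS (mulX^[k] φ))) * this

/-! ### The coefficients and the holomorphic symbol -/

/-- `(2π)^{-1/2} Γ(w+1) e^{∓iπ(w+1)/2}`. -/
def fourierCoeff (σ : ℤˣ) (w : ℂ) : ℂ :=
  (((Real.sqrt (2 * Real.pi))⁻¹ : ℝ) : ℂ) * Complex.Gamma (w + 1) *
    Complex.exp (-((σ : ℤ) : ℂ) * Real.pi * Complex.I / 2 * (w + 1))

/-- The coefficients `c_j^+`. -/
def coeffPlus (σ : ℤˣ) (a : ℂ) (l j : ℕ) : ℂ :=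
  (l.choose j : ℂ) * iteratedDeriv j (fourierCoeff σ) a * (-1) ^ (l - j)

/-- `∑_j c_j^+ z^{-a-1} log^{l-j} z`. -/
def holSymbol (σ : ℤˣ) (a : ℂ) (l : ℕ) (z : ℂ) : ℂ :=
  ∑ j ∈ Finset.range (l + 1), coeffPlus σ a l j * (z ^ (-a - 1) * Complex.log z ^ (l - j))

theorem sqrt_two_pi_inv_ne_zero : (((Real.sqrt (2 * Real.pi))⁻¹ : ℝ) : ℂ) ≠ 0 := by
  have : (0 : ℝ) < (Real.sqrt (2 * Real.pi))⁻¹ := by positivity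
  exact_mod_cast this.ne'

theorem add_one_ne_neg_nat {a : ℂ} (ha : ∀ n : ℕ, a ≠ -((n : ℂ) + 1)) (n : ℕ) :
    a + 1 ≠ -(n : ℂ) := fun h => ha n (by linear_combination h)

theorem fourierCoeff_ne_zero (σ : ℤˣ) {a : ℂ} (ha : ∀ n : ℕ, a ≠ -((n : ℂ) + 1)) :
    fourierCoeff σ a ≠ 0 :=
  mul_ne_zero (mul_ne_zero sqrt_two_pi_inv_ne_zero (Complex.Gamma_ne_zero (add_one_ne_neg_nat ha)))
    (Complex.exp_ne_zero _)

/-- The excluded exponents are exactly the zeros of the entire function 1/Γ(a+1). -/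
theorem isOpen_exponents : IsOpen {a : ℂ | ∀ n : ℕ, a ≠ -((n : ℂ) + 1)} := by
  have h : {a : ℂ | ∀ n : ℕ, a ≠ -((n : ℂ) + 1)} = {a : ℂ | (Complex.Gamma (a + 1))⁻¹ ≠ 0} := by
    ext a
    change (∀ n : ℕ, a ≠ -((n : ℂ) + 1)) ↔ (Complex.Gamma (a + 1))⁻¹ ≠ 0
    rw [Ne, inv_eq_zero, Complex.Gamma_eq_zero_iff]
    push Not
    exact forall_congr' fun n => not_congr
      ⟨fun h => by linear_combination h, fun h => by linear_combination h⟩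
  rw [h]
  have hc : Continuous fun a : ℂ => (Complex.Gamma (a + 1))⁻¹ :=
    Complex.differentiable_one_div_Gamma.continuous.comp (by fun_prop)
  exact isOpen_ne_fun hc continuous_const

theorem analyticAt_fourierCoeff (σ : ℤˣ) {a : ℂ} (ha : ∀ n : ℕ, a ≠ -((n : ℂ) + 1)) :
    AnalyticAt ℂ (fourierCoeff σ) a := by
  have hG : DifferentiableOn ℂ (fun w : ℂ => Complex.Gamma (w + 1))
      {a : ℂ | ∀ n : ℕ, a ≠ -((n : ℂ) + 1)} := by
    intro w hw
    refine DifferentiableAt.differentiableWithinAt ?_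
    exact (Complex.differentiableAt_Gamma _ (add_one_ne_neg_nat hw)).comp w (by fun_prop)
  have hG' := hG.analyticAt (isOpen_exponents.mem_nhds ha)
  exact (analyticAt_const.fun_mul hG').fun_mul (AnalyticAt.cexp (by fun_prop))

/-- Γ(w+2) = (w+1) Γ(w+1) together with e^{∓iπ/2} = ∓i. This is the recursion in the exponent at the
level of coefficients. -/
theorem fourierCoeff_add_one (σ : ℤˣ) {w : ℂ} (hw : w + 1 ≠ 0) :
    ((σ : ℤ) : ℂ) * Complex.I * fourierCoeff σ (w + 1) = (w + 1) * fourierCoeff σ w := by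
  have e : Complex.exp (-((σ : ℤ) : ℂ) * Real.pi * Complex.I / 2) =
      -((σ : ℤ) : ℂ) * Complex.I := by
    rcases Int.units_eq_one_or σ with rfl | rfl
    · have := Complex.exp_neg_pi_div_two_mul_I
      simp only [Units.val_one, Int.cast_one, neg_mul, one_mul]
      rw [← this]
      congr 1
      ring
    · have := Complex.exp_pi_div_two_mul_I
      simp only [Units.val_neg, Units.val_one, Int.cast_neg, Int.cast_one, neg_neg, one_mul]
      nth_rw 2 [← this]
      congr 1
      ring
  unfold fourierCoeff
  rw [Complex.Gamma_add_one _ hw, show -((σ : ℤ) : ℂ) * Real.pi * Complex.I / 2 * (w + 1 + 1) =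
    -((σ : ℤ) : ℂ) * Real.pi * Complex.I / 2 * (w + 1) +
      -((σ : ℤ) : ℂ) * Real.pi * Complex.I / 2 by ring, Complex.exp_add, e]
  set E := Complex.exp (-((σ : ℤ) : ℂ) * Real.pi * Complex.I / 2 * (w + 1))
  linear_combination ((((Real.sqrt (2 * Real.pi))⁻¹ : ℝ) : ℂ) * (w + 1) * Complex.Gamma (w + 1) *
    E) * (-(Complex.I * Complex.I) * sign_mul_self' σ - Complex.I_mul_I)

theorem iteratedDeriv_cpow_exponent {z : ℂ} (hz : z ≠ 0) (m : ℕ) (a : ℂ) :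
    iteratedDeriv m (fun w : ℂ => z ^ (-w - 1)) a =
      (-1) ^ m * (z ^ (-a - 1) * Complex.log z ^ m) := by
  induction m generalizing a with
  | zero => simp
  | succ m ih =>
    rw [iteratedDeriv_succ, show iteratedDeriv m (fun w : ℂ => z ^ (-w - 1)) =
      fun a => (-1) ^ m * (z ^ (-a - 1) * Complex.log z ^ m) from funext ih]
    have h1 : HasDerivAt (fun w : ℂ => -w - 1) (-1) a := ((hasDerivAt_id a).neg).sub_const 1
    have h := ((h1.const_cpow (c := z) (Or.inl hz)).mul_const (Complex.log z ^ m)).const_mul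
      ((-1 : ℂ) ^ m)
    rw [h.deriv]
    ring

theorem analyticAt_cpow_exponent {z : ℂ} (hz : z ≠ 0) (a : ℂ) :
    AnalyticAt ℂ (fun w : ℂ => z ^ (-w - 1)) a := by
  simp only [Complex.cpow_def_of_ne_zero hz]
  exact AnalyticAt.cexp (by fun_prop)

/-- In the Leibniz rule j derivatives fall on the coefficient and l - j on the power, each of the
latter giving -log z. This is the origin of the c_j^+. -/
theorem holSymbol_eq_iteratedDeriv (σ : ℤˣ) {a : ℂ} (ha : ∀ n : ℕ, a ≠ -((n : ℂ) + 1)) (l : ℕ)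
    {z : ℂ} (hz : z ≠ 0) :
    holSymbol σ a l z = iteratedDeriv l (fun w : ℂ => fourierCoeff σ w * z ^ (-w - 1)) a := by
  rw [iteratedDeriv_fun_mul (analyticAt_fourierCoeff σ ha).contDiffAt
    (analyticAt_cpow_exponent hz a).contDiffAt]
  refine Finset.sum_congr rfl fun j _ => ?_
  rw [iteratedDeriv_cpow_exponent hz, coeffPlus]
  ring

/-- The symbol obeys the recursion of the Fourier transforms themselves, with z in place of ξ; this
carries the boundary value statement to the left. -/
theorem holSymbol_recursion (σ : ℤˣ) {a : ℂ} (ha : ∀ n : ℕ, a ≠ -((n : ℂ) + 1)) (l : ℕ)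
    {z : ℂ} (hz : z ≠ 0) :
    ((σ : ℤ) : ℂ) * Complex.I * (z * holSymbol σ (a + 1) l z) =
      (a + 1) * holSymbol σ a l z + l * holSymbol σ a (l - 1) z := by
  rw [holSymbol_eq_iteratedDeriv σ (add_one_ne_neg ha) l hz, holSymbol_eq_iteratedDeriv σ ha l hz,
    holSymbol_eq_iteratedDeriv σ ha (l - 1) hz,
    ← iteratedDeriv_linear_mul ((analyticAt_fourierCoeff σ ha).fun_mul
      (analyticAt_cpow_exponent hz a)) 1 l]
  have e : (fun w : ℂ => fourierCoeff σ w * z ^ (-w - 1) * (w + 1)) =ᶠ[𝓝 a]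
      fun w : ℂ => (((σ : ℤ) : ℂ) * Complex.I * z) *
        (fourierCoeff σ (w + 1) * z ^ (-(w + 1) - 1)) := by
    have : ∀ᶠ w : ℂ in 𝓝 a, w + 1 ≠ 0 :=
      (by fun_prop : ContinuousAt (fun z : ℂ => z + 1) a).eventually_ne (add_one_ne_zero_of ha)
    filter_upwards [this] with w hw
    have h1 : z ^ (-w - 1) = z ^ (-(w + 1) - 1) * z := by
      nth_rw 3 [← Complex.cpow_one z]
      rw [← Complex.cpow_add _ _ hz]
      congr 1
      ring
    rw [h1]
    linear_combination -(z ^ (-(w + 1) - 1) * z) * fourierCoeff_add_one σ hw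
  rw [e.iteratedDeriv_eq l, iteratedDeriv_const_mul_field,
    iteratedDeriv_comp_add_const l (fun w : ℂ => fourierCoeff σ w * z ^ (-w - 1))]
  ring

/-- On the half-plane `±Im z < 0` the symbol is a Laplace transform. -/
theorem holSymbol_eq_mellin (σ : ℤˣ) {a : ℂ} (ha : -1 < a.re) (l : ℕ) {z : ℂ}
    (hz : 0 < (((σ : ℤ) : ℂ) * Complex.I * z).re) :
    holSymbol σ a l z = (((Real.sqrt (2 * Real.pi))⁻¹ : ℝ) : ℂ) *
      mellinLog (fun t : ℝ => Complex.exp (-(((σ : ℤ) : ℂ) * Complex.I * z * t))) l (a + 1) := by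
  have hz0 : z ≠ 0 := by
    rintro rfl
    simp at hz
  have ha' : ∀ n : ℕ, a ≠ -((n : ℂ) + 1) := by
    intro n h
    rw [h] at ha
    simp only [Complex.neg_re, Complex.add_re, Complex.natCast_re, Complex.one_re] at ha
    have : (0 : ℝ) ≤ n := Nat.cast_nonneg n
    linarith
  set s := ((σ : ℤ) : ℂ) * Complex.I * z with hs
  have hs0 : s ≠ 0 := by
    intro h
    rw [h] at hz
    simp at hz
  -- Since s lies in the right half-plane, multiplying it by ∓i does not cross the cut, so the
  -- logarithms add without a 2πi correction.
  have hlog : Complex.log s = Complex.log z + ((σ : ℤ) : ℂ) * Real.pi * Complex.I / 2 := by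
    have hzs : z = (-((σ : ℤ) : ℂ) * Complex.I) * s := by
      rw [hs]
      linear_combination (z * Complex.I * Complex.I) * sign_mul_self' σ + z * Complex.I_mul_I
    have harg := abs_lt.1 (Complex.abs_arg_lt_pi_div_two_iff.2 (Or.inl hz))
    rcases Int.units_eq_one_or σ with rfl | rfl
    · have e : (-(((1 : ℤˣ) : ℤ) : ℂ) * Complex.I) = -Complex.I := by simp
      rw [e] at hzs
      have := (Complex.log_mul_eq_add_log_iff (neg_ne_zero.2 Complex.I_ne_zero) hs0).2 (by
        rw [Complex.arg_neg_I]
        constructor <;> linarith [harg.1, harg.2])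
      rw [hzs, this, Complex.log_neg_I]
      simp only [Units.val_one, Int.cast_one]
      ring
    · have e : (-(((-1 : ℤˣ) : ℤ) : ℂ) * Complex.I) = Complex.I := by simp
      rw [e] at hzs
      have := (Complex.log_mul_eq_add_log_iff Complex.I_ne_zero hs0).2 (by
        rw [Complex.arg_I]
        constructor <;> linarith [harg.1, harg.2])
      rw [hzs, this, Complex.log_I]
      simp only [Units.val_neg, Units.val_one, Int.cast_neg, Int.cast_one]
      ring
  have hreg := mellinRegular_exp hz
  have ha1 : 0 < (a + 1).re := by simp only [Complex.add_re, Complex.one_re]; linarith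
  rw [holSymbol_eq_iteratedDeriv σ ha' l hz0, ← hreg.iteratedDeriv_eq l ha1,
    ← iteratedDeriv_const_mul_field]
  have h1 := congrFun (iteratedDeriv_comp_add_const l (fun w : ℂ =>
    (((Real.sqrt (2 * Real.pi))⁻¹ : ℝ) : ℂ) *
      mellinLog (fun t : ℝ => Complex.exp (-(s * t))) 0 w) 1) a
  rw [← h1]
  refine Filter.EventuallyEq.iteratedDeriv_eq l ?_
  filter_upwards [(isOpen_re_gt (-1)).mem_nhds ha] with w hw
  have hw1 : 0 < (w + 1).re := by
    have : -1 < w.re := hw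
    simp only [Complex.add_re, Complex.one_re]; linarith
  have h2 : mellinLog (fun t : ℝ => Complex.exp (-(s * t))) 0 (w + 1) =
      Complex.Gamma (w + 1) * s ^ (-(w + 1)) := by
    rw [← mellin_exp_neg_mul hw1 hz]
    simp [mellinLog]
  rw [h2, fourierCoeff, Complex.cpow_def_of_ne_zero hs0, Complex.cpow_def_of_ne_zero hz0, hlog,
    mul_assoc, mul_assoc, ← Complex.exp_add]
  congr 3
  ring

/-! ### Bounds for the symbol -/

/-- Polynomial growth outside the disc of radius `δ`. -/
def PolyBoundedOff (δ : ℝ) (f : ℂ → ℂ) : Prop :=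
  ∃ (M : ℝ) (N : ℕ), 0 ≤ M ∧ ∀ z : ℂ, δ ≤ ‖z‖ → ‖f z‖ ≤ M * (1 + ‖z‖) ^ N

theorem PolyBoundedOff.const_mul {δ : ℝ} {f : ℂ → ℂ} (h : PolyBoundedOff δ f) (c : ℂ) :
    PolyBoundedOff δ fun z => c * f z := by
  obtain ⟨M, N, hM, h⟩ := h
  refine ⟨‖c‖ * M, N, by positivity, fun z hz => ?_⟩
  rw [norm_mul, mul_assoc]
  exact mul_le_mul_of_nonneg_left (h z hz) (norm_nonneg _)

theorem PolyBoundedOff.add {δ : ℝ} {f g : ℂ → ℂ} (hf : PolyBoundedOff δ f)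
    (hg : PolyBoundedOff δ g) : PolyBoundedOff δ fun z => f z + g z := by
  obtain ⟨M, N, hM, hf⟩ := hf
  obtain ⟨M', N', hM', hg⟩ := hg
  refine ⟨M + M', max N N', by positivity, fun z hz => (norm_add_le _ _).trans ?_⟩
  have h1 : (1 : ℝ) ≤ 1 + ‖z‖ := by linarith [norm_nonneg z]
  rw [add_mul]
  refine add_le_add ((hf z hz).trans ?_) ((hg z hz).trans ?_)
  · exact mul_le_mul_of_nonneg_left (pow_le_pow_right₀ h1 (le_max_left _ _)) hM
  · exact mul_le_mul_of_nonneg_left (pow_le_pow_right₀ h1 (le_max_right _ _)) hM'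

theorem PolyBoundedOff.sum {δ : ℝ} {f : ℕ → ℂ → ℂ} (hf : ∀ j, PolyBoundedOff δ (f j)) (n : ℕ) :
    PolyBoundedOff δ fun z => ∑ j ∈ Finset.range n, f j z := by
  induction n with
  | zero => exact ⟨0, 0, le_rfl, by simp⟩
  | succ n ih =>
    simp only [Finset.sum_range_succ]
    exact ih.add (hf n)

theorem polyBoundedOff_cpow_mul_log (b : ℂ) (m : ℕ) {δ : ℝ} (hδ : 0 < δ) :
    PolyBoundedOff δ fun z => z ^ b * Complex.log z ^ m := by
  obtain ⟨n, hn⟩ := exists_nat_ge |b.re|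
  set K : ℝ := 1 + δ⁻¹ with hK
  have hδ' : 0 < δ⁻¹ := inv_pos.2 hδ
  refine ⟨Real.exp (Real.pi * |b.im|) * K ^ n * ((1 + Real.pi) * K) ^ m, n + m, by positivity, ?_⟩
  intro z hz
  have hz0 : 0 < ‖z‖ := lt_of_lt_of_le hδ hz
  have hzne : z ≠ 0 := norm_pos_iff.1 hz0
  -- For ‖z‖ ≥ δ the single quantity q dominates 1, ‖z‖ and ‖z‖⁻¹, hence powers of either sign and
  -- the logarithm; the argument of z contributes only e^{π|Im b|}.
  set q := K * (1 + ‖z‖) with hq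
  have hq1 : 1 ≤ q := by rw [hq, hK]; nlinarith
  have hqz : ‖z‖ ≤ q := by rw [hq, hK]; nlinarith
  have hqi : ‖z‖⁻¹ ≤ q := by
    have : ‖z‖⁻¹ ≤ δ⁻¹ := inv_anti₀ hδ hz
    rw [hq, hK]
    nlinarith
  have b1 : ‖z ^ b‖ ≤ Real.exp (Real.pi * |b.im|) * q ^ n := by
    rw [Complex.norm_cpow_of_ne_zero hzne, div_eq_mul_inv, ← Real.exp_neg, mul_comm]
    refine mul_le_mul (Real.exp_le_exp.2 ?_) ?_ (Real.rpow_nonneg hz0.le _) (Real.exp_nonneg _)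
    · have h1 : |z.arg * b.im| ≤ Real.pi * |b.im| := by
        rw [abs_mul]
        exact mul_le_mul_of_nonneg_right (Complex.abs_arg_le_pi z) (abs_nonneg _)
      linarith [(abs_le.1 h1).1]
    · have h2 : ‖z‖ ^ b.re ≤ q ^ |b.re| := by
        rcases le_total 0 b.re with h | h
        · rw [abs_of_nonneg h]
          exact Real.rpow_le_rpow hz0.le hqz h
        · rw [abs_of_nonpos h]
          have : ‖z‖ ^ b.re = ‖z‖⁻¹ ^ (-b.re) := by
            rw [Real.inv_rpow hz0.le, Real.rpow_neg hz0.le, inv_inv]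
          rw [this]
          exact Real.rpow_le_rpow (inv_nonneg.2 hz0.le) hqi (by linarith)
      refine h2.trans ?_
      rw [← Real.rpow_natCast]
      exact Real.rpow_le_rpow_of_exponent_le hq1 hn
  have b2 : ‖Complex.log z‖ ≤ (1 + Real.pi) * q := by
    have h1 : |Real.log ‖z‖| ≤ q := by
      have h3 := Real.log_le_sub_one_of_pos hz0
      have h4 := Real.log_le_sub_one_of_pos (inv_pos.2 hz0)
      rw [Real.log_inv] at h4
      rw [abs_le]
      constructor <;> linarith
    have h2 : ‖Complex.log z‖ ≤ |Real.log ‖z‖| + Real.pi := by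
      refine (Complex.norm_le_abs_re_add_abs_im _).trans ?_
      rw [Complex.log_re, Complex.log_im]
      exact add_le_add le_rfl (Complex.abs_arg_le_pi z)
    nlinarith [Real.pi_pos]
  rw [norm_mul, norm_pow]
  calc ‖z ^ b‖ * ‖Complex.log z‖ ^ m
      ≤ (Real.exp (Real.pi * |b.im|) * q ^ n) * ((1 + Real.pi) * q) ^ m :=
        mul_le_mul b1 (pow_le_pow_left₀ (norm_nonneg _) b2 m) (by positivity) (by positivity)
    _ = _ := by rw [hq]; simp only [mul_pow, pow_add]; ring

theorem polyBoundedOff_holSymbol (σ : ℤˣ) (a : ℂ) (l : ℕ) {δ : ℝ} (hδ : 0 < δ) :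
    PolyBoundedOff δ (holSymbol σ a l) :=
  PolyBoundedOff.sum (fun j => (polyBoundedOff_cpow_mul_log (-a - 1) (l - j) hδ).const_mul
    (coeffPlus σ a l j)) (l + 1)

theorem measurable_holSymbol (σ : ℤˣ) (a : ℂ) (l : ℕ) : Measurable (holSymbol σ a l) := by
  unfold holSymbol
  refine Finset.measurable_fun_sum _ fun j _ => ?_
  exact measurable_const.mul ((measurable_id.pow_const _).mul (Complex.measurable_log.pow_const _))

/-- The point `ξ ∓ iη`. -/
def shifted (σ : ℤˣ) (η ξ : ℝ) : ℂ := ξ + (((-σ : ℤˣ) : ℤ) : ℂ) * η * Complex.I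

theorem shifted_eq (σ : ℤˣ) (η ξ : ℝ) :
    shifted σ η ξ = ξ - ((σ : ℤ) : ℂ) * η * Complex.I := by
  rw [shifted, Units.val_neg, Int.cast_neg]
  ring

theorem shifted_re (σ : ℤˣ) (η ξ : ℝ) : (shifted σ η ξ).re = ξ := by
  simp [shifted]

theorem shifted_im (σ : ℤˣ) (η ξ : ℝ) : (shifted σ η ξ).im = -((σ : ℤ) : ℝ) * η := by
  simp [shifted_eq]

theorem le_norm_shifted (σ : ℤˣ) {η : ℝ} (hη : 0 < η) (ξ : ℝ) : η ≤ ‖shifted σ η ξ‖ := by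
  have h := Complex.abs_im_le_norm (shifted σ η ξ)
  rwa [shifted_im, abs_mul, abs_neg, abs_sign, one_mul, abs_of_pos hη] at h

theorem abs_le_norm_shifted (σ : ℤˣ) (η ξ : ℝ) : |ξ| ≤ ‖shifted σ η ξ‖ := by
  have h := Complex.abs_re_le_norm (shifted σ η ξ)
  rwa [shifted_re] at h

theorem norm_shifted_le (σ : ℤˣ) {η : ℝ} (hη : 0 < η) (ξ : ℝ) : ‖shifted σ η ξ‖ ≤ |ξ| + η := by
  refine (Complex.norm_le_abs_re_add_abs_im _).trans ?_
  rw [shifted_re, shifted_im, abs_mul, abs_neg, abs_sign, one_mul, abs_of_pos hη]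

theorem shifted_ne_zero (σ : ℤˣ) {η : ℝ} (hη : 0 < η) (ξ : ℝ) : shifted σ η ξ ≠ 0 :=
  norm_pos_iff.1 (lt_of_lt_of_le hη (le_norm_shifted σ hη ξ))

theorem measurable_shifted (σ : ℤˣ) (η : ℝ) : Measurable (shifted σ η) := by
  unfold shifted
  fun_prop

theorem integrable_mul_one_add_abs_pow (φ : 𝓢(ℝ, ℂ)) (C : ℝ) (hC : 0 ≤ C) (N : ℕ) :
    Integrable fun ξ : ℝ => ‖φ ξ‖ * (C + |ξ|) ^ N := by
  have h : ∀ ξ : ℝ, ‖φ ξ‖ * (C + |ξ|) ^ N ≤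
      (2 ^ (N - 1) * C ^ N) * (‖ξ‖ ^ 0 * ‖φ ξ‖) + 2 ^ (N - 1) * (‖ξ‖ ^ N * ‖φ ξ‖) := by
    intro ξ
    have := add_pow_le hC (abs_nonneg ξ) N
    have h2 := mul_le_mul_of_nonneg_left this (norm_nonneg (φ ξ))
    rw [Real.norm_eq_abs]
    refine h2.trans (le_of_eq ?_)
    ring
  have hi : Integrable fun ξ : ℝ =>
      (2 ^ (N - 1) * C ^ N) * (‖ξ‖ ^ 0 * ‖φ ξ‖) + 2 ^ (N - 1) * (‖ξ‖ ^ N * ‖φ ξ‖) :=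
    ((φ.integrable_pow_mul volume 0).const_mul _).add ((φ.integrable_pow_mul volume N).const_mul _)
  refine Integrable.mono' hi ?_ (Eventually.of_forall fun ξ => ?_)
  · have := φ.continuous
    exact (by fun_prop : Continuous fun ξ : ℝ => ‖φ ξ‖ * (C + |ξ|) ^ N).aestronglyMeasurable
  · rw [Real.norm_of_nonneg (by positivity)]
    exact h ξ

theorem integrable_mul_shifted {f : ℂ → ℂ} (hf : Measurable f)
    (hb : ∀ δ : ℝ, 0 < δ → PolyBoundedOff δ f) (σ : ℤˣ) {η : ℝ} (hη : 0 < η) (φ : 𝓢(ℝ, ℂ)) :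
    Integrable fun ξ : ℝ => φ ξ * f (shifted σ η ξ) := by
  obtain ⟨M, N, hM, h⟩ := hb η hη
  refine Integrable.mono' ((integrable_mul_one_add_abs_pow φ (1 + η) (by positivity) N).const_mul M)
    (φ.continuous.measurable.mul (hf.comp (measurable_shifted σ η))).aestronglyMeasurable
    (Eventually.of_forall fun ξ => ?_)
  rw [norm_mul]
  have h1 := h _ (le_norm_shifted σ hη ξ)
  have h2 : (1 + ‖shifted σ η ξ‖) ^ N ≤ (1 + η + |ξ|) ^ N :=
    pow_le_pow_left₀ (by positivity) (by linarith [norm_shifted_le σ hη ξ]) N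
  calc ‖φ ξ‖ * ‖f (shifted σ η ξ)‖ ≤ ‖φ ξ‖ * (M * (1 + η + |ξ|) ^ N) :=
        mul_le_mul_of_nonneg_left (h1.trans (mul_le_mul_of_nonneg_left h2 hM)) (norm_nonneg _)
    _ = _ := by ring

theorem integrable_mul_holSymbol (σ : ℤˣ) (a : ℂ) (l : ℕ) {η : ℝ} (hη : 0 < η) (φ : 𝓢(ℝ, ℂ)) :
    Integrable fun ξ : ℝ => φ ξ * holSymbol σ a l (shifted σ η ξ) :=
  integrable_mul_shifted (measurable_holSymbol σ a l)
    (fun _ hδ => polyBoundedOff_holSymbol σ a l hδ) σ hη φ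

/-! ### The Fourier transform as a boundary value -/

theorem sign_I_mul_shifted (σ : ℤˣ) (η ξ : ℝ) :
    ((σ : ℤ) : ℂ) * Complex.I * shifted σ η ξ = η + ((σ : ℤ) : ℂ) * Complex.I * ξ := by
  rw [shifted_eq]
  linear_combination (-(η : ℂ) * Complex.I * Complex.I) * sign_mul_self' σ -
    (η : ℂ) * Complex.I_mul_I

/-- The symbol at ξ ∓ iη is a Laplace integral, and Fubini's theorem moves the oscillating factor
onto φ. The damping e^{-ηt} makes the double integral absolutely convergent. -/
theorem integral_mul_holSymbol (σ : ℤˣ) {a : ℂ} (ha : -1 < a.re) (l : ℕ) {η : ℝ} (hη : 0 < η)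
    (φ : 𝓢(ℝ, ℂ)) :
    ∫ ξ : ℝ, φ ξ * holSymbol σ a l (shifted σ η ξ) =
      mellinLog (fun t : ℝ => Complex.exp (-(η * t)) * fourierS φ (((σ : ℤ) : ℝ) * t)) l
        (a + 1) := by
  have ha1 : 0 < (a + 1).re := by simp only [Complex.add_re, Complex.one_re]; linarith
  set c : ℂ := (((Real.sqrt (2 * Real.pi))⁻¹ : ℝ) : ℂ) with hc
  set m : ℝ → ℂ := fun t => (t : ℂ) ^ (a + 1 - 1) *
    (((Real.log t : ℝ) : ℂ) ^ l * Complex.exp (-(η * t))) with hm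
  have hmi : Integrable m (volume.restrict (Set.Ioi 0)) := by
    have := (mellinRegular_exp (r := (η : ℂ)) (by simpa using hη)).convergent l ha1
    exact this
  have e1 : ∀ ξ : ℝ, φ ξ * holSymbol σ a l (shifted σ η ξ) =
      ∫ t in Set.Ioi (0 : ℝ), c * (m t * (Complex.exp (-(Complex.I * ξ * (((σ : ℤ) : ℂ) * t))) *
        φ ξ)) := by
    intro ξ
    have hre : 0 < (((σ : ℤ) : ℂ) * Complex.I * shifted σ η ξ).re := by
      rw [sign_I_mul_shifted]
      simpa using hη
    rw [holSymbol_eq_mellin σ ha l hre, ← hc, mellinLog, mellin, mul_left_comm,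
      ← integral_const_mul, ← integral_const_mul]
    refine integral_congr_ae (Eventually.of_forall fun t => ?_)
    simp only [smul_eq_mul, hm, sign_I_mul_shifted]
    rw [show -(((η : ℂ) + ((σ : ℤ) : ℂ) * Complex.I * ξ) * t) =
      -(η * t) + -(Complex.I * ξ * (((σ : ℤ) : ℂ) * t)) by ring, Complex.exp_add]
    ring
  have e2 : ∀ t : ℝ, (t : ℂ) ^ (a + 1 - 1) • (((Real.log t : ℝ) : ℂ) ^ l *
      (Complex.exp (-(η * t)) * fourierS φ (((σ : ℤ) : ℝ) * t))) =
      ∫ ξ : ℝ, c * (m t * (Complex.exp (-(Complex.I * ξ * (((σ : ℤ) : ℂ) * t))) * φ ξ)) := by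
    intro t
    rw [fourierS_apply, ← hc, integral_const_mul, integral_const_mul, hm]
    push_cast
    simp only [smul_eq_mul]
    ring
  simp only [e1, mellinLog, mellin, e2]
  refine integral_integral_swap ?_
  have h1 : Integrable (fun p : ℝ × ℝ => φ p.1 * m p.2)
      (volume.prod (volume.restrict (Set.Ioi 0))) := φ.integrable.mul_prod hmi
  have h2 : Integrable (fun p : ℝ × ℝ =>
      Complex.exp (-(Complex.I * p.1 * (((σ : ℤ) : ℂ) * p.2))) * (φ p.1 * m p.2))
      (volume.prod (volume.restrict (Set.Ioi 0))) := by
    refine h1.bdd_mul (c := 1) ?_ (Eventually.of_forall fun p => ?_)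
    · exact (by fun_prop : Continuous fun p : ℝ × ℝ =>
        Complex.exp (-(Complex.I * p.1 * (((σ : ℤ) : ℂ) * p.2)))).aestronglyMeasurable
    · rw [Complex.norm_exp]
      simp
  refine (h2.const_mul c).congr (Eventually.of_forall fun p => ?_)
  simp only [Function.uncurry]
  ring

/-- Dominated convergence: for η > 0 the damping factor is at most 1 in modulus, so the undamped
integrand dominates. -/
theorem tendsto_mellinLog_exp {f : ℝ → ℂ} (hf : MellinRegular f) (l : ℕ) {s : ℂ} (hs : 0 < s.re) :
    Tendsto (fun η : ℝ => mellinLog (fun t : ℝ => Complex.exp (-(η * t)) * f t) l s) (𝓝[>] 0)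
      (𝓝 (mellinLog f l s)) := by
  have hi := hf.convergent l hs
  refine tendsto_integral_filter_of_dominated_convergence
    (fun t : ℝ => ‖(t : ℂ) ^ (s - 1) • (((Real.log t : ℝ) : ℂ) ^ l * f t)‖) ?_ ?_ hi.norm ?_
  · refine Eventually.of_forall fun η => ?_
    have h1 : AEStronglyMeasurable (fun t : ℝ => Complex.exp (-((η : ℂ) * t)))
        (volume.restrict (Set.Ioi 0)) :=
      (by fun_prop : Continuous fun t : ℝ => Complex.exp (-((η : ℂ) * t))).aestronglyMeasurable
    refine (h1.mul hi.aestronglyMeasurable).congr (Eventually.of_forall fun t => ?_)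
    simp only [Pi.mul_apply, smul_eq_mul]
    ring
  · filter_upwards [self_mem_nhdsWithin] with η hη
    filter_upwards [ae_restrict_mem measurableSet_Ioi] with t ht
    have h0 : 0 < η * t := mul_pos hη ht
    have h1 : ‖Complex.exp (-((η : ℂ) * t))‖ ≤ 1 := by
      rw [Complex.norm_exp, ← Complex.ofReal_mul, Complex.neg_re, Complex.ofReal_re]
      exact Real.exp_le_one_iff.2 (by linarith)
    simp only [norm_smul, norm_mul]
    refine mul_le_mul_of_nonneg_left (mul_le_mul_of_nonneg_left ?_ (norm_nonneg _)) (norm_nonneg _)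
    exact mul_le_of_le_one_left (norm_nonneg _) h1
  · refine Eventually.of_forall fun t => ?_
    have h1 : Continuous fun η : ℝ => (t : ℂ) ^ (s - 1) • (((Real.log t : ℝ) : ℂ) ^ l *
        (Complex.exp (-((η : ℂ) * t)) * f t)) := by fun_prop
    have h2 := (h1.tendsto 0).mono_left (nhdsWithin_le_nhds (s := Set.Ioi (0 : ℝ)))
    simpa using h2

/-- For Re a > -1 this is the damped identity in the limit η → 0. Further left, transform and symbol
share a recursion whose coefficient a + 1 is nonzero, so (a, l) follows from (a + 1, l) and (a, l -
1). -/
theorem isBoundaryValue_holSymbol (σ : ℤˣ) {a : ℂ} (ha : ∀ n : ℕ, a ≠ -((n : ℂ) + 1)) (l : ℕ) :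
    IsBoundaryValue (-σ) (holSymbol σ a l) (fourierD (powLogDist σ a l)) := by
  refine exponent_induction (P := fun a l =>
    IsBoundaryValue (-σ) (holSymbol σ a l) (fourierD (powLogDist σ a l))) ?_ ?_ ha l
  · intro a l ha φ
    have ha1 : 0 < (a + 1).re := by simp only [Complex.add_re, Complex.one_re]; linarith
    change Tendsto (fun η : ℝ => ∫ ξ : ℝ, φ ξ * holSymbol σ a l (shifted σ η ξ)) _
      (𝓝 (powLogDist σ a l (fourierS φ)))
    rw [powLogDist_of_re σ ha, regularDist_powLogFun σ ha]
    refine (tendsto_mellinLog_exp (mellinRegular_schwartz σ (fourierS φ)) l ha1).congr' ?_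
    filter_upwards [self_mem_nhdsWithin] with η hη
    exact (integral_mul_holSymbol σ ha l hη φ).symm
  · intro a l ha h1 h2 φ
    have hne := add_one_ne_zero_of ha
    change Tendsto (fun η : ℝ => ∫ ξ : ℝ, φ ξ * holSymbol σ a l (shifted σ η ξ)) _
      (𝓝 (powLogDist σ a l (fourierS φ)))
    have t1 : Tendsto (fun η : ℝ => ∫ ξ : ℝ, φ ξ * holSymbol σ (a + 1) l (shifted σ η ξ)) (𝓝[>] 0)
        (𝓝 (powLogDist σ (a + 1) l (fourierS φ))) := h1 φ
    have t2 : Tendsto (fun η : ℝ => ∫ ξ : ℝ, mulX φ ξ * holSymbol σ (a + 1) l (shifted σ η ξ))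
        (𝓝[>] 0) (𝓝 (powLogDist σ (a + 1) l (fourierS (mulX φ)))) := h1 (mulX φ)
    have t3 : Tendsto (fun η : ℝ => (l : ℂ) * ∫ ξ : ℝ, φ ξ * holSymbol σ a (l - 1) (shifted σ η ξ))
        (𝓝[>] 0) (𝓝 (l * powLogDist σ a (l - 1) (fourierS φ))) := by
      by_cases hl : l = 0
      · subst hl
        simp
      · exact (h2 hl φ).const_mul (l : ℂ)
    have t0 : Tendsto (fun η : ℝ => ((η : ℝ) : ℂ)) (𝓝[>] 0) (𝓝 0) := by
      have := (Complex.continuous_ofReal.tendsto 0).mono_left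
        (nhdsWithin_le_nhds (s := Set.Ioi (0 : ℝ)))
      simpa using this
    have rec1 : (a + 1) * powLogDist σ a l (fourierS φ) =
        ((σ : ℤ) : ℂ) * Complex.I * powLogDist σ (a + 1) l (fourierS (mulX φ)) -
          l * powLogDist σ a (l - 1) (fourierS φ) := by
      have h := powLogDist_deriv σ ha l (fourierS φ)
      rw [deriv_fourierS, map_neg, map_smul, smul_eq_mul] at h
      linear_combination ((σ : ℤ) : ℂ) * h -
        ((a + 1) * powLogDist σ a l (fourierS φ) +
          l * powLogDist σ a (l - 1) (fourierS φ)) * sign_mul_self' σ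
    -- The symbol recursion multiplies by ξ ∓ iη. The factor ξ is moved onto the test function, and
    -- the remaining term is η times a convergent integral, so it disappears in the limit.
    have t4 := ((((t2.sub ((t0.const_mul (((σ : ℤ) : ℂ) * Complex.I)).mul t1)).const_mul
      (((σ : ℤ) : ℂ) * Complex.I)).sub t3).const_mul (a + 1)⁻¹)
    simp only [mul_zero, zero_mul, sub_zero] at t4
    rw [← rec1, inv_mul_cancel_left₀ hne] at t4
    refine t4.congr' ?_
    filter_upwards [self_mem_nhdsWithin] with η hη
    have hη' : (0 : ℝ) < η := hη
    have i1 := integrable_mul_holSymbol σ (a + 1) l hη' (mulX φ)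
    have i2 := integrable_mul_holSymbol σ (a + 1) l hη' φ
    have i3 := integrable_mul_holSymbol σ a (l - 1) hη' φ
    have i4 : Integrable fun ξ : ℝ => ((σ : ℤ) : ℂ) * Complex.I *
        (mulX φ ξ * holSymbol σ (a + 1) l (shifted σ η ξ) -
          ((σ : ℤ) : ℂ) * Complex.I * η * (φ ξ * holSymbol σ (a + 1) l (shifted σ η ξ))) :=
      (i1.sub (i2.const_mul _)).const_mul _
    rw [← integral_const_mul, ← integral_sub i1 (i2.const_mul _), ← integral_const_mul,
      ← integral_const_mul, ← integral_sub i4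
        (i3.const_mul _), ← integral_const_mul]
    refine integral_congr_ae (Eventually.of_forall fun ξ => ?_)
    simp only
    have hr := holSymbol_recursion σ ha l (shifted_ne_zero σ hη' ξ)
    have hs := shifted_eq σ η ξ
    rw [mulX_apply, inv_mul_eq_iff_eq_mul₀ hne]
    set H := holSymbol σ (a + 1) l (shifted σ η ξ)
    have hs' : (ξ : ℂ) = shifted σ η ξ + ((σ : ℤ) : ℂ) * η * Complex.I := by rw [hs]; ring
    linear_combination φ ξ * hr + (((σ : ℤ) : ℂ) * Complex.I * φ ξ * H) * hs'

/-! ### The two half-lines -/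

/-- The coefficients `c_j^-`. -/
def coeffMinus (σ : ℤˣ) (a : ℂ) (l j : ℕ) : ℂ :=
  Complex.exp (-((σ : ℤ) : ℂ) * (-a - 1) * Real.pi * Complex.I) *
    ∑ i ∈ Finset.range (j + 1), ((l - i).choose (j - i) : ℂ) *
      (-((σ : ℤ) : ℂ) * Real.pi * Complex.I) ^ (j - i) * coeffPlus σ a l i

/-- Binomial expansion regrouped by powers of x. With x = ln|ξ| and y = ∓iπ it produces the
triangular formula for the c_j^-. -/
theorem sum_mul_add_pow (c : ℕ → ℂ) (x y : ℂ) (l : ℕ) :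
    ∑ i ∈ Finset.range (l + 1), c i * (x + y) ^ (l - i) =
      ∑ j ∈ Finset.range (l + 1), (∑ i ∈ Finset.range (j + 1),
        ((l - i).choose (j - i) : ℂ) * y ^ (j - i) * c i) * x ^ (l - j) := by
  simp only [Finset.sum_mul, Finset.range_eq_Ico]
  rw [← Finset.sum_Ico_Ico_comm 0 (l + 1) (fun i j =>
    ((l - i).choose (j - i) : ℂ) * y ^ (j - i) * c i * x ^ (l - j))]
  refine Finset.sum_congr rfl fun i hi => ?_
  have hi' : i ≤ l := by have := (Finset.mem_Ico.1 hi).2; omega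
  rw [Finset.sum_Ico_eq_sum_range, add_comm x y, add_pow, Finset.mul_sum,
    show l + 1 - i = l - i + 1 by omega]
  refine Finset.sum_congr rfl fun m hm => ?_
  rw [show i + m - i = m by omega, show l - (i + m) = l - i - m by omega]
  ring

theorem tendsto_nhds_of_eq {α β : Type*} [TopologicalSpace β] {f : α → β} {l : Filter α} {x y : β}
    (h : Tendsto f l (𝓝 x)) (e : x = y) : Tendsto f l (𝓝 y) := e ▸ h

/-- The boundary value of the logarithm on the real axis. -/
def logBoundary (σ : ℤˣ) (ξ : ℝ) : ℂ :=
  (Real.log |ξ| : ℝ) + if 0 < ξ then 0 else -((σ : ℤ) : ℂ) * Real.pi * Complex.I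

/-- For ξ < 0 the point ξ - σiη reaches the cut from below if σ = 1 and from above if σ = -1, whence
the jump -σπi. For ξ > 0 the logarithm is continuous. -/
theorem tendsto_log_shifted (σ : ℤˣ) {ξ : ℝ} (hξ : ξ ≠ 0) :
    Tendsto (fun η : ℝ => Complex.log (shifted σ η ξ)) (𝓝[>] 0) (𝓝 (logBoundary σ ξ)) := by
  have hc : Continuous fun η : ℝ => shifted σ η ξ := by unfold shifted; fun_prop
  have h0 : shifted σ 0 ξ = ξ := by simp [shifted]
  have ht : Tendsto (fun η : ℝ => shifted σ η ξ) (𝓝[>] 0) (𝓝 (ξ : ℂ)) := by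
    have := (hc.tendsto 0).mono_left (nhdsWithin_le_nhds (s := Set.Ioi (0 : ℝ)))
    rwa [h0] at this
  rcases lt_or_gt_of_ne hξ with hneg | hpos
  · have hre : (ξ : ℂ).re < 0 := by simpa using hneg
    have him : (ξ : ℂ).im = 0 := Complex.ofReal_im ξ
    rcases Int.units_eq_one_or σ with rfl | rfl
    · have h1 := Complex.tendsto_log_nhdsWithin_im_neg_of_re_neg_of_im_zero hre him
      have h2 : Tendsto (fun η : ℝ => shifted 1 η ξ) (𝓝[>] 0) (𝓝[{z : ℂ | z.im < 0}] (ξ : ℂ)) := by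
        refine tendsto_nhdsWithin_iff.2 ⟨ht, ?_⟩
        filter_upwards [self_mem_nhdsWithin] with η hη
        have hη' : (0 : ℝ) < η := hη
        change (shifted 1 η ξ).im < 0
        rw [shifted_im]
        simpa using hη'
      refine tendsto_nhds_of_eq (h1.comp h2) ?_
      simp only [logBoundary, if_neg (not_lt.2 hneg.le), Complex.norm_real, Real.norm_eq_abs,
        Units.val_one, Int.cast_one]
      ring
    · have h1 := Complex.tendsto_log_nhdsWithin_im_nonneg_of_re_neg_of_im_zero hre him
      have h2 : Tendsto (fun η : ℝ => shifted (-1) η ξ) (𝓝[>] 0)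
          (𝓝[{z : ℂ | 0 ≤ z.im}] (ξ : ℂ)) := by
        refine tendsto_nhdsWithin_iff.2 ⟨ht, ?_⟩
        filter_upwards [self_mem_nhdsWithin] with η hη
        have hη' : (0 : ℝ) < η := hη
        change 0 ≤ (shifted (-1) η ξ).im
        rw [shifted_im]
        simpa using hη'.le
      refine tendsto_nhds_of_eq (h1.comp h2) ?_
      simp only [logBoundary, if_neg (not_lt.2 hneg.le), Complex.norm_real, Real.norm_eq_abs,
        Units.val_neg, Units.val_one, Int.cast_neg, Int.cast_one]
      ring
  · have h1 := (continuousAt_clog (Complex.ofReal_mem_slitPlane.2 hpos)).tendsto.comp ht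
    refine tendsto_nhds_of_eq h1 ?_
    rw [logBoundary, if_pos hpos, abs_of_pos hpos, add_zero, Complex.ofReal_log hpos.le]

theorem powLogFun_of_pos {a : ℂ} {l : ℕ} {x : ℝ} (hx : 0 < x) :
    powLogFun 1 a l x = ((|x| : ℝ) : ℂ) ^ a * ((Real.log |x| : ℝ) : ℂ) ^ l ∧
      powLogFun (-1) a l x = 0 := by
  constructor
  · simp [powLogFun, hx]
  · simp [powLogFun, hx.le]

theorem powLogFun_of_neg {a : ℂ} {l : ℕ} {x : ℝ} (hx : x < 0) :
    powLogFun 1 a l x = 0 ∧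
      powLogFun (-1) a l x = ((|x| : ℝ) : ℂ) ^ a * ((Real.log |x| : ℝ) : ℂ) ^ l := by
  constructor
  · simp [powLogFun, hx.le]
  · simp [powLogFun, hx]

theorem tendsto_holSymbol_shifted (σ : ℤˣ) (a : ℂ) (l : ℕ) {ξ : ℝ} (hξ : ξ ≠ 0) :
    Tendsto (fun η : ℝ => holSymbol σ a l (shifted σ η ξ)) (𝓝[>] 0)
      (𝓝 (logPolyFun (-a - 1) l (coeffPlus σ a l) (coeffMinus σ a l) ξ)) := by
  set b := -a - 1 with hb
  have hL := tendsto_log_shifted σ hξ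
  have h1 : Tendsto (fun η : ℝ => holSymbol σ a l (shifted σ η ξ)) (𝓝[>] 0)
      (𝓝 (∑ j ∈ Finset.range (l + 1), coeffPlus σ a l j *
        (Complex.exp (logBoundary σ ξ * b) * logBoundary σ ξ ^ (l - j)))) := by
    refine tendsto_finsetSum _ fun j _ => (Tendsto.mul ?_ (hL.pow _)).const_mul _
    refine ((Complex.continuous_exp.tendsto _).comp (hL.mul_const b)).congr' ?_
    filter_upwards [self_mem_nhdsWithin] with η hη
    rw [Complex.cpow_def_of_ne_zero (shifted_ne_zero σ hη ξ)]
    rfl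
  refine tendsto_nhds_of_eq h1 ?_
  have habs : (0 : ℝ) < |ξ| := abs_pos.2 hξ
  have hpow : ((|ξ| : ℝ) : ℂ) ^ b = Complex.exp ((Real.log |ξ| : ℝ) * b) := by
    rw [Complex.cpow_def_of_ne_zero (by exact_mod_cast habs.ne'), Complex.ofReal_log habs.le]
  unfold logPolyFun
  rcases lt_or_gt_of_ne hξ with hneg | hpos
  · have hL' : logBoundary σ ξ = (Real.log |ξ| : ℝ) + -((σ : ℤ) : ℂ) * Real.pi * Complex.I := by
      rw [logBoundary, if_neg (not_lt.2 hneg.le)]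
    simp only [(powLogFun_of_neg hneg).1, (powLogFun_of_neg hneg).2, mul_zero, zero_add]
    have h2 := sum_mul_add_pow (coeffPlus σ a l) ((Real.log |ξ| : ℝ) : ℂ)
      (-((σ : ℤ) : ℂ) * Real.pi * Complex.I) l
    rw [← hL'] at h2
    have h3 : ∀ j, coeffPlus σ a l j * (Complex.exp (logBoundary σ ξ * b) *
        logBoundary σ ξ ^ (l - j)) = Complex.exp (logBoundary σ ξ * b) *
        (coeffPlus σ a l j * logBoundary σ ξ ^ (l - j)) := fun j => by ring
    simp only [h3]
    rw [← Finset.mul_sum, h2, Finset.mul_sum]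
    refine Finset.sum_congr rfl fun j _ => ?_
    rw [coeffMinus, ← hb, hpow, hL', add_mul, Complex.exp_add,
      show -((σ : ℤ) : ℂ) * Real.pi * Complex.I * b = -((σ : ℤ) : ℂ) * b * Real.pi * Complex.I by
        ring]
    ring
  · have hL' : logBoundary σ ξ = (Real.log |ξ| : ℝ) := by
      rw [logBoundary, if_pos hpos, add_zero]
    refine Finset.sum_congr rfl fun j _ => ?_
    rw [(powLogFun_of_pos hpos).1, (powLogFun_of_pos hpos).2, mul_zero, add_zero, hL', hpow]

/-- Off the origin the Fourier transform is the function `logPolyFun`. -/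
theorem fourier_powLogDist_off_zero (σ : ℤˣ) {a : ℂ} (ha : ∀ n : ℕ, a ≠ -((n : ℂ) + 1)) (l : ℕ)
    (φ : 𝓢(ℝ, ℂ)) (hφ : (0 : ℝ) ∉ tsupport φ) :
    fourierD (powLogDist σ a l) φ =
      ∫ ξ : ℝ, φ ξ * logPolyFun (-a - 1) l (coeffPlus σ a l) (coeffMinus σ a l) ξ := by
  refine tendsto_nhds_unique (isBoundaryValue_holSymbol σ ha l φ) ?_
  change Tendsto (fun η : ℝ => ∫ ξ : ℝ, φ ξ * holSymbol σ a l (shifted σ η ξ)) _ _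
  obtain ⟨δ, hδ, hball⟩ := Metric.eventually_nhds_iff.1 (notMem_tsupport_iff_eventuallyEq.1 hφ)
  obtain ⟨M, N, hM, hb⟩ := polyBoundedOff_holSymbol σ a l hδ
  -- On the support of φ one has |ξ| ≥ δ, hence |ξ ∓ iη| ≥ δ for all η, and the polynomial bound is
  -- uniform. The 2 in the majorant comes from 1 + η < 2.
  refine tendsto_integral_filter_of_dominated_convergence
    (fun ξ : ℝ => M * (‖φ ξ‖ * (2 + |ξ|) ^ N)) ?_ ?_
    ((integrable_mul_one_add_abs_pow φ 2 (by norm_num) N).const_mul M) ?_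
  · refine Eventually.of_forall fun η => ?_
    exact (φ.continuous.measurable.mul
      ((measurable_holSymbol σ a l).comp (measurable_shifted σ η))).aestronglyMeasurable
  · filter_upwards [Ioo_mem_nhdsGT (zero_lt_one (α := ℝ))] with η hη
    refine Eventually.of_forall fun ξ => ?_
    rw [norm_mul]
    by_cases hξ : |ξ| < δ
    · have : φ ξ = 0 := hball (by simpa using hξ)
      rw [this, norm_zero, zero_mul, zero_mul, mul_zero]
    · have h1 := hb _ ((not_lt.1 hξ).trans (abs_le_norm_shifted σ η ξ))
      have h2 : (1 + ‖shifted σ η ξ‖) ^ N ≤ (2 + |ξ|) ^ N :=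
        pow_le_pow_left₀ (by positivity) (by linarith [norm_shifted_le σ hη.1 ξ, hη.2]) N
      calc ‖φ ξ‖ * ‖holSymbol σ a l (shifted σ η ξ)‖ ≤ ‖φ ξ‖ * (M * (2 + |ξ|) ^ N) :=
            mul_le_mul_of_nonneg_left (h1.trans (mul_le_mul_of_nonneg_left h2 hM)) (norm_nonneg _)
        _ = _ := by ring
  · have h0 : ∀ᵐ ξ : ℝ, ξ ≠ 0 := by simp [ae_iff, measure_singleton]
    filter_upwards [h0] with ξ hξ
    exact (tendsto_holSymbol_shifted σ a l hξ).const_mul _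

/-! ### The expansion on the whole line -/

/-- In the strip both a and b = -1 - a have real part above -1, so both sides involve locally
integrable functions. As Re b < 0 and |ξ ∓ iη| ≥ |ξ|, the function |ξ|^{Re b} dominates up to a
constant, and dominated convergence works through the origin. -/
theorem fourier_powLogDist_strip (σ : ℤˣ) {a : ℂ} (h1 : -1 < a.re) (h2 : a.re < 0)
    (φ : 𝓢(ℝ, ℂ)) :
    fourierD (powLogDist σ a 0) φ = coeffPlus σ a 0 0 * powLogDist 1 (-1 - a) 0 φ +
      coeffMinus σ a 0 0 * powLogDist (-1) (-1 - a) 0 φ := by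
  have ha : ∀ n : ℕ, a ≠ -((n : ℂ) + 1) := by
    intro n h
    rw [h] at h1
    simp only [Complex.neg_re, Complex.add_re, Complex.natCast_re, Complex.one_re] at h1
    have : (0 : ℝ) ≤ n := Nat.cast_nonneg n
    linarith
  have hb : -1 < (-1 - a).re := by
    simp only [Complex.sub_re, Complex.neg_re, Complex.one_re]; linarith
  set b := -1 - a with hbdef
  have hba : -a - 1 = b := by rw [hbdef]; ring
  obtain ⟨N1, hN1⟩ := temperedFun_powLogFun 1 hb 0
  obtain ⟨N2, hN2⟩ := temperedFun_powLogFun (-1) hb 0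
  have i1 := (TemperedFun.integrable_mul hN1 φ).1
  have i2 := (TemperedFun.integrable_mul hN2 φ).1
  rw [powLogDist_of_re _ hb, powLogDist_of_re _ hb,
    regularDist_apply (temperedFun_powLogFun _ hb 0), regularDist_apply
    (temperedFun_powLogFun _ hb 0), ← integral_const_mul, ← integral_const_mul,
    ← integral_add (i1.const_mul _) (i2.const_mul _)]
  refine tendsto_nhds_unique (isBoundaryValue_holSymbol σ ha 0 φ) ?_
  change Tendsto (fun η : ℝ => ∫ ξ : ℝ, φ ξ * holSymbol σ a 0 (shifted σ η ξ)) _ _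
  set C : ℝ := ‖coeffPlus σ a 0 0‖ * Real.exp (Real.pi * |b.im|) with hC
  have h0 : ∀ᵐ ξ : ℝ, ξ ≠ 0 := by simp [ae_iff, measure_singleton]
  refine tendsto_integral_filter_of_dominated_convergence
    (fun ξ : ℝ => C * (‖φ ξ * powLogFun 1 b 0 ξ‖ + ‖φ ξ * powLogFun (-1) b 0 ξ‖)) ?_ ?_
    ((i1.norm.add i2.norm).const_mul C) ?_
  · refine Eventually.of_forall fun η => ?_
    exact (φ.continuous.measurable.mul
      ((measurable_holSymbol σ a 0).comp (measurable_shifted σ η))).aestronglyMeasurable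
  · filter_upwards [self_mem_nhdsWithin] with η hη
    have hη' : (0 : ℝ) < η := hη
    filter_upwards [h0] with ξ hξ
    have habs : (0 : ℝ) < |ξ| := abs_pos.2 hξ
    have e1 : ‖φ ξ * powLogFun 1 b 0 ξ‖ + ‖φ ξ * powLogFun (-1) b 0 ξ‖ =
        ‖φ ξ‖ * |ξ| ^ b.re := by
      rcases lt_or_gt_of_ne hξ with hneg | hpos
      · rw [(powLogFun_of_neg hneg).1, (powLogFun_of_neg hneg).2, mul_zero, norm_zero, zero_add,
          pow_zero, mul_one, norm_mul, Complex.norm_cpow_eq_rpow_re_of_pos habs]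
      · rw [(powLogFun_of_pos hpos).1, (powLogFun_of_pos hpos).2, mul_zero, norm_zero, add_zero,
          pow_zero, mul_one, norm_mul, Complex.norm_cpow_eq_rpow_re_of_pos habs]
    have e2 : ‖shifted σ η ξ ^ b‖ ≤ Real.exp (Real.pi * |b.im|) * |ξ| ^ b.re := by
      have hz := shifted_ne_zero σ hη' ξ
      rw [Complex.norm_cpow_of_ne_zero hz, div_eq_mul_inv, ← Real.exp_neg, mul_comm]
      refine mul_le_mul (Real.exp_le_exp.2 ?_) ?_ (Real.rpow_nonneg (norm_nonneg _) _)
        (Real.exp_nonneg _)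
      · have h3 : |(shifted σ η ξ).arg * b.im| ≤ Real.pi * |b.im| := by
          rw [abs_mul]
          exact mul_le_mul_of_nonneg_right (Complex.abs_arg_le_pi _) (abs_nonneg _)
        linarith [(abs_le.1 h3).1]
      · refine Real.rpow_le_rpow_of_nonpos habs (abs_le_norm_shifted σ η ξ) ?_
        rw [hbdef]
        simp only [Complex.sub_re, Complex.neg_re, Complex.one_re]
        linarith
    rw [e1, norm_mul]
    have e3 : holSymbol σ a 0 (shifted σ η ξ) = coeffPlus σ a 0 0 * shifted σ η ξ ^ b := by
      simp [holSymbol, hba]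
    rw [e3, norm_mul, hC]
    calc ‖φ ξ‖ * (‖coeffPlus σ a 0 0‖ * ‖shifted σ η ξ ^ b‖) ≤
        ‖φ ξ‖ * (‖coeffPlus σ a 0 0‖ * (Real.exp (Real.pi * |b.im|) * |ξ| ^ b.re)) :=
          mul_le_mul_of_nonneg_left (mul_le_mul_of_nonneg_left e2 (norm_nonneg _)) (norm_nonneg _)
      _ = _ := by ring
  · filter_upwards [h0] with ξ hξ
    refine tendsto_nhds_of_eq ((tendsto_holSymbol_shifted σ a 0 hξ).const_mul (φ ξ)) ?_
    simp only [logPolyFun, hba, zero_add, Finset.sum_range_one, Nat.sub_zero]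
    ring

theorem coeffMinus_zero (σ : ℤˣ) (a : ℂ) :
    coeffMinus σ a 0 0 = Complex.exp (-((σ : ℤ) : ℂ) * (-a - 1) * Real.pi * Complex.I) *
      fourierCoeff σ a := by
  simp [coeffMinus, coeffPlus]

theorem coeffPlus_zero (σ : ℤˣ) (a : ℂ) : coeffPlus σ a 0 0 = fourierCoeff σ a := by
  simp [coeffPlus]

/-! ### Analytic continuation from the strip to the non-integer exponents -/

theorem ne_neg_of_notMem_int {a : ℂ} (ha : a ∈ (Set.range ((↑) : ℤ → ℂ))ᶜ) (n : ℕ) :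
    a ≠ -((n : ℂ) + 1) := by
  rintro rfl
  exact ha ⟨-(n + 1), by push_cast; ring⟩

theorem reflect_notMem_int {a : ℂ} (ha : a ∈ (Set.range ((↑) : ℤ → ℂ))ᶜ) :
    -1 - a ∈ (Set.range ((↑) : ℤ → ℂ))ᶜ := by
  rintro ⟨n, hn⟩
  exact ha ⟨-1 - n, by push_cast; rw [hn]; ring⟩

theorem analyticAt_powLogDist_reflect (σ : ℤˣ) {a : ℂ} (ha : a ∈ (Set.range ((↑) : ℤ → ℂ))ᶜ)
    (φ : 𝓢(ℝ, ℂ)) : AnalyticAt ℂ (fun z : ℂ => powLogDist σ (-1 - z) 0 φ) a := by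
  have h1 := analyticAt_powLogDist σ (ne_neg_of_notMem_int (reflect_notMem_int ha)) φ
  have h2 : AnalyticAt ℂ (fun z : ℂ => -1 - z) a := by fun_prop
  exact AnalyticAt.fun_comp (g := fun z : ℂ => powLogDist σ z 0 φ) (f := fun z : ℂ => -1 - z) h1 h2

/-- The factor `c_0^-` as a function of the exponent. -/
def fourierCoeffMinus (σ : ℤˣ) (a : ℂ) : ℂ :=
  fourierCoeff σ a * Complex.exp (-((σ : ℤ) : ℂ) * (-a - 1) * Real.pi * Complex.I)

theorem analyticAt_exp_factor (σ : ℤˣ) (a : ℂ) :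
    AnalyticAt ℂ (fun z : ℂ => Complex.exp (-((σ : ℤ) : ℂ) * (-z - 1) * Real.pi * Complex.I)) a :=
  AnalyticAt.cexp (by fun_prop)

theorem analyticAt_fourierCoeffMinus (σ : ℤˣ) {a : ℂ} (ha : ∀ n : ℕ, a ≠ -((n : ℂ) + 1)) :
    AnalyticAt ℂ (fourierCoeffMinus σ) a :=
  (analyticAt_fourierCoeff σ ha).fun_mul (analyticAt_exp_factor σ a)

/-- Identity theorem on ℂ ∖ ℤ, which is connected as the complement of a countable set in a real
plane. Both sides are analytic there, as neither a nor -1 - a is a negative integer, and they agree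
near -1/2 by the strip case. -/
theorem fourier_powLogDist_zero (σ : ℤˣ) {a : ℂ} (ha : a ∈ (Set.range ((↑) : ℤ → ℂ))ᶜ)
    (φ : 𝓢(ℝ, ℂ)) :
    powLogDist σ a 0 (fourierS φ) = fourierCoeff σ a * powLogDist 1 (-1 - a) 0 φ +
      fourierCoeffMinus σ a * powLogDist (-1) (-1 - a) 0 φ := by
  have hU : IsPreconnected (Set.range ((↑) : ℤ → ℂ))ᶜ :=
    ((Set.countable_range _).isConnected_compl_of_one_lt_rank
      (by rw [Complex.rank_real_complex]; norm_num)).isPreconnected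
  have hz0 : (-1 / 2 : ℂ) ∈ (Set.range ((↑) : ℤ → ℂ))ᶜ := by
    rintro ⟨n, hn⟩
    have h : ((2 * n : ℤ) : ℂ) = ((-1 : ℤ) : ℂ) := by push_cast; rw [hn]; ring
    have := Int.cast_injective h
    omega
  refine AnalyticOnNhd.eqOn_of_preconnected_of_eventuallyEq (𝕜 := ℂ)
    (f := fun z : ℂ => powLogDist σ z 0 (fourierS φ))
    (g := fun z : ℂ => fourierCoeff σ z * powLogDist 1 (-1 - z) 0 φ +
      fourierCoeffMinus σ z * powLogDist (-1) (-1 - z) 0 φ)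
    (fun z hz => analyticAt_powLogDist σ (ne_neg_of_notMem_int hz) _)
    (fun z hz => ?_) hU hz0 ?_ ha
  · have hz' := ne_neg_of_notMem_int hz
    exact ((analyticAt_fourierCoeff σ hz').fun_mul (analyticAt_powLogDist_reflect 1 hz φ)).fun_add
      ((analyticAt_fourierCoeffMinus σ hz').fun_mul (analyticAt_powLogDist_reflect (-1) hz φ))
  · have o1 := (isOpen_re_gt (-1)).mem_nhds (show (-1 : ℝ) < (-1 / 2 : ℂ).re by norm_num)
    have o2 := (isOpen_lt Complex.continuous_re continuous_const).mem_nhds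
      (show (-1 / 2 : ℂ).re < (0 : ℝ) by norm_num)
    filter_upwards [o1, o2] with z h1 h2
    have := fourier_powLogDist_strip σ h1 h2 φ
    rw [coeffPlus_zero, coeffMinus_zero, mul_comm (Complex.exp _)] at this
    exact this

theorem iteratedDeriv_exp_factor (σ : ℤˣ) (m : ℕ) (a : ℂ) :
    iteratedDeriv m (fun z : ℂ =>
      Complex.exp (-((σ : ℤ) : ℂ) * (-z - 1) * Real.pi * Complex.I)) a =
      (((σ : ℤ) : ℂ) * Real.pi * Complex.I) ^ m *
        Complex.exp (-((σ : ℤ) : ℂ) * (-a - 1) * Real.pi * Complex.I) := by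
  induction m generalizing a with
  | zero => simp
  | succ m ih =>
    rw [iteratedDeriv_succ, funext ih]
    have h1 : HasDerivAt (fun z : ℂ => -((σ : ℤ) : ℂ) * (-z - 1) * Real.pi * Complex.I)
        (((σ : ℤ) : ℂ) * Real.pi * Complex.I) a := by
      have := ((((hasDerivAt_id a).neg.sub_const 1).const_mul (-((σ : ℤ) : ℂ))).mul_const
        (Real.pi : ℂ)).mul_const Complex.I
      exact this.congr_deriv (by ring)
    rw [(h1.cexp.const_mul _).deriv]
    ring

/-- Shows that the c_j^- read off from the logarithm on the negative axis are also those obtained by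
differentiating c_0^- in the exponent. The two sums match through binom(l,j) binom(j,i) = binom(l,i)
binom(l-i,j-i). -/
theorem coeffMinus_eq (σ : ℤˣ) {a : ℂ} (ha : ∀ n : ℕ, a ≠ -((n : ℂ) + 1)) {l j : ℕ} (hj : j ≤ l) :
    coeffMinus σ a l j =
      (l.choose j : ℂ) * iteratedDeriv j (fourierCoeffMinus σ) a * (-1) ^ (l - j) := by
  have h : iteratedDeriv j (fourierCoeffMinus σ) a = _ := iteratedDeriv_fun_mul
    (analyticAt_fourierCoeff σ ha).contDiffAt (analyticAt_exp_factor σ a).contDiffAt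
  rw [h, coeffMinus, Finset.mul_sum, Finset.mul_sum, Finset.sum_mul]
  refine Finset.sum_congr rfl fun i hi => ?_
  have hij : i ≤ j := by have := Finset.mem_range.1 hi; omega
  rw [iteratedDeriv_exp_factor, coeffPlus]
  have h1 : ((l.choose j : ℂ) * (j.choose i : ℂ)) =
      (l.choose i : ℂ) * ((l - i).choose (j - i) : ℂ) := by
    exact_mod_cast Nat.choose_mul hij
  -- Splitting l - i = (j - i) + (l - j), the first part of the sign turns -σπi into σπi.
  have h2 : (-((σ : ℤ) : ℂ) * Real.pi * Complex.I) ^ (j - i) * (-1) ^ (l - i) =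
      (((σ : ℤ) : ℂ) * Real.pi * Complex.I) ^ (j - i) * (-1) ^ (l - j) := by
    rw [show l - i = (j - i) + (l - j) by omega, pow_add, ← mul_assoc, ← mul_pow]
    congr 2
    ring
  set E := Complex.exp (-((σ : ℤ) : ℂ) * (-a - 1) * Real.pi * Complex.I)
  set D := iteratedDeriv i (fourierCoeff σ) a
  calc E * (((l - i).choose (j - i) : ℂ) * (-((σ : ℤ) : ℂ) * Real.pi * Complex.I) ^ (j - i) *
        ((l.choose i : ℂ) * D * (-1) ^ (l - i)))
      = E * D * ((l.choose i : ℂ) * ((l - i).choose (j - i) : ℂ)) *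
          ((-((σ : ℤ) : ℂ) * Real.pi * Complex.I) ^ (j - i) * (-1) ^ (l - i)) := by ring
    _ = _ := by rw [← h1, h2]; ring

/-- The identity for l = 0 holds on a neighbourhood of a and is differentiated l times there; the
reflection z ↦ -1 - z supplies the signs (-1)^{l-j}. -/
theorem fourier_powLogDist_eq_sum (σ : ℤˣ) {a : ℂ} (ha : ∀ n : ℕ, a ≠ -((n : ℂ) + 1)) (l : ℕ)
    (hn : ∀ n : ℕ, a ≠ n) :
    fourierD (powLogDist σ a l) = ∑ j ∈ Finset.range (l + 1),
      (coeffPlus σ a l j • powLogDist 1 (-a - 1) (l - j) +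
        coeffMinus σ a l j • powLogDist (-1) (-a - 1) (l - j)) := by
  have hZ : a ∈ (Set.range ((↑) : ℤ → ℂ))ᶜ := by
    rintro ⟨n, rfl⟩
    obtain ⟨m, rfl | rfl⟩ := n.eq_nat_or_neg
    · exact hn m (by simp)
    · rcases m with - | m
      · exact hn 0 (by simp)
      · exact ha m (by push_cast; ring)
  have hba : -a - 1 = -1 - a := by ring
  ext φ
  rw [sum_dist_apply, hba]
  change powLogDist σ a l (fourierS φ) = ∑ j ∈ Finset.range (l + 1),
    (coeffPlus σ a l j * powLogDist 1 (-1 - a) (l - j) φ +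
      coeffMinus σ a l j * powLogDist (-1) (-1 - a) (l - j) φ)
  have hr := ne_neg_of_notMem_int (reflect_notMem_int hZ)
  have e : (fun z : ℂ => powLogDist σ z 0 (fourierS φ)) =ᶠ[𝓝 a] fun z : ℂ =>
      fourierCoeff σ z * powLogDist 1 (-1 - z) 0 φ +
        fourierCoeffMinus σ z * powLogDist (-1) (-1 - z) 0 φ := by
    filter_upwards [Complex.isOpen_compl_range_intCast.mem_nhds hZ] with z hz
    exact fourier_powLogDist_zero σ hz φ
  have A1 := analyticAt_fourierCoeff σ ha
  have A2 := analyticAt_fourierCoeffMinus σ ha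
  have B1 := analyticAt_powLogDist_reflect 1 hZ φ
  have B2 := analyticAt_powLogDist_reflect (-1) hZ φ
  rw [powLogDist_eq_iteratedDeriv σ ha, e.iteratedDeriv_eq l,
    iteratedDeriv_fun_add (A1.fun_mul B1).contDiffAt (A2.fun_mul B2).contDiffAt,
    iteratedDeriv_fun_mul A1.contDiffAt B1.contDiffAt,
    iteratedDeriv_fun_mul A2.contDiffAt B2.contDiffAt, ← Finset.sum_add_distrib]
  refine Finset.sum_congr rfl fun j hj => ?_
  have hjl : j ≤ l := by have := Finset.mem_range.1 hj; omega
  rw [coeffMinus_eq σ ha hjl, coeffPlus, iteratedDeriv_comp_const_sub (l - j)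
    (fun z : ℂ => powLogDist 1 z 0 φ), iteratedDeriv_comp_const_sub (l - j)
    (fun z : ℂ => powLogDist (-1) z 0 φ)]
  simp only [smul_eq_mul]
  rw [← powLogDist_eq_iteratedDeriv 1 hr, ← powLogDist_eq_iteratedDeriv (-1) hr]
  ring

/-! ### Fourier transforms of integrable functions -/

/-- The Fourier transform of an integrable function. -/
def fourierFun (v : ℝ → ℂ) (ξ : ℝ) : ℂ :=
  (((Real.sqrt (2 * Real.pi))⁻¹ : ℝ) : ℂ) * ∫ x : ℝ, Complex.exp (-(Complex.I * x * ξ)) * v x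

theorem fourierFun_eq (v : ℝ → ℂ) (ξ : ℝ) :
    fourierFun v ξ = (((Real.sqrt (2 * Real.pi))⁻¹ : ℝ) : ℂ) * (𝓕 v) (ξ * (2 * Real.pi)⁻¹) := by
  rw [fourierFun, Real.fourier_eq']
  congr 1
  refine integral_congr_ae (Eventually.of_forall fun x => ?_)
  simp only [smul_eq_mul]
  congr 2
  have hpi : (Real.pi : ℂ) ≠ 0 := by exact_mod_cast Real.pi_ne_zero
  simp only [RCLike.inner_apply, conj_trivial]
  push_cast
  field_simp

theorem contDiff_fourierFun {v : ℝ → ℂ} {N : ℕ∞}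
    (hv : ∀ n : ℕ, n ≤ N → Integrable fun x : ℝ => ‖x‖ ^ n * ‖v x‖) :
    ContDiff ℝ N (fourierFun v) := by
  rw [show fourierFun v = fun ξ : ℝ => (((Real.sqrt (2 * Real.pi))⁻¹ : ℝ) : ℂ) *
    (𝓕 v) (ξ * (2 * Real.pi)⁻¹) from funext (fourierFun_eq v)]
  have h := Real.contDiff_fourier hv
  exact contDiff_const.mul (h.comp (by fun_prop))

theorem norm_exp_phase (x ξ : ℝ) : ‖Complex.exp (-(Complex.I * x * ξ))‖ = 1 := by
  rw [Complex.norm_exp]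
  simp

theorem norm_fourierFun_le (v : ℝ → ℂ) (ξ : ℝ) :
    ‖fourierFun v ξ‖ ≤ ‖(((Real.sqrt (2 * Real.pi))⁻¹ : ℝ) : ℂ)‖ * ∫ x : ℝ, ‖v x‖ := by
  rw [fourierFun, norm_mul]
  refine mul_le_mul_of_nonneg_left ((norm_integral_le_integral_norm _).trans (le_of_eq ?_))
    (norm_nonneg _)
  refine integral_congr_ae (Eventually.of_forall fun x => ?_)
  simp only [norm_mul, norm_exp_phase, one_mul]

theorem integral_fourierS_mul {v : ℝ → ℂ} (hv : Integrable v) (φ : 𝓢(ℝ, ℂ)) :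
    ∫ x : ℝ, fourierS φ x * v x = ∫ ξ : ℝ, φ ξ * fourierFun v ξ := by
  set c : ℂ := (((Real.sqrt (2 * Real.pi))⁻¹ : ℝ) : ℂ) with hc
  have e1 : ∀ x : ℝ, fourierS φ x * v x =
      ∫ ξ : ℝ, c * (Complex.exp (-(Complex.I * ξ * x)) * (v x * φ ξ)) := by
    intro x
    rw [fourierS_apply, ← hc, integral_const_mul, mul_assoc, ← integral_mul_const]
    congr 1
    refine integral_congr_ae (Eventually.of_forall fun ξ => ?_)
    ring
  have e2 : ∀ ξ : ℝ, φ ξ * fourierFun v ξ =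
      ∫ x : ℝ, c * (Complex.exp (-(Complex.I * ξ * x)) * (v x * φ ξ)) := by
    intro ξ
    rw [fourierFun, ← hc, integral_const_mul, mul_left_comm, ← integral_const_mul]
    congr 1
    refine integral_congr_ae (Eventually.of_forall fun x => ?_)
    simp only
    rw [show Complex.I * (x : ℂ) * ξ = Complex.I * ξ * x by ring]
    ring
  simp only [e1, e2]
  refine integral_integral_swap ?_
  have h1 : Integrable (fun p : ℝ × ℝ => v p.1 * φ p.2) (volume.prod volume) :=
    hv.mul_prod φ.integrable
  have h2 : Integrable (fun p : ℝ × ℝ => Complex.exp (-(Complex.I * p.2 * p.1)) *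
      (v p.1 * φ p.2)) (volume.prod volume) := by
    refine h1.bdd_mul (c := 1) ?_ (Eventually.of_forall fun p => (norm_exp_phase p.2 p.1).le)
    exact (by fun_prop : Continuous fun p : ℝ × ℝ =>
      Complex.exp (-(Complex.I * p.2 * p.1))).aestronglyMeasurable
  exact h2.const_mul c

theorem derivCLM_smulLeft {χ χ' : ℝ → ℂ} (hχ : χ.HasTemperateGrowth) (hχ' : χ'.HasTemperateGrowth)
    (hd : ∀ x, HasDerivAt χ (χ' x) x) (ψ : 𝓢(ℝ, ℂ)) :
    SchwartzMap.derivCLM ℂ ℂ (SchwartzMap.smulLeftCLM ℂ χ ψ) =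
      SchwartzMap.smulLeftCLM ℂ χ' ψ +
        SchwartzMap.smulLeftCLM ℂ χ (SchwartzMap.derivCLM ℂ ℂ ψ) := by
  ext x
  rw [SchwartzMap.derivCLM_apply, add_apply,
    SchwartzMap.smulLeftCLM_apply_apply hχ', SchwartzMap.smulLeftCLM_apply_apply hχ,
    SchwartzMap.derivCLM_apply]
  have e : (SchwartzMap.smulLeftCLM ℂ χ ψ : ℝ → ℂ) = fun x => χ x * ψ x := by
    funext x
    rw [SchwartzMap.smulLeftCLM_apply_apply hχ, smul_eq_mul]
  rw [e]
  exact ((hd x).mul (ψ.hasDerivAt x)).deriv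

/-! ### The part near zero: smooth Fourier transforms -/

/-- The Fourier transform of `S` is a smooth function of polynomial growth. -/
def HasSmoothFourier (S : 𝓢'(ℝ, ℂ)) : Prop :=
  ∃ h : ℝ → ℂ, ContDiff ℝ ∞ h ∧ (∃ (M : ℝ) (N : ℕ), ∀ ξ, ‖h ξ‖ ≤ M * (1 + |ξ|) ^ N) ∧
    ∀ φ : 𝓢(ℝ, ℂ), S (fourierS φ) = ∫ ξ : ℝ, φ ξ * h ξ

theorem integrable_mul_of_poly_bound {h : ℝ → ℂ} (hc : Continuous h) {M : ℝ} {N : ℕ}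
    (hb : ∀ ξ, ‖h ξ‖ ≤ M * (1 + |ξ|) ^ N) (φ : 𝓢(ℝ, ℂ)) : Integrable fun ξ : ℝ => φ ξ * h ξ := by
  refine Integrable.mono' ((integrable_mul_one_add_abs_pow φ 1 zero_le_one N).const_mul M)
    (φ.continuous.mul hc).aestronglyMeasurable (Eventually.of_forall fun ξ => ?_)
  rw [norm_mul]
  calc ‖φ ξ‖ * ‖h ξ‖ ≤ ‖φ ξ‖ * (M * (1 + |ξ|) ^ N) :=
        mul_le_mul_of_nonneg_left (hb ξ) (norm_nonneg _)
    _ = _ := by ring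

theorem HasSmoothFourier.add {S T : 𝓢'(ℝ, ℂ)} (hS : HasSmoothFourier S) (hT : HasSmoothFourier T) :
    HasSmoothFourier (S + T) := by
  obtain ⟨h, h1, ⟨M, N, h2⟩, h3⟩ := hS
  obtain ⟨k, k1, ⟨M', N', k2⟩, k3⟩ := hT
  refine ⟨fun ξ => h ξ + k ξ, h1.add k1, ⟨|M| + |M'|, max N N', fun ξ => ?_⟩, fun φ => ?_⟩
  · have hx : (1 : ℝ) ≤ 1 + |ξ| := by linarith [abs_nonneg ξ]
    refine (norm_add_le _ _).trans ?_
    rw [add_mul]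
    refine add_le_add ((h2 ξ).trans ?_) ((k2 ξ).trans ?_)
    · exact mul_le_mul (le_abs_self _) (pow_le_pow_right₀ hx (le_max_left _ _)) (by positivity)
        (abs_nonneg _)
    · exact mul_le_mul (le_abs_self _) (pow_le_pow_right₀ hx (le_max_right _ _)) (by positivity)
        (abs_nonneg _)
  · change S (fourierS φ) + T (fourierS φ) = _
    rw [h3, k3, ← integral_add (integrable_mul_of_poly_bound h1.continuous h2 φ)
      (integrable_mul_of_poly_bound k1.continuous k2 φ)]
    simp only [mul_add]

theorem HasSmoothFourier.smul {S : 𝓢'(ℝ, ℂ)} (hS : HasSmoothFourier S) (c : ℂ) :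
    HasSmoothFourier (c • S) := by
  obtain ⟨h, h1, ⟨M, N, h2⟩, h3⟩ := hS
  refine ⟨fun ξ => c * h ξ, contDiff_const.mul h1, ⟨‖c‖ * M, N, fun ξ => ?_⟩, fun φ => ?_⟩
  · rw [norm_mul, mul_assoc]
    exact mul_le_mul_of_nonneg_left (h2 ξ) (norm_nonneg _)
  · change c * S (fourierS φ) = _
    rw [h3, ← integral_const_mul]
    refine integral_congr_ae (Eventually.of_forall fun ξ => ?_)
    ring

theorem HasSmoothFourier.zero : HasSmoothFourier 0 :=
  ⟨fun _ => 0, contDiff_const, ⟨0, 0, by simp⟩, fun φ => by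
    change (0 : ℂ) = _
    simp⟩

theorem HasSmoothFourier.sum {T : ℕ → 𝓢'(ℝ, ℂ)} (hT : ∀ m, HasSmoothFourier (T m)) (n : ℕ) :
    HasSmoothFourier (∑ m ∈ Finset.range n, T m) := by
  induction n with
  | zero => simpa using HasSmoothFourier.zero
  | succ n ih =>
    rw [Finset.sum_range_succ]
    exact ih.add (hT n)

theorem derivCLM_fourierS_apply (S : 𝓢'(ℝ, ℂ)) (φ : 𝓢(ℝ, ℂ)) :
    TemperedDistribution.derivCLM ℂ S (fourierS φ) = Complex.I * S (fourierS (mulX φ)) := by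
  rw [TemperedDistribution.derivCLM_apply_apply, deriv_fourierS, neg_neg, map_smul, smul_eq_mul]

/-- A derivative multiplies the transform by iξ. This is why polynomial growth, rather than
boundedness, is carried along. -/
theorem HasSmoothFourier.deriv {S : 𝓢'(ℝ, ℂ)} (hS : HasSmoothFourier S) :
    HasSmoothFourier (TemperedDistribution.derivCLM ℂ S) := by
  obtain ⟨h, h1, ⟨M, N, h2⟩, h3⟩ := hS
  refine ⟨fun ξ => Complex.I * ξ * h ξ, ?_, ⟨M, N + 1, fun ξ => ?_⟩, fun φ => ?_⟩
  · exact (contDiff_const.mul Complex.ofRealCLM.contDiff).mul h1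
  · rw [norm_mul, norm_mul, Complex.norm_I, one_mul, Complex.norm_real, Real.norm_eq_abs, pow_succ,
      ← mul_assoc, mul_comm]
    exact mul_le_mul (h2 ξ) (by linarith) (abs_nonneg _) ((norm_nonneg _).trans (h2 ξ))
  · rw [derivCLM_fourierS_apply, h3, ← integral_const_mul]
    refine integral_congr_ae (Eventually.of_forall fun ξ => ?_)
    simp only [mulX_apply]
    ring

theorem TemperedFun.integrable_cutoff {u w : ℝ → ℂ} (hu : TemperedFun u) (hw : Continuous w)
    (hc : HasCompactSupport w) : Integrable fun x => w x * u x := by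
  obtain ⟨N, hN⟩ := hu
  have hcont : Continuous fun x : ℝ => (((1 + |x|) ^ N : ℝ) : ℂ) * w x := by fun_prop
  obtain ⟨C, hC⟩ := hcont.bounded_above_of_compact_support (hc.mul_left)
  refine (hN.bdd_mul hcont.aestronglyMeasurable (Eventually.of_forall hC)).congr
    (Eventually.of_forall fun x => ?_)
  have : (((1 + |x|) ^ N : ℝ) : ℂ) ≠ 0 := by
    have : (0 : ℝ) < (1 + |x|) ^ N := by positivity
    exact_mod_cast this.ne'
  simp only
  push_cast at this ⊢
  field_simp

/-- A compactly supported integrable function has all moments, so its transform is smooth and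
bounded. -/
theorem hasSmoothFourier_cutoff_base {u w : ℝ → ℂ} (hu : TemperedFun u) (hw : ContDiff ℝ ∞ w)
    (hc : HasCompactSupport w) :
    HasSmoothFourier (TemperedDistribution.smulLeftCLM ℂ w (regularDist u)) := by
  have hi := hu.integrable_cutoff hw.continuous hc
  refine ⟨fourierFun fun x => w x * u x, contDiff_fourierFun (N := ⊤) fun n _ => ?_,
    ⟨_, 0, fun ξ => (norm_fourierFun_le _ ξ).trans (le_of_eq (by rw [pow_zero, mul_one]))⟩,
    fun φ => ?_⟩
  · have hw' : Continuous fun x : ℝ => (x : ℂ) ^ n * w x := by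
      have := hw.continuous
      fun_prop
    refine (hu.integrable_cutoff hw' hc.mul_left).norm.congr (Eventually.of_forall fun x => ?_)
    simp only [norm_mul, norm_pow, Complex.norm_real, mul_assoc]
  · rw [TemperedDistribution.smulLeftCLM_apply_apply, regularDist_apply hu,
      ← integral_fourierS_mul hi]
    refine integral_congr_ae (Eventually.of_forall fun x => ?_)
    simp only
    rw [SchwartzMap.smulLeftCLM_apply_apply (hc.hasTemperateGrowth hw), smul_eq_mul]
    ring

/-- Uses w ∂S = ∂(wS) - w'S. The induction runs over all compactly supported smooth w at once
because w' appears. -/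
theorem hasSmoothFourier_cutoff_deriv {u : ℝ → ℂ} (hu : TemperedFun u) (k : ℕ) {w : ℝ → ℂ}
    (hw : ContDiff ℝ ∞ w) (hc : HasCompactSupport w) :
    HasSmoothFourier (TemperedDistribution.smulLeftCLM ℂ w
      ((TemperedDistribution.derivCLM ℂ)^[k] (regularDist u))) := by
  induction k generalizing w with
  | zero => exact hasSmoothFourier_cutoff_base hu hw hc
  | succ k ih =>
    have hw' : ContDiff ℝ ∞ (deriv w) := by
      simpa using hw.iterate_deriv 1
    have hc' : HasCompactSupport (deriv w) := hc.deriv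
    have hd : ∀ x, HasDerivAt w (deriv w x) x := fun x =>
      (hw.differentiable (by simp) x).hasDerivAt
    have e : TemperedDistribution.smulLeftCLM ℂ w
        ((TemperedDistribution.derivCLM ℂ)^[k + 1] (regularDist u)) =
        TemperedDistribution.derivCLM ℂ (TemperedDistribution.smulLeftCLM ℂ w
          ((TemperedDistribution.derivCLM ℂ)^[k] (regularDist u))) +
        (-1 : ℂ) • TemperedDistribution.smulLeftCLM ℂ (deriv w)
          ((TemperedDistribution.derivCLM ℂ)^[k] (regularDist u)) := by
      rw [Function.iterate_succ_apply']
      set S := (TemperedDistribution.derivCLM ℂ)^[k] (regularDist u)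
      ext ψ
      change S (-SchwartzMap.derivCLM ℂ ℂ (SchwartzMap.smulLeftCLM ℂ w ψ)) =
        S (SchwartzMap.smulLeftCLM ℂ w (-SchwartzMap.derivCLM ℂ ℂ ψ)) +
          (-1) * S (SchwartzMap.smulLeftCLM ℂ (deriv w) ψ)
      rw [derivCLM_smulLeft (hc.hasTemperateGrowth hw) (hc'.hasTemperateGrowth hw') hd]
      simp only [map_neg, map_add]
      ring
    rw [e]
    exact (ih hw hc).deriv.add ((ih hw' hc').smul (-1))

theorem IsCutoff.complex {w : ℝ → ℝ} (hw : IsCutoff w) :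
    ContDiff ℝ ∞ (fun x => (w x : ℂ)) ∧ HasCompactSupport fun x => (w x : ℂ) :=
  ⟨Complex.ofRealCLM.contDiff.comp hw.smooth, hw.compact.comp_left Complex.ofReal_zero⟩

theorem hasSmoothFourier_mulDist (σ : ℤˣ) (a : ℂ) (l : ℕ) {w : ℝ → ℝ} (hw : IsCutoff w) :
    HasSmoothFourier (mulDist w (powLogDist σ a l)) := by
  simp only [mulDist, powLogDist, map_sum, map_smul]
  refine HasSmoothFourier.sum (fun m => ?_) (l + 1)
  exact (hasSmoothFourier_cutoff_deriv
    (temperedFun_powLogFun σ (powLogDist_exponent a) m) _ hw.complex.1 hw.complex.2).smul _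

/-! ### The functions `x_±^a ln^l |x|` off the origin -/

theorem eventually_sign_pos {σ : ℤˣ} {x : ℝ} (h : 0 < ((σ : ℤ) : ℝ) * x) :
    ∀ᶠ y in 𝓝 x, 0 < ((σ : ℤ) : ℝ) * y :=
  (by fun_prop : Continuous fun y : ℝ => ((σ : ℤ) : ℝ) * y).continuousAt.eventually_const_lt h

theorem eventually_sign_neg {σ : ℤˣ} {x : ℝ} (h : ((σ : ℤ) : ℝ) * x < 0) :
    ∀ᶠ y in 𝓝 x, ((σ : ℤ) : ℝ) * y < 0 :=
  (by fun_prop : Continuous fun y : ℝ => ((σ : ℤ) : ℝ) * y).continuousAt.eventually_lt_const h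

theorem abs_eq_sign_mul {σ : ℤˣ} {x : ℝ} (h : 0 < ((σ : ℤ) : ℝ) * x) :
    |x| = ((σ : ℤ) : ℝ) * x := by
  rw [← abs_of_pos h, abs_mul, abs_sign, one_mul]

theorem powLogFun_eq_of_pos {σ : ℤˣ} (a : ℂ) (l : ℕ) {x : ℝ} (h : 0 < ((σ : ℤ) : ℝ) * x) :
    powLogFun σ a l x = Complex.exp ((Real.log (((σ : ℤ) : ℝ) * x) : ℝ) * a) *
      ((Real.log (((σ : ℤ) : ℝ) * x) : ℝ) : ℂ) ^ l := by
  rw [powLogFun, if_pos h, abs_eq_sign_mul h, Complex.cpow_def_of_ne_zero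
    (by exact_mod_cast h.ne'), Complex.ofReal_log h.le]

theorem powLogFun_eq_zero {σ : ℤˣ} (a : ℂ) (l : ℕ) {x : ℝ} (h : ((σ : ℤ) : ℝ) * x < 0) :
    powLogFun σ a l x = 0 := by
  rw [powLogFun, if_neg (not_lt.2 h.le)]

theorem sign_mul_ne_zero (σ : ℤˣ) {x : ℝ} (hx : x ≠ 0) : ((σ : ℤ) : ℝ) * x ≠ 0 := by
  intro h
  have := congrArg abs h
  rw [abs_mul, abs_sign, one_mul, abs_zero, abs_eq_zero] at this
  exact hx this

theorem contDiffAt_powLogFun (σ : ℤˣ) (a : ℂ) (l : ℕ) {x : ℝ} (hx : x ≠ 0) :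
    ContDiffAt ℝ ∞ (powLogFun σ a l) x := by
  rcases lt_or_gt_of_ne (sign_mul_ne_zero σ hx) with h | h
  · refine (contDiffAt_const (c := (0 : ℂ))).congr_of_eventuallyEq ?_
    filter_upwards [eventually_sign_neg h] with y hy
    exact powLogFun_eq_zero a l hy
  · have hlog : ContDiffAt ℝ ∞ (fun y : ℝ => ((Real.log (((σ : ℤ) : ℝ) * y) : ℝ) : ℂ)) x :=
      Complex.ofRealCLM.contDiff.contDiffAt.comp x
        ((contDiffAt_const.mul contDiffAt_id).log h.ne')
    refine ContDiffAt.congr_of_eventuallyEq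
      ((hlog.mul (contDiffAt_const (c := a))).cexp.mul (hlog.pow l)) ?_
    filter_upwards [eventually_sign_pos h] with y hy
    exact powLogFun_eq_of_pos a l hy

theorem hasDerivAt_powLogFun (σ : ℤˣ) (a : ℂ) (l : ℕ) {x : ℝ} (hx : x ≠ 0) :
    HasDerivAt (powLogFun σ a l)
      (((σ : ℤ) : ℂ) * (a * powLogFun σ (a - 1) l x + l * powLogFun σ (a - 1) (l - 1) x)) x := by
  rcases lt_or_gt_of_ne (sign_mul_ne_zero σ hx) with h | h
  · rw [powLogFun_eq_zero _ _ h, powLogFun_eq_zero _ _ h]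
    simp only [mul_zero, add_zero]
    refine (hasDerivAt_const x (0 : ℂ)).congr_of_eventuallyEq ?_
    filter_upwards [eventually_sign_neg h] with y hy
    exact powLogFun_eq_zero a l hy
  · set s := ((σ : ℤ) : ℝ) with hs
    have hL : HasDerivAt (fun y : ℝ => ((Real.log (s * y) : ℝ) : ℂ)) (((s * x)⁻¹ * s : ℝ) : ℂ) x := by
      have h1 : HasDerivAt (fun y : ℝ => s * y) s x := by
        simpa using (hasDerivAt_id x).const_mul s
      exact ((Real.hasDerivAt_log h.ne').comp x h1).ofReal_comp
    have h2 := (hL.mul_const a).cexp.mul (hL.pow l)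
    refine (h2.congr_of_eventuallyEq ?_).congr_deriv ?_
    · filter_upwards [eventually_sign_pos h] with y hy
      exact powLogFun_eq_of_pos a l hy
    · rw [powLogFun_eq_of_pos _ _ h, powLogFun_eq_of_pos _ _ h]
      have hE : Complex.exp ((Real.log (s * x) : ℝ) * (a - 1)) =
          Complex.exp ((Real.log (s * x) : ℝ) * a) * ((s * x : ℝ) : ℂ)⁻¹ := by
        rw [mul_sub, mul_one, Complex.exp_sub, ← Complex.ofReal_exp, Real.exp_log h, div_eq_mul_inv]
      rw [← hs, hE, Pi.pow_apply, show ((σ : ℤ) : ℂ) = (s : ℂ) by rw [hs, ofReal_sign]]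
      push_cast
      ring

/-- Away from zero the exponent may be raised until its real part exceeds -1, where integrability
against a negative power of 1 + |x| is already known. -/
theorem norm_powLogFun_le_shift (σ : ℤˣ) (a : ℂ) (l n : ℕ) {δ : ℝ} (hδ : 0 < δ) {x : ℝ}
    (hx : δ ≤ |x|) :
    ‖powLogFun σ a l x‖ ≤ (δ ^ n)⁻¹ * ‖powLogFun σ (a + n) l x‖ := by
  have habs : (0 : ℝ) < |x| := hδ.trans_le hx
  unfold powLogFun
  split_ifs
  · rw [norm_mul, norm_mul, Complex.norm_cpow_eq_rpow_re_of_pos habs,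
      Complex.norm_cpow_eq_rpow_re_of_pos habs, Complex.add_re, Complex.natCast_re,
      Real.rpow_add_natCast habs.ne', ← mul_assoc]
    refine mul_le_mul_of_nonneg_right ?_ (norm_nonneg _)
    have h1 : δ ^ n ≤ |x| ^ n := pow_le_pow_left₀ hδ.le hx n
    rw [inv_mul_eq_div, le_div_iff₀ (by positivity)]
    exact mul_le_mul_of_nonneg_left h1 (Real.rpow_nonneg habs.le _)
  · simp

theorem measurable_powLogFun (σ : ℤˣ) (a : ℂ) (l : ℕ) : Measurable (powLogFun σ a l) := by
  unfold powLogFun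
  exact Measurable.ite (measurableSet_lt (by fun_prop) (by fun_prop)) (by fun_prop) (by fun_prop)

theorem temperedFun_mul_powLogFun (σ : ℤˣ) (a : ℂ) (l : ℕ) {χ : ℝ → ℂ} (hm : Measurable χ)
    {C : ℝ} (hb : ∀ x, ‖χ x‖ ≤ C) (h0 : ∀ᶠ x in 𝓝 0, χ x = 0) :
    TemperedFun fun x => χ x * powLogFun σ a l x := by
  obtain ⟨δ, hδ, hball⟩ := Metric.eventually_nhds_iff.1 h0
  obtain ⟨n, hn⟩ := exists_nat_re a
  obtain ⟨N, hN⟩ := temperedFun_powLogFun σ (a := a + n) (by simpa using hn) l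
  refine ⟨N, Integrable.mono' (hN.norm.const_mul (C * (δ ^ n)⁻¹)) ?_
    (Eventually.of_forall fun x => ?_)⟩
  · have := measurable_powLogFun σ a l
    exact (by fun_prop : Measurable fun x : ℝ => ((((1 + |x|) ^ N)⁻¹ : ℝ) : ℂ) *
      (χ x * powLogFun σ a l x)).aestronglyMeasurable
  · have hC : 0 ≤ C := (norm_nonneg _).trans (hb 0)
    by_cases hx : |x| < δ
    · simp only [hball (show dist x 0 < δ by simpa using hx), zero_mul, mul_zero, norm_zero]
      positivity
    · rw [norm_mul, norm_mul, norm_mul]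
      have h1 := norm_powLogFun_le_shift σ a l n hδ (not_lt.1 hx)
      calc ‖((((1 + |x|) ^ N)⁻¹ : ℝ) : ℂ)‖ * (‖χ x‖ * ‖powLogFun σ a l x‖)
          ≤ ‖((((1 + |x|) ^ N)⁻¹ : ℝ) : ℂ)‖ * (C * ((δ ^ n)⁻¹ * ‖powLogFun σ (a + n) l x‖)) :=
            mul_le_mul_of_nonneg_left (mul_le_mul (hb x) h1 (norm_nonneg _) hC) (norm_nonneg _)
        _ = _ := by ring

theorem integrable_mul_powLogFun_off (σ : ℤˣ) (a : ℂ) (l : ℕ) (φ : 𝓢(ℝ, ℂ))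
    (hφ : (0 : ℝ) ∉ tsupport φ) : Integrable fun x => φ x * powLogFun σ a l x := by
  obtain ⟨δ, hδ, hball⟩ := Metric.eventually_nhds_iff.1 (notMem_tsupport_iff_eventuallyEq.1 hφ)
  obtain ⟨n, hn⟩ := exists_nat_re a
  obtain ⟨N, hN⟩ := temperedFun_powLogFun σ (a := a + n) (by simpa using hn) l
  refine Integrable.mono' ((TemperedFun.integrable_mul hN φ).1.norm.const_mul (δ ^ n)⁻¹)
    (φ.continuous.measurable.mul (measurable_powLogFun σ a l)).aestronglyMeasurable
    (Eventually.of_forall fun x => ?_)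
  by_cases hx : |x| < δ
  · have : φ x = 0 := hball (by simpa using hx)
    rw [this, zero_mul, norm_zero, zero_mul, norm_zero, mul_zero]
  · rw [norm_mul, norm_mul]
    calc ‖φ x‖ * ‖powLogFun σ a l x‖
        ≤ ‖φ x‖ * ((δ ^ n)⁻¹ * ‖powLogFun σ (a + n) l x‖) :=
          mul_le_mul_of_nonneg_left (norm_powLogFun_le_shift σ a l n hδ (not_lt.1 hx))
            (norm_nonneg _)
      _ = _ := by ring

theorem integrable_mul_logPolyFun_off (b : ℂ) (l : ℕ) (cp cm : ℕ → ℂ) (φ : 𝓢(ℝ, ℂ))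
    (hφ : (0 : ℝ) ∉ tsupport φ) : Integrable fun x => φ x * logPolyFun b l cp cm x := by
  simp only [logPolyFun, Finset.mul_sum]
  refine integrable_finsetSum _ fun j _ => ?_
  refine (((integrable_mul_powLogFun_off 1 b (l - j) φ hφ).const_mul (cp j)).add
    ((integrable_mul_powLogFun_off (-1) b (l - j) φ hφ).const_mul (cm j))).congr
    (Eventually.of_forall fun x => ?_)
  simp only [Pi.add_apply]
  ring

theorem contDiffOn_logPolyFun (b : ℂ) (l : ℕ) (cp cm : ℕ → ℂ) :
    ContDiffOn ℝ ∞ (logPolyFun b l cp cm) {0}ᶜ := by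
  intro x hx
  unfold logPolyFun
  refine ContDiffAt.contDiffWithinAt (ContDiffAt.sum fun j _ => ?_)
  exact (contDiffAt_const.mul (contDiffAt_powLogFun 1 b _ hx)).add
    (contDiffAt_const.mul (contDiffAt_powLogFun (-1) b _ hx))

/-! ### Cut-offs vanishing near zero -/

/-- A smooth function vanishing near zero whose derivative has compact support. -/
structure AwayCutoff (χ : ℝ → ℂ) : Prop where
  smooth : ContDiff ℝ ∞ χ
  zero : ∀ᶠ x in 𝓝 0, χ x = 0
  compact : HasCompactSupport (deriv χ)
  temperate : χ.HasTemperateGrowth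
  bounded : ∃ C, ∀ x, ‖χ x‖ ≤ C

theorem contDiff_deriv {χ : ℝ → ℂ} (h : ContDiff ℝ ∞ χ) : ContDiff ℝ ∞ (deriv χ) := by
  simpa using h.iterate_deriv 1

theorem eventually_deriv_zero {χ : ℝ → ℂ} {x : ℝ} (h : ∀ᶠ y in 𝓝 x, χ y = 0) :
    ∀ᶠ y in 𝓝 x, deriv χ y = 0 := by
  have h2 : χ =ᶠ[𝓝 x] fun _ => (0 : ℂ) := h
  filter_upwards [h2.deriv] with y hy
  rw [hy, deriv_const]

theorem awayCutoff_of_compact {χ : ℝ → ℂ} (h1 : ContDiff ℝ ∞ χ) (h2 : ∀ᶠ x in 𝓝 0, χ x = 0)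
    (h3 : HasCompactSupport χ) : AwayCutoff χ where
  smooth := h1
  zero := h2
  compact := h3.deriv
  temperate := h3.hasTemperateGrowth h1
  bounded := h1.continuous.bounded_above_of_compact_support h3

theorem AwayCutoff.deriv {χ : ℝ → ℂ} (h : AwayCutoff χ) : AwayCutoff (deriv χ) :=
  awayCutoff_of_compact (contDiff_deriv h.smooth) (eventually_deriv_zero h.zero) h.compact

theorem AwayCutoff.hasDerivAt {χ : ℝ → ℂ} (h : AwayCutoff χ) (x : ℝ) :
    HasDerivAt χ (_root_.deriv χ x) x := (h.smooth.differentiable (by simp) x).hasDerivAt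

theorem IsCutoff.away {w : ℝ → ℝ} (hw : IsCutoff w) :
    AwayCutoff fun x => ((1 - w x : ℝ) : ℂ) := by
  obtain ⟨h1, h2⟩ := hw.complex
  have e : (fun x => ((1 - w x : ℝ) : ℂ)) = fun x => 1 - (w x : ℂ) := by
    funext x
    push_cast
    rfl
  rw [e]
  refine ⟨contDiff_const.sub h1, ?_, ?_, ?_, ?_⟩
  · filter_upwards [hw.eq_one] with x hx
    simp [hx]
  · have : _root_.deriv (fun x => 1 - (w x : ℂ)) = -_root_.deriv fun x => (w x : ℂ) := by
      funext x
      simp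
    rw [this]
    exact h2.deriv.neg
  · exact (Function.HasTemperateGrowth.const 1).sub (h2.hasTemperateGrowth h1)
  · obtain ⟨C, hC⟩ := h1.continuous.bounded_above_of_compact_support h2
    refine ⟨1 + C, fun x => (norm_sub_le _ _).trans ?_⟩
    rw [norm_one]
    linarith [hC x]

theorem AwayCutoff.contDiff_mul {χ : ℝ → ℂ} (h : AwayCutoff χ) (σ : ℤˣ) (a : ℂ) (l : ℕ) :
    ContDiff ℝ ∞ fun x => χ x * powLogFun σ a l x := by
  rw [contDiff_iff_contDiffAt]
  intro x
  by_cases hx : x = 0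
  · subst hx
    refine (contDiffAt_const (c := (0 : ℂ))).congr_of_eventuallyEq ?_
    filter_upwards [h.zero] with y hy
    rw [hy, zero_mul]
  · exact h.smooth.contDiffAt.mul (contDiffAt_powLogFun σ a l hx)

theorem AwayCutoff.hasDerivAt_mul {χ : ℝ → ℂ} (h : AwayCutoff χ) (σ : ℤˣ) (a : ℂ) (l : ℕ) (x : ℝ) :
    HasDerivAt (fun x => χ x * powLogFun σ a l x)
      (_root_.deriv χ x * powLogFun σ a l x + ((σ : ℤ) : ℂ) *
        (a * (χ x * powLogFun σ (a - 1) l x) + l * (χ x * powLogFun σ (a - 1) (l - 1) x))) x := by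
  by_cases hx : x = 0
  · subst hx
    rw [h.zero.self_of_nhds, (eventually_deriv_zero h.zero).self_of_nhds]
    simp only [zero_mul, mul_zero, add_zero]
    refine (hasDerivAt_const (0 : ℝ) (0 : ℂ)).congr_of_eventuallyEq ?_
    filter_upwards [h.zero] with y hy
    rw [hy, zero_mul]
  · exact ((h.hasDerivAt x).mul (hasDerivAt_powLogFun σ a l hx)).congr_deriv (by ring)

theorem AwayCutoff.tempered {χ : ℝ → ℂ} (h : AwayCutoff χ) (σ : ℤˣ) (a : ℂ) (l : ℕ) :
    TemperedFun fun x => χ x * powLogFun σ a l x := by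
  obtain ⟨C, hC⟩ := h.bounded
  exact temperedFun_mul_powLogFun σ a l h.smooth.continuous.measurable hC h.zero

theorem TemperedFun.integrable {f : ℝ → ℂ} (hf : TemperedFun f) (φ : 𝓢(ℝ, ℂ)) :
    Integrable fun x => φ x * f x := by
  obtain ⟨N, hN⟩ := hf
  exact (TemperedFun.integrable_mul hN φ).1

/-- Integration by parts without boundary terms: a Schwartz function times a tempered function is
integrable on the whole line. -/
theorem AwayCutoff.integral_deriv_mul {χ : ℝ → ℂ} (h : AwayCutoff χ) (σ : ℤˣ) (a : ℂ) (l : ℕ)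
    (ψ : 𝓢(ℝ, ℂ)) :
    ∫ x : ℝ, SchwartzMap.derivCLM ℂ ℂ ψ x * (χ x * powLogFun σ a l x) =
      -((∫ x : ℝ, ψ x * (_root_.deriv χ x * powLogFun σ a l x)) + ((σ : ℤ) : ℂ) *
        (a * (∫ x : ℝ, ψ x * (χ x * powLogFun σ (a - 1) l x)) +
          l * ∫ x : ℝ, ψ x * (χ x * powLogFun σ (a - 1) (l - 1) x))) := by
  have i1 := (h.deriv.tempered σ a l).integrable ψ
  have i2 := (h.tempered σ (a - 1) l).integrable ψ
  have i3 := (h.tempered σ (a - 1) (l - 1)).integrable ψ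
  have i4 : Integrable fun x => a * (ψ x * (χ x * powLogFun σ (a - 1) l x)) +
      l * (ψ x * (χ x * powLogFun σ (a - 1) (l - 1) x)) := (i2.const_mul a).add (i3.const_mul _)
  have hi := i1.add (i4.const_mul ((σ : ℤ) : ℂ))
  rw [← integral_const_mul, ← integral_const_mul, ← integral_add (i2.const_mul a) (i3.const_mul _),
    ← integral_const_mul, ← integral_add i1 (i4.const_mul _)]
  have hd := integral_mul_deriv_eq_deriv_mul_of_integrable (u := ψ)
    (v := fun x => χ x * powLogFun σ a l x) (u' := SchwartzMap.derivCLM ℂ ℂ ψ)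
    (fun x _ => by rw [SchwartzMap.derivCLM_apply]; exact ψ.hasDerivAt x)
    (fun x _ => h.hasDerivAt_mul σ a l x)
    (hi.congr (Eventually.of_forall fun x => by simp only [Pi.add_apply, Pi.mul_apply]; ring))
    ((h.tempered σ a l).integrable _) ((h.tempered σ a l).integrable ψ)
  rw [eq_neg_iff_add_eq_zero, add_comm, ← eq_neg_iff_add_eq_zero, ← hd]
  refine integral_congr_ae (Eventually.of_forall fun x => ?_)
  ring

/-- Away from zero `x_±^a ln^l |x|` is the function. -/
theorem AwayCutoff.powLogDist_apply {χ : ℝ → ℂ} (h : AwayCutoff χ) (σ : ℤˣ) {a : ℂ}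
    (ha : ∀ n : ℕ, a ≠ -((n : ℂ) + 1)) (l : ℕ) (ψ : 𝓢(ℝ, ℂ)) :
    powLogDist σ a l (SchwartzMap.smulLeftCLM ℂ χ ψ) =
      ∫ x : ℝ, ψ x * (χ x * powLogFun σ a l x) := by
  -- The claim is quantified over χ because the recursion, tested on χψ, produces χ', which is again
  -- a cut-off of this kind.
  refine exponent_induction (P := fun a l => ∀ χ : ℝ → ℂ, AwayCutoff χ → ∀ ψ : 𝓢(ℝ, ℂ),
    powLogDist σ a l (SchwartzMap.smulLeftCLM ℂ χ ψ) =
      ∫ x : ℝ, ψ x * (χ x * powLogFun σ a l x)) ?_ ?_ ha l χ h ψ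
  · intro a l ha χ h ψ
    rw [powLogDist_of_re σ ha, regularDist_apply (temperedFun_powLogFun σ ha l)]
    refine integral_congr_ae (Eventually.of_forall fun x => ?_)
    simp only
    rw [SchwartzMap.smulLeftCLM_apply_apply h.temperate, smul_eq_mul]
    ring
  · intro a l ha h1 h2 χ h ψ
    have hrec := powLogDist_deriv σ ha l (SchwartzMap.smulLeftCLM ℂ χ ψ)
    rw [derivCLM_smulLeft h.temperate h.deriv.temperate h.hasDerivAt, map_add, h1 _ h.deriv,
      h1 _ h, h.integral_deriv_mul, add_sub_cancel_right] at hrec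
    have hl : (l : ℂ) * powLogDist σ a (l - 1) (SchwartzMap.smulLeftCLM ℂ χ ψ) =
        l * ∫ x : ℝ, ψ x * (χ x * powLogFun σ a (l - 1) x) := by
      by_cases hl : l = 0
      · simp [hl]
      · rw [h2 hl χ h ψ]
    rw [mul_add, mul_add, hl] at hrec
    refine mul_left_cancel₀ (add_one_ne_zero_of ha) ?_
    linear_combination ((σ : ℤ) : ℂ) * hrec +
      ((a + 1) * (∫ x : ℝ, ψ x * (χ x * powLogFun σ a l x)) -
        (a + 1) * powLogDist σ a l (SchwartzMap.smulLeftCLM ℂ χ ψ)) * sign_mul_self' σ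

/-! ### The part away from zero: rapid decrease of the Fourier transform -/

/-- `ξ^N` times the Fourier transform of `v` is a bounded continuous function. -/
def HasBoundedFourier (N : ℕ) (v : ℝ → ℂ) : Prop :=
  ∃ G : ℝ → ℂ, Continuous G ∧ (∃ M, ∀ ξ, ‖G ξ‖ ≤ M) ∧
    ∀ φ : 𝓢(ℝ, ℂ), ∫ x : ℝ, fourierS (mulX^[N] φ) x * v x = ∫ ξ : ℝ, φ ξ * G ξ

theorem hasBoundedFourier_of_integrable {v : ℝ → ℂ} (hv : Integrable v) : HasBoundedFourier 0 v :=
  ⟨fourierFun v, (contDiff_fourierFun (N := 0) fun n hn => by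
    have : n = 0 := by simpa using hn
    simpa [this] using hv.norm).continuous, ⟨_, norm_fourierFun_le v⟩,
    fun φ => integral_fourierS_mul hv φ⟩

/-- The hypothesis `hibp` says weakly that v' = r + c₁v₁ + c₂v₂. Since the transform of v' is iξ
times that of v, one more power of ξ becomes available, with the factor -i. -/
theorem hasBoundedFourier_succ {N : ℕ} {v r v₁ v₂ : ℝ → ℂ} {c₁ c₂ : ℂ}
    (hibp : ∀ ψ : 𝓢(ℝ, ℂ), ∫ x : ℝ, SchwartzMap.derivCLM ℂ ℂ ψ x * v x =
      -((∫ x : ℝ, ψ x * r x) + (c₁ * (∫ x : ℝ, ψ x * v₁ x) + c₂ * ∫ x : ℝ, ψ x * v₂ x)))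
    (hr : HasBoundedFourier N r) (h₁ : HasBoundedFourier N v₁) (h₂ : HasBoundedFourier N v₂) :
    HasBoundedFourier (N + 1) v := by
  obtain ⟨G, hG, ⟨M, hM⟩, hrep⟩ := hr
  obtain ⟨G₁, hG₁, ⟨M₁, hM₁⟩, hrep₁⟩ := h₁
  obtain ⟨G₂, hG₂, ⟨M₂, hM₂⟩, hrep₂⟩ := h₂
  refine ⟨fun ξ => -Complex.I * (G ξ + (c₁ * G₁ ξ + c₂ * G₂ ξ)), by fun_prop,
    ⟨M + (‖c₁‖ * M₁ + ‖c₂‖ * M₂), fun ξ => ?_⟩, fun φ => ?_⟩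
  · rw [norm_mul, norm_neg, Complex.norm_I, one_mul]
    refine (norm_add_le _ _).trans (add_le_add (hM ξ) ((norm_add_le _ _).trans ?_))
    rw [norm_mul, norm_mul]
    exact add_le_add (mul_le_mul_of_nonneg_left (hM₁ ξ) (norm_nonneg _))
      (mul_le_mul_of_nonneg_left (hM₂ ξ) (norm_nonneg _))
  · have hb : ∀ {H : ℝ → ℂ} {K : ℝ}, Continuous H → (∀ ξ, ‖H ξ‖ ≤ K) →
        Integrable fun ξ => φ ξ * H ξ := fun hc hK =>
      integrable_mul_of_poly_bound (N := 0) hc (by simpa using hK) φ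
    have i := hb hG hM
    have i₁ := hb hG₁ hM₁
    have i₂ := hb hG₂ hM₂
    have i₃ : Integrable fun ξ => c₁ * (φ ξ * G₁ ξ) + c₂ * (φ ξ * G₂ ξ) :=
      (i₁.const_mul c₁).add (i₂.const_mul c₂)
    have h := hibp (fourierS (mulX^[N] φ))
    rw [deriv_fourierS, hrep, hrep₁, hrep₂, ← integral_const_mul, ← integral_const_mul,
      ← integral_add (i₁.const_mul c₁) (i₂.const_mul c₂),
      ← integral_add i i₃] at h
    rw [Function.iterate_succ_apply']
    have e1 : ∫ x : ℝ, fourierS (mulX (mulX^[N] φ)) x * v x =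
        Complex.I * ∫ x : ℝ, (-(Complex.I • fourierS (mulX (mulX^[N] φ)))) x * v x := by
      rw [← integral_const_mul]
      refine integral_congr_ae (Eventually.of_forall fun x => ?_)
      change _ = Complex.I * (-(Complex.I * fourierS (mulX (mulX^[N] φ)) x) * v x)
      linear_combination (fourierS (mulX (mulX^[N] φ)) x * v x) * Complex.I_mul_I
    rw [e1, h, ← neg_mul_comm, ← integral_const_mul]
    refine integral_congr_ae (Eventually.of_forall fun x => ?_)
    beta_reduce
    ring

theorem hasBoundedFourier_schwartz (N : ℕ) (f : 𝓢(ℝ, ℂ)) : HasBoundedFourier N f := by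
  induction N generalizing f with
  | zero => exact hasBoundedFourier_of_integrable f.integrable
  | succ N ih =>
    refine hasBoundedFourier_succ (c₁ := 0) (c₂ := 0) (fun ψ => ?_)
      (ih (SchwartzMap.derivCLM ℂ ℂ f)) (ih f) (ih f)
    have h := SchwartzMap.integral_mul_deriv_eq_neg_deriv_mul ψ f
    simp only [SchwartzMap.derivCLM_apply, zero_mul, add_zero]
    rw [h, neg_neg]

/-- Each logarithm is bounded crudely by a multiple of 1 + |x|. Hence the condition on Re a + l; the
loss does not matter, since arbitrarily many derivatives can be taken. -/
theorem integrable_mul_powLogFun_away (σ : ℤˣ) {a : ℂ} {l : ℕ} (hal : a.re + l < -1) {χ : ℝ → ℂ}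
    (h : AwayCutoff χ) : Integrable fun x => χ x * powLogFun σ a l x := by
  obtain ⟨C, hC⟩ := h.bounded
  have hC0 : 0 ≤ C := (norm_nonneg _).trans (hC 0)
  obtain ⟨δ, hδ, hball⟩ := Metric.eventually_nhds_iff.1 h.zero
  -- Chosen so that 1 + |x| ≤ B|x| whenever |x| ≥ δ.
  set B : ℝ := 1 + δ⁻¹ with hB
  have hδ' : 0 < δ⁻¹ := inv_pos.2 hδ
  have hB0 : 0 < B := by positivity
  have hl : (0 : ℝ) ≤ l := Nat.cast_nonneg l
  have hint : Integrable fun x : ℝ => (1 + ‖x‖) ^ (-(-(a.re + l))) :=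
    integrable_one_add_norm (by simp only [Module.finrank_self, Nat.cast_one]; linarith)
  refine Integrable.mono' (hint.const_mul (C * ((B⁻¹) ^ a.re * B ^ l)))
    (h.smooth.continuous.measurable.mul (measurable_powLogFun σ a l)).aestronglyMeasurable
    (Eventually.of_forall fun x => ?_)
  rw [neg_neg, norm_mul]
  have hx1 : 0 < 1 + ‖x‖ := by positivity
  by_cases hx : |x| < δ
  · rw [hball (by simpa using hx), norm_zero, zero_mul]
    positivity
  · rw [mul_assoc]
    refine mul_le_mul (hC x) ?_ (norm_nonneg _) hC0
    rw [powLogFun]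
    split_ifs
    · have hxδ := not_lt.1 hx
      have habs : (0 : ℝ) < |x| := hδ.trans_le hxδ
      have hinv : |x|⁻¹ ≤ δ⁻¹ := inv_anti₀ hδ hxδ
      have hone : 1 ≤ δ⁻¹ * |x| := by
        rw [inv_mul_eq_div, le_div_iff₀ hδ]
        linarith
      rw [norm_mul, norm_pow, Complex.norm_cpow_eq_rpow_re_of_pos habs, Complex.norm_real,
        Real.norm_eq_abs, Real.norm_eq_abs, Real.rpow_add_natCast (by positivity)]
      have b1 : |x| ^ a.re ≤ (B⁻¹) ^ a.re * (1 + |x|) ^ a.re := by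
        rw [← Real.mul_rpow (by positivity) (by positivity)]
        refine Real.rpow_le_rpow_of_nonpos (by positivity) ?_ (by linarith)
        rw [inv_mul_eq_div, div_le_iff₀ hB0, hB]
        linarith
      have b2 : |Real.log (|x|)| ≤ B * (1 + |x|) := by
        have h3 := Real.log_le_sub_one_of_pos habs
        have h4 := Real.log_le_sub_one_of_pos (inv_pos.2 habs)
        rw [Real.log_inv] at h4
        have h5 : B * (1 + |x|) = 1 + |x| + δ⁻¹ + δ⁻¹ * |x| := by rw [hB]; ring
        rw [h5, abs_le]
        constructor <;> linarith
      calc |x| ^ a.re * |Real.log (|x|)| ^ l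
          ≤ ((B⁻¹) ^ a.re * (1 + |x|) ^ a.re) * (B * (1 + |x|)) ^ l :=
            mul_le_mul b1 (pow_le_pow_left₀ (abs_nonneg _) b2 l) (by positivity) (by positivity)
        _ = _ := by rw [mul_pow]; ring
    · rw [norm_zero]
      positivity

/-- A derivative lowers Re a + l by at least one, apart from the term with χ', which is smooth with
compact support and hence Schwartz. After N derivatives everything is integrable. -/
theorem AwayCutoff.hasBoundedFourier (σ : ℤˣ) (N : ℕ) {a : ℂ} {l : ℕ} (hal : a.re + l < N - 1)
    {χ : ℝ → ℂ} (h : AwayCutoff χ) : HasBoundedFourier N fun x => χ x * powLogFun σ a l x := by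
  induction N generalizing a l with
  | zero =>
    exact hasBoundedFourier_of_integrable (integrable_mul_powLogFun_away σ (by simpa using hal) h)
  | succ N ih =>
    push_cast at hal
    have hsm := h.deriv.contDiff_mul σ a l
    have hcs : HasCompactSupport fun x => _root_.deriv χ x * powLogFun σ a l x :=
      h.compact.mul_right
    have hl : ((l - 1 : ℕ) : ℝ) ≤ l := by exact_mod_cast Nat.sub_le l 1
    refine hasBoundedFourier_succ (c₁ := ((σ : ℤ) : ℂ) * a) (c₂ := ((σ : ℤ) : ℂ) * l)
      (fun ψ => ?_) (hasBoundedFourier_schwartz N (hcs.toSchwartzMap hsm))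
      (ih (a := a - 1) (l := l) ?_) (ih (a := a - 1) (l := l - 1) ?_)
    · rw [h.integral_deriv_mul]
      simp only [HasCompactSupport.toSchwartzMap_toFun]
      ring
    · simp only [Complex.sub_re, Complex.one_re]
      linarith
    · simp only [Complex.sub_re, Complex.one_re]
      linarith

/-! ### Splitting by a cut-off function and comparing the two transforms -/

theorem fourier_mulDist_away (σ : ℤˣ) (a : ℂ) (l : ℕ) {w : ℝ → ℝ} (hw : IsCutoff w)
    (φ : 𝓢(ℝ, ℂ)) :
    fourierD (mulDist (fun x => 1 - w x) (powLogDist σ a l)) φ =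
      fourierD (powLogDist σ a l) φ - fourierD (mulDist w (powLogDist σ a l)) φ := by
  have h2 := hw.complex.2.hasTemperateGrowth hw.complex.1
  change powLogDist σ a l (SchwartzMap.smulLeftCLM ℂ (fun x => ((1 - w x : ℝ) : ℂ)) (fourierS φ)) =
    powLogDist σ a l (fourierS φ) -
      powLogDist σ a l (SchwartzMap.smulLeftCLM ℂ (fun x => (w x : ℂ)) (fourierS φ))
  rw [← map_sub]
  congr 1
  ext x
  rw [SchwartzMap.smulLeftCLM_apply_apply hw.away.temperate, sub_apply,
    SchwartzMap.smulLeftCLM_apply_apply h2]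
  simp only [smul_eq_mul]
  push_cast
  ring

/-- If a function on `ℝ \ {0}` represents the Fourier transform of `(1 - w) x_±^a ln^l |x|` off
zero, it decreases rapidly. -/
theorem rapidlyDecreasing_of_represents (σ : ℤˣ) {a : ℂ} (ha : ∀ n : ℕ, a ≠ -((n : ℂ) + 1)) (l : ℕ)
    {w : ℝ → ℝ} (hw : IsCutoff w) {g : ℝ → ℂ} (hg : ContDiffOn ℝ ∞ g {0}ᶜ)
    (hrep : ∀ φ : 𝓢(ℝ, ℂ), (0 : ℝ) ∉ tsupport φ →
      fourierD (mulDist (fun x => 1 - w x) (powLogDist σ a l)) φ = ∫ ξ : ℝ, φ ξ * g ξ)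
    (hint : ∀ φ : 𝓢(ℝ, ℂ), (0 : ℝ) ∉ tsupport φ → Integrable fun ξ : ℝ => φ ξ * g ξ) :
    RapidlyDecreasing g := by
  intro n
  -- The extra m powers of ξ make Re a + l < (n + m) - 1; for |ξ| ≥ 1 a bound with |ξ|^{n+m} implies
  -- the one with |ξ|^n.
  obtain ⟨m, hm⟩ := exists_nat_gt (a.re + l + 1)
  obtain ⟨G, hG, ⟨M, hM⟩, hGrep⟩ := AwayCutoff.hasBoundedFourier σ (n + m) (a := a) (l := l)
    (by push_cast; have : (0 : ℝ) ≤ n := Nat.cast_nonneg n; linarith) hw.away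
  set N := n + m
  have hopen : IsOpen ({0}ᶜ : Set ℝ) := isOpen_compl_singleton
  have hcont : ContinuousOn (fun ξ : ℝ => (ξ : ℂ) ^ N * g ξ) {0}ᶜ :=
    (by fun_prop : Continuous fun ξ : ℝ => (ξ : ℂ) ^ N).continuousOn.mul hg.continuousOn
  -- Tested off zero, both G and ξ^N g represent ξ^N times the same transform, so they agree almost
  -- everywhere, and then everywhere off zero by continuity.
  have hae : ∀ᵐ ξ : ℝ, ξ ∈ ({0}ᶜ : Set ℝ) → G ξ - (ξ : ℂ) ^ N * g ξ = 0 := by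
    refine hopen.ae_eq_zero_of_integral_contDiff_smul_eq_zero
      ((hG.continuousOn.sub hcont).locallyIntegrableOn hopen.measurableSet) ?_
    intro θ hθ hθc hθs
    have hc : HasCompactSupport fun x => (θ x : ℂ) := hθc.comp_left Complex.ofReal_zero
    have hs : ContDiff ℝ ∞ fun x => (θ x : ℂ) := Complex.ofRealCLM.contDiff.comp hθ
    set φ : 𝓢(ℝ, ℂ) := hc.toSchwartzMap hs with hφ
    have hφx : ∀ x, φ x = θ x := fun x => rfl
    have hts : (0 : ℝ) ∉ tsupport φ := by
      intro h0
      have h1 : tsupport φ ⊆ tsupport θ := closure_mono fun x hx h => hx (by rw [hφx, h]; rfl)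
      exact hθs (h1 h0) rfl
    have hts' : (0 : ℝ) ∉ tsupport (mulX^[N] φ) := by
      intro h0
      have h1 : tsupport (mulX^[N] φ) ⊆ tsupport φ := by
        refine closure_mono fun x hx h => hx ?_
        rw [mulX_iterate_apply, h, mul_zero]
      exact hts (h1 h0)
    have e1 := hrep _ hts'
    change powLogDist σ a l (SchwartzMap.smulLeftCLM ℂ (fun x => ((1 - w x : ℝ) : ℂ))
      (fourierS (mulX^[N] φ))) = _ at e1
    rw [hw.away.powLogDist_apply σ ha, hGrep] at e1
    have i1 : Integrable fun ξ => φ ξ * G ξ :=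
      integrable_mul_of_poly_bound (N := 0) hG (by simpa using hM) φ
    have i2 := hint _ hts'
    have e2 : ∫ x : ℝ, θ x • (G x - (x : ℂ) ^ N * g x) =
        ∫ x : ℝ, (φ x * G x - mulX^[N] φ x * g x) := by
      refine integral_congr_ae (Eventually.of_forall fun x => ?_)
      simp only [mulX_iterate_apply, hφx, Complex.real_smul]
      ring
    rw [e2, integral_sub i1 i2, e1, sub_self]
  have heq : Set.EqOn G (fun ξ : ℝ => (ξ : ℂ) ^ N * g ξ) {0}ᶜ := by
    refine Measure.eqOn_open_of_ae_eq (μ := volume) ?_ hopen hG.continuousOn hcont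
    refine (ae_restrict_iff' hopen.measurableSet).2 ?_
    filter_upwards [hae] with ξ hξ hmem
    exact sub_eq_zero.1 (hξ hmem)
  refine Asymptotics.IsBigO.of_bound M ?_
  filter_upwards [tendsto_norm_cocompact_atTop.eventually_ge_atTop (1 : ℝ)] with ξ hξ
  rw [Real.norm_eq_abs] at hξ
  have hξ0 : ξ ≠ 0 := by
    rintro rfl
    norm_num at hξ
  have h1 : ‖G ξ‖ = |ξ| ^ N * ‖g ξ‖ := by
    rw [heq hξ0, norm_mul, norm_pow, Complex.norm_real, Real.norm_eq_abs]
  have h2 := hM ξ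
  rw [h1] at h2
  rw [Real.norm_of_nonneg (by positivity), ← div_eq_mul_inv, le_div_iff₀ (by positivity)]
  have h3 : |ξ| ^ n ≤ |ξ| ^ N := pow_le_pow_right₀ hξ (Nat.le_add_right n m)
  calc ‖g ξ‖ * |ξ| ^ n ≤ ‖g ξ‖ * |ξ| ^ N := mul_le_mul_of_nonneg_left h3 (norm_nonneg _)
    _ ≤ M := by linarith

/-- The Fourier transforms of the two parts of `x_±^a ln^l |x|` cut off at zero. -/
theorem exists_cutoff_expansion (σ : ℤˣ) {a : ℂ} (ha : ∀ n : ℕ, a ≠ -((n : ℂ) + 1)) (l : ℕ)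
    {w : ℝ → ℝ} (hw : IsCutoff w) :
    ∃ h g : ℝ → ℂ, ContDiff ℝ ∞ h ∧
      (∀ φ : 𝓢(ℝ, ℂ), Integrable (fun ξ : ℝ => φ ξ * h ξ) ∧
        fourierD (mulDist w (powLogDist σ a l)) φ = ∫ ξ : ℝ, φ ξ * h ξ) ∧
      (∀ ξ, h ξ - logPolyFun (-a - 1) l (coeffPlus σ a l) (coeffMinus σ a l) ξ = -g ξ) ∧
      ContDiffOn ℝ ∞ g {0}ᶜ ∧
      (∀ φ : 𝓢(ℝ, ℂ), (0 : ℝ) ∉ tsupport φ →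
        fourierD (mulDist (fun x => 1 - w x) (powLogDist σ a l)) φ = ∫ ξ : ℝ, φ ξ * g ξ) ∧
      RapidlyDecreasing g := by
  obtain ⟨h, h1, ⟨M, N, h2⟩, h3⟩ := hasSmoothFourier_mulDist σ a l hw
  set P := logPolyFun (-a - 1) l (coeffPlus σ a l) (coeffMinus σ a l) with hP
  have ih := integrable_mul_of_poly_bound h1.continuous h2
  have iP : ∀ φ : 𝓢(ℝ, ℂ), (0 : ℝ) ∉ tsupport φ → Integrable fun ξ : ℝ => φ ξ * P ξ :=
    integrable_mul_logPolyFun_off _ _ _ _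
  -- Off zero the full transform is P and that of the cut-off part is h, so P - h represents the
  -- transform of the remainder.
  have hg : ContDiffOn ℝ ∞ (fun ξ => P ξ - h ξ) {0}ᶜ :=
    (contDiffOn_logPolyFun _ _ _ _).sub h1.contDiffOn
  have hrep : ∀ φ : 𝓢(ℝ, ℂ), (0 : ℝ) ∉ tsupport φ →
      fourierD (mulDist (fun x => 1 - w x) (powLogDist σ a l)) φ =
        ∫ ξ : ℝ, φ ξ * (P ξ - h ξ) := by
    intro φ hφ
    rw [fourier_mulDist_away σ a l hw, fourier_powLogDist_off_zero σ ha l φ hφ, ← hP]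
    simp only [mul_sub]
    rw [integral_sub (iP φ hφ) (ih φ), ← h3 φ]
    rfl
  refine ⟨h, fun ξ => P ξ - h ξ, h1, fun φ => ⟨ih φ, h3 φ⟩, fun ξ => by ring, hg, hrep,
    rapidlyDecreasing_of_represents σ ha l hw hg hrep fun φ hφ => ?_⟩
  simp only [mul_sub]
  exact (iP φ hφ).sub (ih φ)

end LogFourier
end

/-! ### The main theorem -/

theorem mainTheorem6 (σ : ℤˣ) (a : ℂ) (ha : ∀ n : ℕ, a ≠ -((n : ℂ) + 1)) (l : ℕ) :
    -- the formula for the Fourier transform, for every admissible `k`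
    ((∃ k : ℕ, -1 < a.re + k) ∧
      ∀ k : ℕ, -1 < a.re + k → ∀ φ : 𝓢(ℝ, ℂ),
        AnalyticAt ℂ (fun z : ℂ => (∏ j ∈ Finset.range k, (z + j + 1))⁻¹ *
          LogFourier.fourierD (LogFourier.powLogDist σ (z + k) 0)
            (SchwartzMap.smulLeftCLM ℂ (fun ξ : ℝ => (ξ : ℂ) ^ k) φ)) a ∧
        LogFourier.fourierD (LogFourier.powLogDist σ a l) φ =
          (((σ : ℤ) : ℂ) * Complex.I) ^ k *
            iteratedDeriv l (fun z : ℂ => (∏ j ∈ Finset.range k, (z + j + 1))⁻¹ *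
              LogFourier.fourierD (LogFourier.powLogDist σ (z + k) 0)
                (SchwartzMap.smulLeftCLM ℂ (fun ξ : ℝ => (ξ : ℂ) ^ k) φ)) a) ∧
    -- the log-polyhomogeneous expansion
    (∃ cp cm : ℕ → ℂ, cp 0 ≠ 0 ∧
      (∀ j ≤ l, cm j = Complex.exp (-((σ : ℤ) : ℂ) * (-a - 1) * Real.pi * Complex.I) *
        ∑ i ∈ Finset.range (j + 1), ((l - i).choose (j - i) : ℂ) *
          (-((σ : ℤ) : ℂ) * Real.pi * Complex.I) ^ (j - i) * cp i) ∧
      LogFourier.IsBoundaryValue (-σ)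
        (fun z : ℂ => ∑ j ∈ Finset.range (l + 1),
          cp j * (z ^ (-a - 1) * Complex.log z ^ (l - j)))
        (LogFourier.fourierD (LogFourier.powLogDist σ a l)) ∧
      (∀ φ : 𝓢(ℝ, ℂ), (0 : ℝ) ∉ tsupport φ →
        LogFourier.fourierD (LogFourier.powLogDist σ a l) φ =
          ∫ ξ : ℝ, φ ξ * LogFourier.logPolyFun (-a - 1) l cp cm ξ) ∧
      ((∀ n : ℕ, a ≠ n) →
        LogFourier.fourierD (LogFourier.powLogDist σ a l) =
          ∑ j ∈ Finset.range (l + 1),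
            (cp j • LogFourier.powLogDist 1 (-a - 1) (l - j) +
              cm j • LogFourier.powLogDist (-1) (-a - 1) (l - j))) ∧
      -- the part near zero has the same expansion at infinity
      ∀ w : ℝ → ℝ, LogFourier.IsCutoff w →
        ∃ h : ℝ → ℂ, ContDiff ℝ ∞ h ∧
          (∀ φ : 𝓢(ℝ, ℂ),
            Integrable (fun ξ : ℝ => φ ξ * h ξ) ∧
            LogFourier.fourierD
              (LogFourier.mulDist w (LogFourier.powLogDist σ a l)) φ = ∫ ξ : ℝ, φ ξ * h ξ) ∧
          LogFourier.RapidlyDecreasing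
            (fun ξ => h ξ - LogFourier.logPolyFun (-a - 1) l cp cm ξ)) ∧
    -- the part away from zero
    (∀ w : ℝ → ℝ, LogFourier.IsCutoff w →
      ∃ g : ℝ → ℂ, ContDiffOn ℝ ∞ g {0}ᶜ ∧
        (∀ φ : 𝓢(ℝ, ℂ), (0 : ℝ) ∉ tsupport φ →
          LogFourier.fourierD
            (LogFourier.mulDist (fun x => 1 - w x) (LogFourier.powLogDist σ a l)) φ =
              ∫ ξ : ℝ, φ ξ * g ξ) ∧
        LogFourier.RapidlyDecreasing g) := by
  refine ⟨⟨LogFourier.exists_nat_re a,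
    fun k hk φ => LogFourier.fourier_powLogDist σ ha l k hk φ⟩,
    ⟨LogFourier.coeffPlus σ a l, LogFourier.coeffMinus σ a l, ?_,
    fun j _ => rfl, LogFourier.isBoundaryValue_holSymbol σ ha l,
    fun φ hφ => LogFourier.fourier_powLogDist_off_zero σ ha l φ hφ,
    fun hn => LogFourier.fourier_powLogDist_eq_sum σ ha l hn, fun w hw => ?_⟩, fun w hw => ?_⟩
  -- Here c_0^+ = (-1)^l C(a), which is nonzero because Γ has no zeros.
  · simp [LogFourier.coeffPlus, LogFourier.fourierCoeff_ne_zero σ ha]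
  · obtain ⟨h, g, h1, h2, h3, -, -, h6⟩ := LogFourier.exists_cutoff_expansion σ ha l hw
    refine ⟨h, h1, h2, fun n => ?_⟩
    simp only [h3]
    exact (h6 n).neg_left
  · obtain ⟨h, g, -, -, -, h4, h5, h6⟩ := LogFourier.exists_cutoff_expansion σ ha l hw
    exact ⟨g, h4, h5, h6⟩
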